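/- Let $\mathfrak g$ be one of the complex Lie superalgebras $\mathfrak{sl}(m+1,n+1)$ ($m,n\ge 0$), $\mathfrak{osp}(2,2n)$ ($n\ge 1$), $G(3)$, $F(4)$, with its standard simple system $\Pi$ (one odd simple root), invariant form $(\cdot,\cdot)$, positive even and odd roots $\Phi_0^+,\Phi_1^+$, odd roots $\Phi_1=\Phi_1^+\cup-\Phi_1^+$, set $\Pi_0\subseteq\Pi$ of even simple roots, and $\rho=\frac12\sum_{\alpha\in\Phi_0^+}\alpha-\frac12\sum_{\alpha\in\Phi_1^+}\alpha$. For $\mathfrak{sl}(m+1,n+1)$, weights and roots are written in terms of the functionals $\varepsilon_i,\delta_j$ on diagonal matrices. Put $\langle\mu,\alpha\rangle=2(\mu,\alpha)/(\alpha,\alpha)$ and let $s_\alpha$ be the reflection $\mu\mapsto\mu-\langle\mu,\alpha\rangle\alpha$. Let $\lambda$ be a dominant integral weight (the irreducible module $V(\lambda)$ is finite dimensional) that is singly atypical of type $\gamma$: $\gamma$ is isotropic, and it is the only root in $\Phi_1^+$ with $(\lambda+\rho,\gamma)=0$. Let $W$ be the group generated by the $s_\alpha$, $\alpha\in\Pi_0$,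 with length function $\ell$. For $w\in W$ write $\lambda+\rho-w(\lambda+\rho)=\sum_{\alpha\in\Pi_0}c_\alpha(w)\,\alpha$ with $c_\alpha(w)\in\mathbb Z_{\ge0}$, put $X(\lambda,w)=\prod_{\alpha\in\Pi_0}X_\alpha^{c_\alpha(w)}$, and let $$U(\lambda)=\sum_{w\in W}(-1)^{\ell(w)}\,\varphi(Z_{w\gamma})\,X(\lambda,w)\in\mathbb C[[Z_\beta:\beta\in\Phi_1]][[X_\alpha:\alpha\in\Pi_0]],\qquad \varphi(z)=\frac1{1+z},$$ where $X_\alpha=e^{-\alpha}$ and $Z_\beta=e^{-\beta}$ are independent formal variables. Then the numbers $\langle\lambda+\rho,\alpha\rangle$, $\alpha\in\Pi_0$, are natural numbers, and the coefficient in $\mathbb C[[Z_\beta:\beta\in\Phi_1]]$ of the monomial $X^\lambda=\prod_{\alpha\in\Pi_0}X_\alpha^{\langle\lambda+\rho,\alpha\rangle}$ in $-\log U(\lambda)=\sum_{k\ge1}(1-U(\lambda))^k/k$ is nonzero. For $G(3)$ and $F(4)$ the same holds, for every such $\lambda$, with $\varphi(z)=\frac12\cdot\frac{2+z}{1+z}$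 (the function that defines $U(\lambda)$ for the two special weights $\lambda_1,\lambda_2$). Moreover, in all these assertions $W$ may be replaced by the whole Weyl group $W_0$ of the even part $\mathfrak g_0$ (for $G(3)$ and $F(4)$ it is larger than $W$), with lengths taken with respect to the simple roots of $\Phi_0^+$, provided that $U(\lambda)$ is expanded in variables $X_\alpha=e^{-\alpha}$, $\alpha\in B$, where $B\supseteq\Pi_0$ is any linearly independent set such that $\lambda+\rho-w(\lambda+\rho)$ is a combination of $B$ with coefficients in $\mathbb Z_{\ge0}$ for all $w\in W_0$; the monomial $X^\lambda$ is still the product over $\Pi_0$. -/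

import Mathlib

noncomputable section

/-- The root data of a basic classical Lie superalgebra, in coordinates: weights are the vectors
`ι → ℂ`, and `gram` is the Gram matrix of the invariant form `(.,.)` on weights. The fields are the
positive even and odd roots and the even and odd simple roots of the standard simple system.
Only the four explicit families below are used. -/
structure SuperRootDatum (ι : Type) where
  gram : Matrix ι ι ℂ
  evenPos : Set (ι → ℂ)
  oddPos : Set (ι → ℂ)
  evenSimple : Set (ι → ℂ)
  oddSimple : Set (ι → ℂ)

/-! ### The four families -/

/-- `ε i`, resp. `δ j`, for the diagonal matrices of `gl(m+1|n+1)`. -/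
def slEps (m n : ℕ) (i : Fin (m + 1)) : Fin (m + 1) ⊕ Fin (n + 1) → ℂ := Pi.single (Sum.inl i) 1

def slDelta (m n : ℕ) (j : Fin (n + 1)) : Fin (m + 1) ⊕ Fin (n + 1) → ℂ := Pi.single (Sum.inr j) 1

/-- `sl(m+1, n+1)`. A weight is written as a linear combination of the `ε i` and `δ j`, which stands
for its restriction to the diagonal matrices of supertrace zero; two such combinations with the same
restriction differ by a multiple of `∑ ε i - ∑ δ j`, which is orthogonal to all roots. -/
def slDatum (m n : ℕ) : SuperRootDatum (Fin (m + 1) ⊕ Fin (n + 1)) where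
  gram := Matrix.diagonal (Sum.elim (fun _ => 1) (fun _ => -1))
  evenPos := {α | ∃ i k : Fin (m + 1), i < k ∧ α = slEps m n i - slEps m n k} ∪
    {α | ∃ j k : Fin (n + 1), j < k ∧ α = slDelta m n j - slDelta m n k}
  oddPos := {α | ∃ (i : Fin (m + 1)) (j : Fin (n + 1)), α = slEps m n i - slDelta m n j}
  evenSimple := {α | ∃ i : Fin m, α = slEps m n i.castSucc - slEps m n i.succ} ∪
    {α | ∃ j : Fin n, α = slDelta m n j.castSucc - slDelta m n j.succ}
  oddSimple := {slEps m n (Fin.last m) - slDelta m n 0}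

def ospEps (r : ℕ) : Unit ⊕ Fin (r + 1) → ℂ := Pi.single (Sum.inl ()) 1

def ospDelta (r : ℕ) (j : Fin (r + 1)) : Unit ⊕ Fin (r + 1) → ℂ := Pi.single (Sum.inr j) 1

/-- `osp(2, 2n)` for `n = r + 1`. -/
def ospDatum (r : ℕ) : SuperRootDatum (Unit ⊕ Fin (r + 1)) where
  gram := Matrix.diagonal (Sum.elim (fun _ => 1) (fun _ => -1))
  evenPos := {α | ∃ j : Fin (r + 1), α = (2 : ℂ) • ospDelta r j} ∪
    {α | ∃ j k : Fin (r + 1), j < k ∧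
      (α = ospDelta r j - ospDelta r k ∨ α = ospDelta r j + ospDelta r k)}
  oddPos := {α | ∃ j : Fin (r + 1), α = ospEps r + ospDelta r j ∨ α = ospEps r - ospDelta r j}
  evenSimple := {α | ∃ j : Fin r, α = ospDelta r j.castSucc - ospDelta r j.succ} ∪
    {(2 : ℂ) • ospDelta r (Fin.last r)}
  oddSimple := {ospEps r - ospDelta r 0}

/-- `ε₁, ε₂, ε₃` for `G(3)`, where `ε₁ + ε₂ + ε₃ = 0`, in the basis `ε₁, ε₂, δ`. -/
def g3Eps : Fin 3 → (Fin 3 → ℂ) := ![![1, 0, 0], ![0, 1, 0], ![-1, -1, 0]]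

def g3Delta : Fin 3 → ℂ := ![0, 0, 1]

/-- `G(3)`. -/
def g3Datum : SuperRootDatum (Fin 3) where
  gram := !![2, -1, 0; -1, 2, 0; 0, 0, -2]
  evenPos := {g3Eps 0, g3Eps 1, -g3Eps 2, g3Eps 1 - g3Eps 0, g3Eps 0 - g3Eps 2, g3Eps 1 - g3Eps 2,
    (2 : ℂ) • g3Delta}
  oddPos := {g3Delta} ∪ {α | ∃ i : Fin 3, α = g3Eps i + g3Delta ∨ α = -g3Eps i + g3Delta}
  evenSimple := {g3Eps 0, g3Eps 1 - g3Eps 0}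
  oddSimple := {g3Eps 2 + g3Delta}

/-- `ε₁, ε₂, ε₃` for `F(4)`, in the basis `ε₁, ε₂, ε₃, δ`. -/
def f4Eps (i : Fin 3) : Fin 4 → ℂ := Pi.single i.castSucc 1

def f4Delta : Fin 4 → ℂ := Pi.single 3 1

/-- `F(4)`. -/
def f4Datum : SuperRootDatum (Fin 4) where
  gram := Matrix.diagonal ![1, 1, 1, -3]
  evenPos := {α | ∃ i : Fin 3, α = f4Eps i} ∪
    {α | ∃ i j : Fin 3, i < j ∧ (α = f4Eps i - f4Eps j ∨ α = f4Eps i + f4Eps j)} ∪ {f4Delta}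
  oddPos := {α | ∃ s : Fin 3 → ℂ, (∀ i, s i = 1 ∨ s i = -1) ∧
    α = (1 / 2 : ℂ) • (∑ i, s i • f4Eps i + f4Delta)}
  evenSimple := {f4Eps 0 - f4Eps 1, f4Eps 1 - f4Eps 2, f4Eps 2}
  oddSimple := {(1 / 2 : ℂ) • (-f4Eps 0 - f4Eps 1 - f4Eps 2 + f4Delta)}

/-! ### The coefficients in the character formulae -/

/-- The coefficient `1 / (1 + z)` of the generic character formula. -/
def genericFactor {σ : Type} (z : MvPowerSeries σ ℂ) : MvPowerSeries σ ℂ := (1 + z)⁻¹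

/-- The coefficient `(1 / 2) (2 + z) / (1 + z)` of the character formula for the special weights. -/
def specialFactor {σ : Type} (z : MvPowerSeries σ ℂ) : MvPowerSeries σ ℂ :=
  (1 / 2 : ℂ) • ((2 + z) * (1 + z)⁻¹)

namespace SuperRootDatum

variable {ι : Type} [Fintype ι]

/-! ### Form, Weyl vector, atypicality -/

/-- The bilinear form `(μ, ν)` on weights. -/
def form (D : SuperRootDatum ι) (μ ν : ι → ℂ) : ℂ := μ ⬝ᵥ (D.gram.mulVec ν)

/-- `⟨μ, α⟩ = 2 (μ, α) / (α, α)`. -/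
def pairing (D : SuperRootDatum ι) (μ α : ι → ℂ) : ℂ := 2 * D.form μ α / D.form α α

/-- The Weyl vector: half the sum of the positive even roots minus half the sum of the positive odd
roots (both sets are finite). -/
def rho (D : SuperRootDatum ι) : ι → ℂ :=
  (1 / 2 : ℂ) • (∑ᶠ α ∈ D.evenPos, α) - (1 / 2 : ℂ) • (∑ᶠ α ∈ D.oddPos, α)

/-- `lam` is singly atypical of type `γ`: the root `γ` is isotropic and is the only positive odd
root orthogonal to `lam + ρ`. -/
def IsSinglyAtypical (D : SuperRootDatum ι) (lam γ : ι → ℂ) : Prop :=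
  γ ∈ D.oddPos ∧ D.form γ γ = 0 ∧ D.form (lam + D.rho) γ = 0 ∧
    ∀ γ' ∈ D.oddPos, D.form (lam + D.rho) γ' = 0 → γ' = γ

/-! ### Finite dimensional irreducible highest weight modules -/

/-- A representation, on a `ℤ/2`-graded vector space with grading operator `P`, of the Lie superalgebra
with the given standard simple system, in Chevalley generators: `E α` and `F α`, for simple roots
`α`, are root vectors of weights `α` and `-α`, and `H μ` is the element of the Cartan subalgebra that
the form identifies with the weight `μ`, so that a weight `ν` takes the value `(μ, ν)` on it.
The values of `E` and `F` at other vectors play no role. There is only one odd simple root, so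
`E α` and `F β` with `α ≠ β` are never both odd, and their superbracket is the commutator. The Serre relations need not be listed: the
ideal that they generate meets the Cartan subalgebra in zero, and such an ideal
acts as zero on every irreducible highest weight module. -/
structure Rep (D : SuperRootDatum ι) (V : Type) [AddCommGroup V] [Module ℂ V] where
  P : Module.End ℂ V
  H : (ι → ℂ) →ₗ[ℂ] Module.End ℂ V
  E : (ι → ℂ) → Module.End ℂ V
  F : (ι → ℂ) → Module.End ℂ V
  P_sq : P * P = 1
  P_H : ∀ μ, P * H μ = H μ * P
  P_E_even : ∀ α ∈ D.evenSimple, P * E α = E α * P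
  P_F_even : ∀ α ∈ D.evenSimple, P * F α = F α * P
  P_E_odd : ∀ α ∈ D.oddSimple, P * E α = -(E α * P)
  P_F_odd : ∀ α ∈ D.oddSimple, P * F α = -(F α * P)
  H_H : ∀ μ ν, H μ * H ν = H ν * H μ
  H_E : ∀ μ, ∀ α ∈ D.evenSimple ∪ D.oddSimple, H μ * E α - E α * H μ = D.form μ α • E α
  H_F : ∀ μ, ∀ α ∈ D.evenSimple ∪ D.oddSimple, H μ * F α - F α * H μ = -(D.form μ α • F α)
  E_F_even : ∀ α ∈ D.evenSimple, E α * F α - F α * E α = H α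
  E_F_odd : ∀ α ∈ D.oddSimple, E α * F α + F α * E α = H α
  E_F_ne : ∀ α ∈ D.evenSimple ∪ D.oddSimple, ∀ β ∈ D.evenSimple ∪ D.oddSimple, α ≠ β →
    E α * F β - F β * E α = 0

/-- Irreducibility: the only graded subspaces stable under all generators are `0` and `V`. -/
def Rep.IsIrreducible {D : SuperRootDatum ι} {V : Type} [AddCommGroup V] [Module ℂ V]
    (R : D.Rep V) : Prop :=
  Nontrivial V ∧ ∀ N : Submodule ℂ V, (∀ x ∈ N, R.P x ∈ N) → (∀ μ, ∀ x ∈ N, R.H μ x ∈ N) →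
    (∀ α ∈ D.evenSimple ∪ D.oddSimple, ∀ x ∈ N, R.E α x ∈ N ∧ R.F α x ∈ N) → N = ⊥ ∨ N = ⊤

/-- `v` is a highest weight vector of weight `lam`. -/
def Rep.IsHighestWeightVector {D : SuperRootDatum ι} {V : Type} [AddCommGroup V] [Module ℂ V]
    (R : D.Rep V) (lam : ι → ℂ) (v : V) : Prop :=
  v ≠ 0 ∧ (∀ α ∈ D.evenSimple ∪ D.oddSimple, R.E α v = 0) ∧
    ∀ μ, R.H μ v = D.form μ lam • v

/-- `lam` is dominant integral: the irreducible module of highest weight `lam` is finite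
dimensional. -/
def IsDominantIntegral (D : SuperRootDatum ι) (lam : ι → ℂ) : Prop :=
  ∃ (V : Type) (_ : AddCommGroup V) (_ : Module ℂ V) (_ : FiniteDimensional ℂ V) (R : D.Rep V),
    R.IsIrreducible ∧ ∃ v : V, R.IsHighestWeightVector lam v

/-! ### Reflection groups -/

/-- The reflection `s_α`. -/
def sRefl (D : SuperRootDatum ι) (α : ι → ℂ) : Module.End ℂ (ι → ℂ) where
  toFun v := v - D.pairing v α • α
  map_add' v w := by
    simp only [pairing, form, add_dotProduct, mul_add, add_div, add_smul]; abel
  map_smul' c v := by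
    simp only [pairing, form, smul_dotProduct, smul_eq_mul, RingHom.id_apply, smul_sub, smul_smul]
    congr 2; ring

/-- The group generated by the reflections in the elements of `S` (reflections are involutions, so
the monoid that they generate is a group). -/
def weyl (D : SuperRootDatum ι) (S : Set (ι → ℂ)) : Submonoid (Module.End ℂ (ι → ℂ)) :=
  Submonoid.closure (D.sRefl '' S)

/-- The length of `w` with respect to the reflections in the elements of `S`. -/
def length (D : SuperRootDatum ι) (S : Set (ι → ℂ)) (w : Module.End ℂ (ι → ℂ)) : ℕ :=
  sInf {k | ∃ l : List (ι → ℂ), (∀ α ∈ l, α ∈ S) ∧ l.length = k ∧ (l.map D.sRefl).prod = w}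

/-- The simple roots of the positive system `evenPos` of the even part: the positive even roots that
are not sums of two positive even roots. They generate the Weyl group of the even part. -/
def evenBase (D : SuperRootDatum ι) : Set (ι → ℂ) :=
  {α | α ∈ D.evenPos ∧ ¬∃ β ∈ D.evenPos, ∃ γ ∈ D.evenPos, α = β + γ}

/-! ### The normalized numerator `U(lam)` and the coefficient of `X^lam` in `-log U(lam)` -/

/-- All odd roots. -/
def oddRoots (D : SuperRootDatum ι) : Set (ι → ℂ) := {γ | γ ∈ D.oddPos ∨ -γ ∈ D.oddPos}

/-- The ring of formal power series over `ℂ` in the variables `Z_γ = e^{-γ}`, for `γ` an odd root,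
and `X_α = e^{-α}`, for `α ∈ B`. -/
abbrev SeriesRing (D : SuperRootDatum ι) (B : Set (ι → ℂ)) : Type :=
  MvPowerSeries (D.oddRoots ⊕ B) ℂ

open Classical in
/-- The variable `Z_γ`, for an odd root `γ`. -/
def varZ (D : SuperRootDatum ι) (B : Set (ι → ℂ)) (γ : ι → ℂ) : D.SeriesRing B :=
  if h : γ ∈ D.oddRoots then MvPowerSeries.X (Sum.inl ⟨γ, h⟩) else 0

/-- The exponents `c` are those of `e^{w(lam+ρ)-(lam+ρ)}` in the variables `X_α = e^{-α}`, `α ∈ B`: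
`lam + ρ - w(lam + ρ) = ∑ c_α α`. -/
def IsExponent (D : SuperRootDatum ι) (B : Set (ι → ℂ)) (lam : ι → ℂ)
    (w : Module.End ℂ (ι → ℂ)) (c : B →₀ ℕ) : Prop :=
  lam + D.rho - w (lam + D.rho) = c.sum fun α k => (k : ℂ) • (α : ι → ℂ)

open Classical in
/-- The exponents `c_α(w)`, `α ∈ B`. -/
def exponent (D : SuperRootDatum ι) (B : Set (ι → ℂ)) (lam : ι → ℂ)
    (w : Module.End ℂ (ι → ℂ)) : B →₀ ℕ :=
  if h : ∃ c, D.IsExponent B lam w c then h.choose else 0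

/-- The monomial `X(lam, w) = ∏ X_α ^ c_α(w)`. -/
def monX (D : SuperRootDatum ι) (B : Set (ι → ℂ)) (lam : ι → ℂ)
    (w : Module.End ℂ (ι → ℂ)) : D.SeriesRing B :=
  (D.exponent B lam w).prod fun α k => MvPowerSeries.X (Sum.inr α) ^ k

/-- `U(lam) = ∑_w (-1)^{ℓ(w)} φ(Z_{wγ}) X(lam, w)`, the sum over the group generated by the
reflections in `S`, expanded in the variables `X_α`, `α ∈ B`. -/
def U (D : SuperRootDatum ι) (S B : Set (ι → ℂ)) (φ : D.SeriesRing B → D.SeriesRing B)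
    (lam γ : ι → ℂ) : D.SeriesRing B :=
  ∑ᶠ w ∈ D.weyl S, (-1) ^ D.length S w * φ (D.varZ B (w γ)) * D.monX B lam w

end SuperRootDatum

/-- The formal logarithm `log f = -∑_{k ≥ 1} (1 - f)^k / k` of a power series with constant term `1`.
Each power `(1 - f)^k` has no terms of degree less than `k`, so the coefficient at an exponent `d` is
the finite sum over `k` up to the degree of `d`. -/
def formalLog {σ : Type} (f : MvPowerSeries σ ℂ) : MvPowerSeries σ ℂ := fun d =>
  -∑ k ∈ Finset.Icc 1 d.degree, MvPowerSeries.coeff d ((1 - f) ^ k) / (k : ℂ)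

/-- The coefficient, itself a power series in the variables `z`, of the monomial `x^a` in a power
series in the variables `z` and `x`. -/
def coeffX {σ τ : Type} (f : MvPowerSeries (σ ⊕ τ) ℂ) (a : τ →₀ ℕ) : MvPowerSeries σ ℂ :=
  fun d => MvPowerSeries.coeff (Finsupp.sumElim d a) f

namespace SuperRootDatum

variable {ι : Type} [Fintype ι]

open Classical in
/-- The numbers `⟨lam + ρ, α⟩`, for even simple roots `α`, are natural numbers, and the coefficient of
`X^lam = ∏ X_α ^ ⟨lam + ρ, α⟩` (product over the even simple roots `α`) in `-log U(lam)` is not zero.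
-/
def HasNonzeroCoeff (D : SuperRootDatum ι) (S B : Set (ι → ℂ)) (φ : D.SeriesRing B → D.SeriesRing B)
    (lam γ : ι → ℂ) : Prop :=
  ∃ a : B →₀ ℕ,
    (∀ α : B, (a α : ℂ) = if (α : ι → ℂ) ∈ D.evenSimple then D.pairing (lam + D.rho) α else 0) ∧
    coeffX (-formalLog (D.U S B φ lam γ)) a ≠ 0

/-- `B` contains the even simple roots, is linearly independent, and is such that every
`e^{w(lam+ρ)-(lam+ρ)}`, for `w` in the Weyl group of the even part, is a monomial in the
`X_α = e^{-α}`, `α ∈ B`. -/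
def IsExpansionSet (D : SuperRootDatum ι) (lam : ι → ℂ) (B : Set (ι → ℂ)) : Prop :=
  D.evenSimple ⊆ B ∧ LinearIndependent ℂ (fun α : B => (α : ι → ℂ)) ∧
    ∀ w ∈ D.weyl D.evenBase, ∃ c, D.IsExponent B lam w c

end SuperRootDatum

end

/-! Write Λ = lam + ρ and k_α = ⟨Λ, α⟩ for the even simple roots α. By sl₂-theory ⟨lam, α⟩ is a
natural number, and ⟨ρ, α⟩ = 1, so every k_α is positive.

To find the coefficient of Z_γ X^λ in -log U, only the monomials of U that divide Z_γ X^λ matter.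
Along a reduced word of w, the difference Λ - wΛ grows at each letter by k_α times a positive root.
It stays below ∑ k_α α only if w is the product of the s_α, α ∈ I, for a set I of pairwise
orthogonal simple roots, that is, an independent set of the Dynkin diagram
(`IsPositiveSystem.exists_eq_orthRefl`). For such w the monomial X(lam, w) is the product over I of
Y_α = X_α^{k_α}. The square of Y_α does not divide X^λ, and wγ = γ exactly when I avoids the set N
of simple roots not orthogonal to γ. Since φ(z) = 1 + cz + O(z²) with c = -1 or c = -1/2, this gives
U ≡ Q + c Z_γ Q', where Q and Q' are the signed independence polynomials of the diagram and of the
diagram with N removed, in the square-zero variables Y_α.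

The part of -log U linear in Z_γ is therefore -c Z_γ Q'/Q. Deleting vertices one at a time
(`indepQuot_eq_mul`) shows that Q'/Q has natural coefficients, and that the product of all Y_α
occurs in it as soon as every component of the diagram meets N (`indepQuot_sub_prod_mem`). Hence the
coefficient is -c times a positive integer (`coeff_formalLog_ne_zero`). That γ touches every
component is checked for each family.

For G(3) and F(4) the even part has one more simple root d, orthogonal to Π₀, and W₀ is W extended
by s_d. An element u s_d moves Λ out of the coset of the span of Π₀ because ⟨Λ, d⟩ ≠ 0, so it cannot
contribute to X^λ. If ⟨Λ, d⟩ were zero, then changing the sign of the component of γ orthogonal to d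
would give a second atypical root. -/

namespace SuperRootDatum

variable {ι : Type} [Fintype ι]

/-! ### Reflections -/

/-- The linear form `⟨·, α⟩`. -/
noncomputable def pairingHom (D : SuperRootDatum ι) (α : ι → ℂ) : (ι → ℂ) →ₗ[ℂ] ℂ where
  toFun v := D.pairing v α
  map_add' v w := by simp only [pairing, form, add_dotProduct, mul_add, add_div]
  map_smul' c v := by
    simp only [pairing, form, smul_dotProduct, smul_eq_mul, RingHom.id_apply]; ring

@[simp] lemma pairingHom_apply (D : SuperRootDatum ι) (α v : ι → ℂ) :
    D.pairingHom α v = D.pairing v α := rfl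

lemma sRefl_apply (D : SuperRootDatum ι) (α v : ι → ℂ) :
    D.sRefl α v = v - D.pairing v α • α := rfl

lemma form_sub_smul_left (D : SuperRootDatum ι) (x y z : ι → ℂ) (c : ℂ) :
    D.form (x - c • y) z = D.form x z - c * D.form y z := by
  simp only [form, sub_dotProduct, smul_dotProduct, smul_eq_mul]

lemma form_sub_smul_right (D : SuperRootDatum ι) (x y z : ι → ℂ) (c : ℂ) :
    D.form x (y - c • z) = D.form x y - c * D.form x z := by
  simp only [form, Matrix.mulVec_sub, Matrix.mulVec_smul, dotProduct_sub, dotProduct_smul,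
    smul_eq_mul]

lemma form_comm {D : SuperRootDatum ι} (hD : D.gram.IsSymm) (x y : ι → ℂ) :
    D.form x y = D.form y x := by
  unfold form
  rw [Matrix.dotProduct_mulVec, dotProduct_comm, ← Matrix.mulVec_transpose, hD.eq]

lemma pairing_self {D : SuperRootDatum ι} {α : ι → ℂ} (h : D.form α α ≠ 0) :
    D.pairing α α = 2 := by
  unfold pairing; field_simp

lemma sRefl_self {D : SuperRootDatum ι} {α : ι → ℂ} (h : D.form α α ≠ 0) :
    D.sRefl α α = -α := by
  rw [sRefl_apply, pairing_self h, two_smul]; abel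

lemma sRefl_mul_self {D : SuperRootDatum ι} {α : ι → ℂ} (h : D.form α α ≠ 0) :
    D.sRefl α * D.sRefl α = 1 := by
  refine LinearMap.ext fun v => ?_
  rw [Module.End.mul_apply, Module.End.one_apply, sRefl_apply D α v, map_sub, map_smul,
    sRefl_self h, sRefl_apply, smul_neg]
  abel

lemma form_sRefl {D : SuperRootDatum ι} (hD : D.gram.IsSymm) {α : ι → ℂ} (h : D.form α α ≠ 0)
    (x y : ι → ℂ) : D.form (D.sRefl α x) (D.sRefl α y) = D.form x y := by
  simp only [sRefl_apply, form_sub_smul_left, form_sub_smul_right, pairing]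
  rw [form_comm hD α y]
  field_simp
  ring

lemma det_sRefl {D : SuperRootDatum ι} {α : ι → ℂ} (h : D.form α α ≠ 0) :
    LinearMap.det (D.sRefl α) = -1 := by
  have : D.sRefl α = LinearMap.transvection (D.pairingHom α) (-α) := by
    refine LinearMap.ext fun v => ?_
    simp [sRefl_apply, LinearMap.transvection.apply, sub_eq_add_neg]
  rw [this, LinearMap.transvection.det, map_neg, pairingHom_apply, pairing_self h]
  norm_num

lemma sRefl_mem_weyl (D : SuperRootDatum ι) {S : Set (ι → ℂ)} {α : ι → ℂ} (h : α ∈ S) :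
    D.sRefl α ∈ D.weyl S := Submonoid.subset_closure ⟨α, h, rfl⟩

lemma form_weyl {D : SuperRootDatum ι} (hD : D.gram.IsSymm) {S : Set (ι → ℂ)}
    (hS : ∀ α ∈ S, D.form α α ≠ 0) {w : Module.End ℂ (ι → ℂ)} (hw : w ∈ D.weyl S)
    (x y : ι → ℂ) : D.form (w x) (w y) = D.form x y := by
  induction hw using Submonoid.closure_induction generalizing x y with
  | mem _ h => obtain ⟨α, hα, rfl⟩ := h; exact form_sRefl hD (hS α hα) x y
  | one => rfl
  | mul u v _ _ hu hv => rw [Module.End.mul_apply, Module.End.mul_apply, hu, hv]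

/-- Conjugating a reflection by an isometry reflects in the image of the root. The form without
inverses suits `weyl`, which is only a submonoid. -/
lemma weyl_mul_sRefl {D : SuperRootDatum ι} (hD : D.gram.IsSymm) {S : Set (ι → ℂ)}
    (hS : ∀ α ∈ S, D.form α α ≠ 0) {w : Module.End ℂ (ι → ℂ)} (hw : w ∈ D.weyl S)
    (α : ι → ℂ) : w * D.sRefl α = D.sRefl (w α) * w := by
  refine LinearMap.ext fun v => ?_
  simp only [Module.End.mul_apply, sRefl_apply, map_sub, map_smul, pairing, form_weyl hD hS hw]

lemma exists_word (D : SuperRootDatum ι) {S : Set (ι → ℂ)} {w : Module.End ℂ (ι → ℂ)}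
    (hw : w ∈ D.weyl S) :
    ∃ l : List (ι → ℂ), (∀ α ∈ l, α ∈ S) ∧ (l.map D.sRefl).prod = w := by
  induction hw using Submonoid.closure_induction with
  | mem _ h => obtain ⟨α, hα, rfl⟩ := h; exact ⟨[α], by simpa using hα, by simp⟩
  | one => exact ⟨[], by simp, by simp⟩
  | mul u v _ _ hu hv =>
    obtain ⟨l, hl, rfl⟩ := hu
    obtain ⟨l', hl', rfl⟩ := hv
    refine ⟨l ++ l', fun α h => ?_, by simp⟩
    rcases List.mem_append.1 h with h | h
    exacts [hl α h, hl' α h]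

lemma word_mem_weyl (D : SuperRootDatum ι) {S : Set (ι → ℂ)} {l : List (ι → ℂ)}
    (hl : ∀ α ∈ l, α ∈ S) : (l.map D.sRefl).prod ∈ D.weyl S := by
  refine Submonoid.list_prod_mem _ fun x hx => ?_
  obtain ⟨α, hα, rfl⟩ := List.mem_map.1 hx
  exact D.sRefl_mem_weyl (hl α hα)

/-- Recovers the group structure of the submonoid `weyl`: the generators are involutions. -/
lemma exists_weyl_inv {D : SuperRootDatum ι} {S : Set (ι → ℂ)}
    (hS : ∀ α ∈ S, D.form α α ≠ 0) {w : Module.End ℂ (ι → ℂ)} (hw : w ∈ D.weyl S) :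
    ∃ u ∈ D.weyl S, u * w = 1 ∧ w * u = 1 := by
  induction hw using Submonoid.closure_induction with
  | mem _ h =>
    obtain ⟨α, hα, rfl⟩ := h
    exact ⟨_, D.sRefl_mem_weyl hα, sRefl_mul_self (hS α hα), sRefl_mul_self (hS α hα)⟩
  | one => exact ⟨1, one_mem _, by simp, by simp⟩
  | mul x y _ _ hx hy =>
    obtain ⟨u, hu, h1, h2⟩ := hx
    obtain ⟨v, hv, h3, h4⟩ := hy
    refine ⟨v * u, mul_mem hv hu, ?_, ?_⟩
    · rw [mul_assoc, ← mul_assoc u, h1, one_mul, h3]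
    · rw [mul_assoc, ← mul_assoc y, h4, one_mul, h2]

/-- The sign of `w` is its determinant. -/
lemma neg_one_pow_length {D : SuperRootDatum ι} {S : Set (ι → ℂ)}
    (hS : ∀ α ∈ S, D.form α α ≠ 0) {w : Module.End ℂ (ι → ℂ)} (hw : w ∈ D.weyl S) :
    ((-1) ^ D.length S w : ℂ) = LinearMap.det w := by
  have key : ∀ l : List (ι → ℂ), (∀ α ∈ l, α ∈ S) →
      LinearMap.det (l.map D.sRefl).prod = (-1) ^ l.length := by
    intro l
    induction l with
    | nil => simp
    | cons α l ih =>
      intro hl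
      rw [List.map_cons, List.prod_cons, map_mul, ih fun β hβ => hl β (List.mem_cons_of_mem _ hβ),
        det_sRefl (hS α (hl α List.mem_cons_self)), List.length_cons, pow_succ, mul_comm]
  have hne : {k | ∃ l : List (ι → ℂ), (∀ α ∈ l, α ∈ S) ∧ l.length = k ∧
      (l.map D.sRefl).prod = w}.Nonempty := by
    obtain ⟨l, hl, h⟩ := D.exists_word hw
    exact ⟨_, l, hl, rfl, h⟩
  obtain ⟨l, hl, hk, h⟩ := Nat.sInf_mem hne
  rw [← h, key l hl, hk, h]
  rfl

/-! ### Positive systems -/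

/-- `R` is a positive system of roots whose simple roots are the even simple roots of `D`. -/
structure IsPositiveSystem (D : SuperRootDatum ι) (R : Set (ι → ℂ)) : Prop where
  symm : D.gram.IsSymm
  finite : R.Finite
  simple_subset : D.evenSimple ⊆ R
  subset_closure : R ⊆ AddSubmonoid.closure D.evenSimple
  sRefl_mem : ∀ β ∈ D.evenSimple, ∀ x ∈ R, x ≠ β → D.sRefl β x ∈ R
  form_ne_zero : ∀ α ∈ D.evenSimple, D.form α α ≠ 0
  exists_coweight : ∀ α ∈ D.evenSimple, ∃ f : (ι → ℂ) →ₗ[ℂ] ℂ, f α = 1 ∧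
    ∀ β ∈ D.evenSimple, β ≠ α → f β = 0

namespace IsPositiveSystem

variable {D : SuperRootDatum ι} {R : Set (ι → ℂ)}

lemma nat_coweight {α : ι → ℂ} {f : (ι → ℂ) →ₗ[ℂ] ℂ} (h1 : f α = 1)
    (h0 : ∀ β ∈ D.evenSimple, β ≠ α → f β = 0) {x : ι → ℂ}
    (hx : x ∈ AddSubmonoid.closure D.evenSimple) : ∃ n : ℕ, f x = n := by
  induction hx using AddSubmonoid.closure_induction with
  | mem β hβ =>
    by_cases h : β = α
    · exact ⟨1, by rw [h, h1]; simp⟩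
    · exact ⟨0, by rw [h0 β hβ h]; simp⟩
  | zero => exact ⟨0, by simp⟩
  | add x y _ _ hx hy =>
    obtain ⟨a, ha⟩ := hx
    obtain ⟨b, hb⟩ := hy
    exact ⟨a + b, by rw [map_add, ha, hb]; push_cast; rfl⟩

lemma neg_notMem (h : D.IsPositiveSystem R) {x : ι → ℂ} (hx : x ∈ R) (hx0 : x ≠ 0) : -x ∉ R := by
  intro hnx
  -- A nonzero sum of simple roots has a nonzero coordinate. Coordinates are natural numbers, so
  -- nothing cancels in a sum; applied to `x` and `-x` this is contradictory.
  have key : ∀ y ∈ AddSubmonoid.closure D.evenSimple, y ≠ 0 → ∃ α ∈ D.evenSimple,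
      ∀ f : (ι → ℂ) →ₗ[ℂ] ℂ, f α = 1 → (∀ β ∈ D.evenSimple, β ≠ α → f β = 0) → f y ≠ 0 := by
    intro y hy
    induction hy using AddSubmonoid.closure_induction with
    | mem β hβ => exact fun _ => ⟨β, hβ, fun f h1 _ => by rw [h1]; exact one_ne_zero⟩
    | zero => exact fun h => absurd rfl h
    | add x y hx hy ihx ihy =>
      intro hxy
      by_cases hx0 : x = 0
      · rw [hx0, zero_add] at hxy ⊢
        exact ihy hxy
      · obtain ⟨α, hα, h⟩ := ihx hx0
        refine ⟨α, hα, fun f h1 h0 hf => h f h1 h0 ?_⟩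
        obtain ⟨a, ha⟩ := nat_coweight h1 h0 hx
        obtain ⟨b, hb⟩ := nat_coweight h1 h0 hy
        rw [map_add, ha, hb] at hf
        have : a + b = 0 := by exact_mod_cast hf
        rw [ha]; norm_cast; omega
  obtain ⟨α, hα, hk⟩ := key x (h.subset_closure hx) hx0
  obtain ⟨f, h1, h0⟩ := h.exists_coweight α hα
  obtain ⟨a, ha⟩ := nat_coweight h1 h0 (h.subset_closure hx)
  obtain ⟨b, hb⟩ := nat_coweight h1 h0 (h.subset_closure hnx)
  have : a + b = 0 := by
    rw [map_neg, ha] at hb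
    have : (a + b : ℂ) = 0 := by rw [← hb]; ring
    exact_mod_cast this
  apply hk f h1 h0
  rw [ha]; norm_cast; omega

lemma ne_zero_of_mem (h : D.IsPositiveSystem R) {α : ι → ℂ} (hα : α ∈ D.evenSimple) : α ≠ 0 := by
  rintro rfl
  exact h.form_ne_zero _ hα (by simp [form])

lemma neg_simple_notMem (h : D.IsPositiveSystem R) {α : ι → ℂ} (hα : α ∈ D.evenSimple) :
    -α ∉ R := h.neg_notMem (h.simple_subset hα) (h.ne_zero_of_mem hα)

/-- The exchange condition. -/
lemma exchange (h : D.IsPositiveSystem R) {α : ι → ℂ} (hα : α ∈ D.evenSimple) :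
    ∀ l : List (ι → ℂ), (∀ β ∈ l, β ∈ D.evenSimple) → (l.map D.sRefl).prod α ∉ R →
      ∃ l' : List (ι → ℂ), (∀ β ∈ l', β ∈ D.evenSimple) ∧ l'.length + 1 = l.length ∧
        (l'.map D.sRefl).prod = (l.map D.sRefl).prod * D.sRefl α := by
  intro l
  induction l with
  | nil => intro _ hn; exact absurd (h.simple_subset hα) (by simpa using hn)
  | cons β l ih =>
    intro hl hn
    have hl' : ∀ γ ∈ l, γ ∈ D.evenSimple := fun γ hγ => hl γ (List.mem_cons_of_mem _ hγ)
    have hβ : β ∈ D.evenSimple := hl β List.mem_cons_self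
    rw [List.map_cons, List.prod_cons] at hn ⊢
    by_cases hv : (l.map D.sRefl).prod α ∈ R
    · have heq : (l.map D.sRefl).prod α = β := by
        by_contra hne
        exact hn (h.sRefl_mem β hβ _ hv hne)
      refine ⟨l, hl', rfl, ?_⟩
      rw [mul_assoc, weyl_mul_sRefl h.symm h.form_ne_zero (D.word_mem_weyl hl'), heq,
        ← mul_assoc, sRefl_mul_self (h.form_ne_zero β hβ), one_mul]
    · obtain ⟨l', h1, h2, h3⟩ := ih hl' hv
      refine ⟨β :: l', ?_, by simp [h2], by simp [h3, mul_assoc]⟩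
      intro γ hγ
      rcases List.mem_cons.1 hγ with rfl | hγ
      exacts [hβ, h1 γ hγ]

/-- Induction along reduced words. -/
lemma weyl_induction (h : D.IsPositiveSystem R) {P : Module.End ℂ (ι → ℂ) → Prop} (one : P 1)
    (mul : ∀ w ∈ D.weyl D.evenSimple, P w → ∀ α ∈ D.evenSimple, w α ∈ R → P (w * D.sRefl α))
    {w : Module.End ℂ (ι → ℂ)} (hw : w ∈ D.weyl D.evenSimple) : P w := by
  have key : ∀ n, ∀ l : List (ι → ℂ), l.length = n → (∀ α ∈ l, α ∈ D.evenSimple) →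
      P (l.map D.sRefl).prod := by
    intro n
    induction n using Nat.strong_induction_on with
    | _ n ih =>
      intro l hln hl
      rcases List.eq_nil_or_concat l with rfl | ⟨l', α, rfl⟩
      · simpa using one
      · have hl' : ∀ β ∈ l', β ∈ D.evenSimple := fun β hβ => hl β (by simp [hβ])
        have hα : α ∈ D.evenSimple := hl α (by simp)
        have hlen : l'.length + 1 = n := by simpa using hln
        have hprod : ((l'.concat α).map D.sRefl).prod = (l'.map D.sRefl).prod * D.sRefl α := by
          simp
        -- Otherwise the word is not reduced: the exchange condition gives a word for the same
        -- element that is shorter by two letters.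
        by_cases hR : (l'.map D.sRefl).prod α ∈ R
        · rw [hprod]
          exact mul _ (D.word_mem_weyl hl') (ih l'.length (by omega) l' rfl hl') α hα hR
        · obtain ⟨l'', h1, h2, h3⟩ := h.exchange hα l' hl' hR
          rw [hprod, ← h3]
          exact ih l''.length (by omega) l'' rfl h1
  obtain ⟨l, hl, rfl⟩ := D.exists_word hw
  exact key _ l rfl hl

lemma mem_or_neg_mem (h : D.IsPositiveSystem R) {w : Module.End ℂ (ι → ℂ)}
    (hw : w ∈ D.weyl D.evenSimple) {x : ι → ℂ} (hx : x ∈ R ∨ -x ∈ R) : w x ∈ R ∨ -w x ∈ R := by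
  induction hw using Submonoid.closure_induction generalizing x with
  | mem _ hs =>
    obtain ⟨β, hβ, rfl⟩ := hs
    have key : ∀ y ∈ R, D.sRefl β y ∈ R ∨ -D.sRefl β y ∈ R := by
      intro y hy
      by_cases hyβ : y = β
      · right
        rwa [hyβ, sRefl_self (h.form_ne_zero β hβ), neg_neg, ← hyβ]
      · exact Or.inl (h.sRefl_mem β hβ y hy hyβ)
    rcases hx with hx | hx
    · exact key x hx
    · have := key _ hx
      rw [map_neg, neg_neg] at this
      exact this.symm
  | one => exact hx
  | mul u v _ _ hu hv => exact hu (hv hx)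

/-- A reduced word that is not empty sends its own last letter to a negative root. -/
lemma eq_one_of_forall_mem (h : D.IsPositiveSystem R) {w : Module.End ℂ (ι → ℂ)}
    (hw : w ∈ D.weyl D.evenSimple) (hpos : ∀ α ∈ D.evenSimple, w α ∈ R) : w = 1 := by
  have : w = 1 ∨ ∃ α ∈ D.evenSimple, w α ∉ R := by
    refine h.weyl_induction (P := fun w => w = 1 ∨ ∃ α ∈ D.evenSimple, w α ∉ R) (Or.inl rfl) ?_ hw
    intro w hw _ α hα hR
    refine Or.inr ⟨α, hα, ?_⟩
    rw [Module.End.mul_apply, sRefl_self (h.form_ne_zero α hα), map_neg]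
    refine h.neg_notMem hR fun h0 => ?_
    obtain ⟨u, _, hu, _⟩ := exists_weyl_inv h.form_ne_zero hw
    apply h.ne_zero_of_mem hα
    have := congrArg u h0
    rwa [← Module.End.mul_apply, hu, map_zero] at this
  rcases this with h1 | ⟨α, hα, hn⟩
  · exact h1
  · exact absurd (hpos α hα) hn

/-- An element is determined by its values on the simple roots, which lie in the finite set `R ∪
-R`. -/
lemma weyl_finite (h : D.IsPositiveSystem R) :
    {w | w ∈ D.weyl D.evenSimple}.Finite := by
  have hfin : D.evenSimple.Finite := h.finite.subset h.simple_subset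
  have : Finite D.evenSimple := hfin
  have hR : (R ∪ -R).Finite := h.finite.union h.finite.neg
  have : Finite ↥(R ∪ -R) := hR
  let g : {w // w ∈ D.weyl D.evenSimple} → (D.evenSimple → ↥(R ∪ -R)) := fun w α =>
    ⟨w.1 α.1, by
      have := h.mem_or_neg_mem w.2 (Or.inl (h.simple_subset α.2))
      simpa using this⟩
  have hg : Function.Injective g := by
    rintro ⟨w, hw⟩ ⟨w', hw'⟩ hww
    obtain ⟨u, hu, h1, h2⟩ := exists_weyl_inv h.form_ne_zero hw
    have : u * w' = 1 := by
      refine h.eq_one_of_forall_mem (mul_mem hu hw') fun α hα => ?_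
      have h3 : w α = w' α := congrArg Subtype.val (congrFun hww ⟨α, hα⟩)
      rw [Module.End.mul_apply, ← h3, ← Module.End.mul_apply, h1]
      exact h.simple_subset hα
    refine Subtype.ext ?_
    calc w = w * (u * w') := by rw [this, mul_one]
      _ = w' := by rw [← mul_assoc, h2, one_mul]
  have : Finite {w // w ∈ D.weyl D.evenSimple} := Finite.of_injective g hg
  exact this

/-- Lengthening a reduced word by `α` adds `k α • w α` to `Λ - w Λ`, and `w α` is a positive root.
-/
lemma sub_weyl_mem_closure (h : D.IsPositiveSystem R) {Λ : ι → ℂ} {k : (ι → ℂ) → ℕ}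
    (hk : ∀ α ∈ D.evenSimple, D.pairing Λ α = k α) {w : Module.End ℂ (ι → ℂ)}
    (hw : w ∈ D.weyl D.evenSimple) : Λ - w Λ ∈ AddSubmonoid.closure D.evenSimple := by
  refine h.weyl_induction (P := fun w => Λ - w Λ ∈ AddSubmonoid.closure D.evenSimple)
    (by simp) ?_ hw
  intro w _ ih α hα hR
  have : Λ - (w * D.sRefl α) Λ = (Λ - w Λ) + k α • w α := by
    rw [Module.End.mul_apply, sRefl_apply, map_sub, map_smul, hk α hα, Nat.cast_smul_eq_nsmul]
    abel
  rw [this]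
  exact add_mem ih (nsmul_mem (h.subset_closure hR) _)

end IsPositiveSystem

/-! ### Products of commuting reflections -/

/-- The product of the reflections in the elements of `I`, if these are pairwise orthogonal. -/
noncomputable def orthRefl (D : SuperRootDatum ι) (I : Finset (ι → ℂ)) : Module.End ℂ (ι → ℂ) :=
  1 - ∑ α ∈ I, (D.pairingHom α).smulRight α

/-- The elements of `I` are pairwise orthogonal. -/
def PairwiseOrth (D : SuperRootDatum ι) (I : Finset (ι → ℂ)) : Prop :=
  ∀ α ∈ I, ∀ β ∈ I, α ≠ β → D.pairing α β = 0

lemma orthRefl_apply (D : SuperRootDatum ι) (I : Finset (ι → ℂ)) (x : ι → ℂ) :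
    D.orthRefl I x = x - ∑ α ∈ I, D.pairing x α • α := by
  simp [orthRefl]

@[simp] lemma orthRefl_empty (D : SuperRootDatum ι) : D.orthRefl ∅ = 1 := by simp [orthRefl]

lemma pairing_eq_zero_comm {D : SuperRootDatum ι} (hD : D.gram.IsSymm) {α β : ι → ℂ}
    (h : D.pairing α β = 0) (hβ : D.form β β ≠ 0) : D.pairing β α = 0 := by
  have : D.form α β = 0 := by
    unfold pairing at h
    simpa [hβ] using h
  unfold pairing
  rw [form_comm hD, this]; simp

open Classical in
lemma orthRefl_insert {D : SuperRootDatum ι} {I : Finset (ι → ℂ)} {α : ι → ℂ} (hα : α ∉ I)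
    (h : ∀ β ∈ I, D.pairing α β = 0) : D.orthRefl (insert α I) = D.orthRefl I * D.sRefl α := by
  refine LinearMap.ext fun x => ?_
  have : D.orthRefl I α = α := by
    rw [orthRefl_apply, Finset.sum_eq_zero, sub_zero]
    intro β hβ
    rw [h β hβ, zero_smul]
  rw [Module.End.mul_apply, sRefl_apply, map_sub, map_smul, this, orthRefl_apply, orthRefl_apply,
    Finset.sum_insert hα]
  abel

open Classical in
lemma orthRefl_mem_weyl {D : SuperRootDatum ι} {S : Set (ι → ℂ)}
    (hS : ∀ α ∈ S, D.form α α ≠ 0) {I : Finset (ι → ℂ)} (hI : ↑I ⊆ S) (horth : D.PairwiseOrth I) :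
    D.orthRefl I ∈ D.weyl S ∧ LinearMap.det (D.orthRefl I) = (-1) ^ I.card := by
  induction I using Finset.induction_on with
  | empty => simp
  | insert α I hα ih =>
    have hαS : α ∈ S := hI (by simp)
    obtain ⟨h1, h2⟩ := ih (fun x hx => hI (by simp [Finset.mem_coe.1 hx])) fun x hx y hy =>
      horth x (by simp [hx]) y (by simp [hy])
    rw [orthRefl_insert hα fun β hβ => horth α (by simp) β (by simp [hβ])
      (by rintro rfl; exact hα hβ)]
    refine ⟨mul_mem h1 (D.sRefl_mem_weyl hαS), ?_⟩
    rw [map_mul, h2, det_sRefl (hS α hαS), Finset.card_insert_of_notMem hα, pow_succ]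

open Classical in
/-- The elements `w` for which `Λ - w Λ` is at most `∑ ⟨Λ, α⟩ α` are the products of commuting simple
reflections. -/
lemma IsPositiveSystem.exists_eq_orthRefl {D : SuperRootDatum ι} {R : Set (ι → ℂ)}
    (h : D.IsPositiveSystem R) {Λ : ι → ℂ} {k : (ι → ℂ) → ℕ}
    (hk : ∀ α ∈ D.evenSimple, D.pairing Λ α = k α) (hpos : ∀ α ∈ D.evenSimple, 0 < k α)
    {f : (ι → ℂ) → (ι → ℂ) →ₗ[ℂ] ℂ} (f1 : ∀ α ∈ D.evenSimple, f α α = 1)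
    (f0 : ∀ α ∈ D.evenSimple, ∀ β ∈ D.evenSimple, β ≠ α → f α β = 0)
    {w : Module.End ℂ (ι → ℂ)} (hw : w ∈ D.weyl D.evenSimple)
    (hle : ∀ α ∈ D.evenSimple, ∃ n : ℕ, f α (Λ - w Λ) = n ∧ n ≤ k α) :
    ∃ I : Finset (ι → ℂ), ↑I ⊆ D.evenSimple ∧ D.PairwiseOrth I ∧ w = D.orthRefl I := by
  revert hle
  refine h.weyl_induction (P := fun w => (∀ α ∈ D.evenSimple,
    ∃ n : ℕ, f α (Λ - w Λ) = n ∧ n ≤ k α) → ∃ I : Finset (ι → ℂ), ↑I ⊆ D.evenSimple ∧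
      D.PairwiseOrth I ∧ w = D.orthRefl I) ?_ ?_ hw
  · exact fun _ => ⟨∅, by simp, by simp [PairwiseOrth], by simp⟩
  intro w hw ih α hα hR hle
  have hsum : ∀ β, f β (Λ - (w * D.sRefl α) Λ) = f β (Λ - w Λ) + k α * f β (w α) := by
    intro β
    have : Λ - (w * D.sRefl α) Λ = (Λ - w Λ) + (k α : ℂ) • w α := by
      rw [Module.End.mul_apply, sRefl_apply, map_sub, map_smul, hk α hα]
      abel
    rw [this, map_add, map_smul, smul_eq_mul]
  -- Both summands have natural coordinates, so the bound for the longer word is inherited by `w`,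
  -- and the induction hypothesis applies.
  have hnat : ∀ β ∈ D.evenSimple, ∃ a b : ℕ, f β (Λ - w Λ) = a ∧ f β (w α) = b ∧
      a + k α * b ≤ k β := by
    intro β hβ
    obtain ⟨a, ha⟩ := nat_coweight (f1 β hβ) (f0 β hβ) (h.sub_weyl_mem_closure hk hw)
    obtain ⟨b, hb⟩ := nat_coweight (f1 β hβ) (f0 β hβ) (h.subset_closure hR)
    obtain ⟨n, hn, hnk⟩ := hle β hβ
    refine ⟨a, b, ha, hb, ?_⟩
    rw [hsum, ha, hb] at hn
    have : a + k α * b = n := by exact_mod_cast hn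
    omega
  obtain ⟨I, hI, horth, rfl⟩ := ih fun β hβ => by
    obtain ⟨a, b, ha, _, hab⟩ := hnat β hβ
    exact ⟨a, ha, by omega⟩
  have hfI : ∀ x, ∀ β ∈ I, f β (D.orthRefl I x) = f β x - D.pairing x β := by
    intro x β hβ
    rw [orthRefl_apply, map_sub, map_sum, Finset.sum_eq_single β]
    · rw [map_smul, f1 β (hI hβ), smul_eq_mul, mul_one]
    · intro b hb hne
      rw [map_smul, f0 β (hI hβ) b (hI hb) hne, smul_zero]
    · exact fun hn => absurd hβ hn
  -- If `α` were in `I`, the product would send `α` to `-α`, which is not in `R`.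
  have hαI : α ∉ I := by
    intro hαI
    refine h.neg_simple_notMem hα ?_
    convert hR using 1
    rw [orthRefl_apply, Finset.sum_eq_single α, pairing_self (h.form_ne_zero α hα), two_smul]
    · abel
    · intro β hβ hne
      rw [horth α hαI β hβ hne.symm, zero_smul]
    · exact fun hn => absurd hαI hn
  -- For `β ∈ I` the bound `k β` is already exhausted by `w`. Hence `w α` has `β`-coordinate zero,
  -- and this coordinate is `-⟨α, β⟩`.
  have hzero : ∀ β ∈ I, D.pairing α β = 0 := by
    intro β hβ
    obtain ⟨a, b, ha, hb, hab⟩ := hnat β (hI hβ)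
    rw [map_sub, hfI Λ β hβ, hk β (hI hβ)] at ha
    rw [hfI α β hβ, f0 β (hI hβ) α hα (by rintro rfl; exact hαI hβ), zero_sub] at hb
    have ha' : a = k β := by
      have : (a : ℂ) = k β := by rw [← ha]; ring
      exact_mod_cast this
    have hb0 : b = 0 := by
      have h1 : k α * b = 0 := by omega
      rcases Nat.mul_eq_zero.1 h1 with h2 | h2
      · exact absurd h2 (hpos α hα).ne'
      · exact h2
    rw [hb0] at hb
    simpa using hb
  refine ⟨insert α I, ?_, ?_, (orthRefl_insert hαI hzero).symm⟩
  · intro x hx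
    rcases Finset.mem_insert.1 (Finset.mem_coe.1 hx) with rfl | hx
    exacts [hα, hI hx]
  · intro x hx y hy hne
    rcases Finset.mem_insert.1 hx with rfl | hx' <;> rcases Finset.mem_insert.1 hy with rfl | hy'
    · exact absurd rfl hne
    · exact hzero y hy'
    · exact pairing_eq_zero_comm h.symm (hzero x hx')
        (h.form_ne_zero _ (hI hx'))
    · exact horth x hx' y hy' hne

end SuperRootDatum

/-! ### Independence polynomials in square-zero variables -/

/-- `I` is an independent set of the graph `adj`. -/
def IsIndep {V : Type*} (adj : V → V → Prop) (I : Finset V) : Prop :=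
  ∀ u ∈ I, ∀ v ∈ I, u ≠ v → ¬adj u v

open Classical in
/-- The signed sum of the monomials `∏ y_v` over the independent subsets of `J`. -/
noncomputable def indepPoly {V A : Type*} [CommRing A] (adj : V → V → Prop) (y : V → A)
    (J : Finset V) : A :=
  ∑ I ∈ J.powerset with IsIndep adj I, (-1) ^ I.card * ∏ v ∈ I, y v

open Classical in
/-- The quotient of the independence polynomials of `J \ M` and of `J`. -/
noncomputable def indepQuot {V A : Type*} [CommRing A] (adj : V → V → Prop) (y : V → A)
    (J : Finset V) (M : Set V) : A :=
  indepPoly adj y (J.filter (· ∉ M)) * Ring.inverse (indepPoly adj y J)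

section Indep

variable {V A : Type*} [CommRing A] {adj : V → V → Prop} {y : V → A}

open Classical in
-- The deletion recursion: an independent set either omits `v`, or consists of `v` and an
-- independent set avoiding the neighbours of `v`.
lemma indepPoly_eq_sub (hs : ∀ u v, adj u v → adj v u) {J : Finset V} {v : V} (hv : v ∈ J) :
    indepPoly adj y J = indepPoly adj y (J.erase v) -
      y v * indepPoly adj y ((J.erase v).filter (· ∉ {u | adj v u})) := by
  unfold indepPoly
  conv_lhs => rw [← Finset.insert_erase hv, Finset.powerset_insert, Finset.filter_union]
  have hdisj : Disjoint ((J.erase v).powerset.filter (IsIndep adj))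
      (((J.erase v).powerset.image (insert v)).filter (IsIndep adj)) := by
    rw [Finset.disjoint_left]
    intro I h1 h2
    simp only [Finset.mem_filter, Finset.mem_powerset, Finset.mem_image] at h1 h2
    obtain ⟨⟨K, _, rfl⟩, _⟩ := h2
    exact Finset.notMem_erase v J (h1.1 (Finset.mem_insert_self _ _))
  rw [Finset.sum_union hdisj, sub_eq_add_neg, Finset.mul_sum, ← Finset.sum_neg_distrib]
  congr 1
  symm
  have hvI : ∀ L ∈ ((J.erase v).filter (· ∉ {u | adj v u})).powerset.filter (IsIndep adj),
      v ∉ L := by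
    intro L hL hvL
    simp only [Finset.mem_filter, Finset.mem_powerset] at hL
    exact Finset.notMem_erase v J (Finset.mem_filter.1 (hL.1 hvL)).1
  refine Finset.sum_bij (fun I _ => insert v I) ?_ ?_ ?_ ?_
  · intro I hI
    simp only [Finset.mem_filter, Finset.mem_powerset, Finset.mem_image] at hI ⊢
    refine ⟨⟨I, fun u hu => (Finset.mem_filter.1 (hI.1 hu)).1, rfl⟩, ?_⟩
    intro u hu w hw hne
    rcases Finset.mem_insert.1 hu with rfl | hu' <;> rcases Finset.mem_insert.1 hw with rfl | hw'
    · exact absurd rfl hne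
    · exact (Finset.mem_filter.1 (hI.1 hw')).2
    · exact fun h => (Finset.mem_filter.1 (hI.1 hu')).2 (hs _ _ h)
    · exact hI.2 u hu' w hw' hne
  · intro I hI K hK h
    rw [← Finset.erase_insert (hvI I hI), h, Finset.erase_insert (hvI K hK)]
  · intro I hI
    simp only [Finset.mem_filter, Finset.mem_powerset, Finset.mem_image] at hI
    obtain ⟨⟨K, hK, rfl⟩, hind⟩ := hI
    have hvK : v ∉ K := fun h => Finset.notMem_erase v J (hK h)
    refine ⟨K, ?_, rfl⟩
    simp only [Finset.mem_filter, Finset.mem_powerset]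
    refine ⟨fun u hu => Finset.mem_filter.2 ⟨hK hu, ?_⟩, fun u hu w hw =>
      hind u (Finset.mem_insert_of_mem hu) w (Finset.mem_insert_of_mem hw)⟩
    exact hind v (Finset.mem_insert_self _ _) u (Finset.mem_insert_of_mem hu)
      (by rintro rfl; exact hvK hu)
  · intro I hI
    rw [Finset.card_insert_of_notMem (hvI I hI), Finset.prod_insert (hvI I hI), pow_succ]
    ring

@[simp] lemma indepPoly_empty : indepPoly adj y ∅ = 1 := by
  classical
  unfold indepPoly
  rw [Finset.powerset_empty, Finset.filter_singleton, if_pos (by simp [IsIndep])]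
  simp

/-- By the deletion recursion, each new vertex changes a unit by a nilpotent element. -/
lemma isUnit_indepPoly (hs : ∀ u v, adj u v → adj v u) (hy : ∀ v, y v * y v = 0)
    (J : Finset V) : IsUnit (indepPoly adj y J) := by
  classical
  induction J using Finset.strongInduction with
  | H J ih =>
    rcases J.eq_empty_or_nonempty with rfl | ⟨v, hv⟩
    · simp
    · rw [indepPoly_eq_sub hs hv, sub_eq_add_neg]
      refine IsNilpotent.isUnit_add_left_of_commute ⟨2, ?_⟩
        (ih _ (Finset.erase_ssubset hv)) (Commute.all _ _)
      rw [neg_sq, mul_pow, pow_two, hy, zero_mul]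

lemma indepQuot_mul (hs : ∀ u v, adj u v → adj v u) (hy : ∀ v, y v * y v = 0)
    (J : Finset V) (M : Set V) [DecidablePred (· ∉ M)] :
    indepQuot adj y J M * indepPoly adj y J = indepPoly adj y (J.filter (· ∉ M)) := by
  unfold indepQuot
  rw [mul_assoc, Ring.inverse_mul_cancel _ (isUnit_indepPoly hs hy J), mul_one]
  congr!

open Classical in
-- Dividing the deletion recursion by the polynomial of `J.erase v` gives a factor `1 - y v * G`,
-- whose inverse is `1 + y v * G` because `y v` has square zero. The resulting recursion contains no
-- signs, which is the source of all positivity below.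
lemma indepQuot_eq_mul (hs : ∀ u v, adj u v → adj v u) (hy : ∀ v, y v * y v = 0)
    {J : Finset V} {M : Set V} {v : V} (hv : v ∈ J) (hM : v ∈ M) :
    indepQuot adj y J M = (1 + y v * indepQuot adj y (J.erase v) {u | adj v u}) *
      indepQuot adj y (J.erase v) M := by
  refine (isUnit_indepPoly hs hy J).mul_right_cancel ?_
  rw [indepQuot_mul hs hy]
  have h1 : J.filter (· ∉ M) = (J.erase v).filter (· ∉ M) := by
    ext u
    simp only [Finset.mem_filter, Finset.mem_erase]
    constructor
    · rintro ⟨h1, h2⟩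
      exact ⟨⟨by rintro rfl; exact h2 hM, h1⟩, h2⟩
    · rintro ⟨⟨_, h1⟩, h2⟩
      exact ⟨h1, h2⟩
  rw [h1, ← indepQuot_mul hs hy, indepPoly_eq_sub hs hv, ← indepQuot_mul hs hy (J.erase v) {u | _}]
  linear_combination indepQuot adj y (J.erase v) M * indepPoly adj y (J.erase v) *
    indepQuot adj y (J.erase v) {u | adj v u} ^ 2 * hy v

lemma indepQuot_eq_one (hs : ∀ u v, adj u v → adj v u) (hy : ∀ v, y v * y v = 0)
    {J : Finset V} {M : Set V} (h : ∀ v ∈ J, v ∉ M) : indepQuot adj y J M = 1 := by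
  classical
  refine (isUnit_indepPoly hs hy J).mul_right_cancel ?_
  rw [indepQuot_mul hs hy, Finset.filter_true_of_mem h, one_mul]

open Classical in
-- The quotients telescope when `M` is removed first and then `N`.
lemma indepQuot_union (hs : ∀ u v, adj u v → adj v u) (hy : ∀ v, y v * y v = 0)
    (J : Finset V) (M N : Set V) :
    indepQuot adj y J (M ∪ N) =
      indepQuot adj y J M * indepQuot adj y (J.filter (· ∉ M)) N := by
  refine (isUnit_indepPoly hs hy J).mul_right_cancel ?_
  rw [mul_right_comm, indepQuot_mul hs hy, indepQuot_mul hs hy, mul_comm, indepQuot_mul hs hy,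
    Finset.filter_filter]
  congr 1
  ext u
  simp

/-- Enlarging `J` increases the coefficients of `indepQuot adj y J M`. -/
lemma indepQuot_sub_mem (hs : ∀ u v, adj u v → adj v u) (hy : ∀ v, y v * y v = 0)
    {C : Subsemiring A} (hC : ∀ v, y v ∈ C) (J : Finset V) :
    ∀ L ⊆ J, ∀ M, indepQuot adj y J M - indepQuot adj y L M ∈ C := by
  classical
  induction J using Finset.strongInduction with
  | H J ih =>
    intro L hL M
    by_cases hJM : ∃ v ∈ J, v ∈ M
    · obtain ⟨v, hv, hM⟩ := hJM
      have hJ' := ih _ (Finset.erase_ssubset hv)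
      have hmem : ∀ N, indepQuot adj y (J.erase v) N ∈ C := by
        intro N
        have := hJ' ∅ (Finset.empty_subset _) N
        rw [indepQuot_eq_one (J := ∅) hs hy (by simp)] at this
        have h2 := add_mem this (one_mem C)
        rwa [sub_add_cancel] at h2
      rw [indepQuot_eq_mul hs hy hv hM]
      by_cases hvL : v ∈ L
      · rw [indepQuot_eq_mul hs hy hvL hM]
        have hsub := Finset.erase_subset_erase v hL
        have h1 := hJ' _ hsub {u | adj v u}
        have h2 := hJ' _ hsub M
        have hmemL : indepQuot adj y (L.erase v) {u | adj v u} ∈ C := by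
          have h3 := ih (L.erase v) ((Finset.erase_ssubset hvL).trans_subset hL) ∅
            (Finset.empty_subset _) {u | adj v u}
          rw [indepQuot_eq_one (J := ∅) hs hy (by simp)] at h3
          have h4 := add_mem h3 (one_mem C)
          rwa [sub_add_cancel] at h4
        -- `C` is not closed under subtraction, so the difference of products is regrouped such that
        -- the only differences left are those covered by induction.
        have : (1 + y v * indepQuot adj y (J.erase v) {u | adj v u}) *
            indepQuot adj y (J.erase v) M - (1 + y v * indepQuot adj y (L.erase v) {u | adj v u}) *
            indepQuot adj y (L.erase v) M =
            y v * (indepQuot adj y (J.erase v) {u | adj v u} -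
              indepQuot adj y (L.erase v) {u | adj v u}) * indepQuot adj y (J.erase v) M +
            (1 + y v * indepQuot adj y (L.erase v) {u | adj v u}) *
              (indepQuot adj y (J.erase v) M - indepQuot adj y (L.erase v) M) := by ring
        rw [this]
        exact add_mem (mul_mem (mul_mem (hC v) h1) (hmem M))
          (mul_mem (add_mem (one_mem C) (mul_mem (hC v) hmemL)) h2)
      · have h2 := hJ' L (fun u hu => Finset.mem_erase.2 ⟨by rintro rfl; exact hvL hu, hL hu⟩) M
        have : (1 + y v * indepQuot adj y (J.erase v) {u | adj v u}) *
            indepQuot adj y (J.erase v) M - indepQuot adj y L M =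
            y v * indepQuot adj y (J.erase v) {u | adj v u} * indepQuot adj y (J.erase v) M +
              (indepQuot adj y (J.erase v) M - indepQuot adj y L M) := by ring
        rw [this]
        exact add_mem (mul_mem (mul_mem (hC v) (hmem _)) (hmem M)) h2
    · push Not at hJM
      rw [indepQuot_eq_one hs hy hJM, indepQuot_eq_one hs hy fun v hv => hJM v (hL hv), sub_self]
      exact zero_mem C

lemma indepQuot_mem (hs : ∀ u v, adj u v → adj v u) (hy : ∀ v, y v * y v = 0)
    {C : Subsemiring A} (hC : ∀ v, y v ∈ C) (J : Finset V) (M : Set V) :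
    indepQuot adj y J M ∈ C := by
  have h1 := indepQuot_sub_mem hs hy hC J ∅ (Finset.empty_subset _) M
  rw [indepQuot_eq_one (J := ∅) hs hy (by simp)] at h1
  have h2 := add_mem h1 (one_mem C)
  rwa [sub_add_cancel] at h2

/-- If every vertex of `J` is connected to `M` in `J`, then the squarefree monomial of all vertices
of `J` occurs in `indepQuot adj y J M`. -/
lemma indepQuot_sub_prod_mem (hs : ∀ u v, adj u v → adj v u) (hy : ∀ v, y v * y v = 0)
    {C : Subsemiring A} (hC : ∀ v, y v ∈ C) (J : Finset V) :
    ∀ M : Set V, (∀ K ⊆ J, K.Nonempty → ∃ v ∈ K, v ∈ M ∨ ∃ u ∈ J, u ∉ K ∧ adj u v) →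
      indepQuot adj y J M - ∏ v ∈ J, y v ∈ C := by
  classical
  induction J using Finset.strongInduction with
  | H J ih =>
    intro M hcon
    rcases J.eq_empty_or_nonempty with rfl | hne
    · rw [indepQuot_eq_one (J := ∅) hs hy (by simp)]
      simp
    obtain ⟨v, hv, hM⟩ : ∃ v ∈ J, v ∈ M := by
      obtain ⟨v, hv, h | ⟨u, hu, hnu, _⟩⟩ := hcon J subset_rfl hne
      · exact ⟨v, hv, h⟩
      · exact absurd hu hnu
    -- Once `v` is deleted, a set that was connected to `M` only through `v` contains a neighbour of
    -- `v`. Adding these neighbours to `M` preserves the connectedness hypothesis.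
    have htop := ih _ (Finset.erase_ssubset hv) ({u | adj v u} ∪ M) (by
      intro K hK hKne
      have hvK : v ∉ K := fun h => Finset.notMem_erase v J (hK h)
      obtain ⟨u, hu, h | ⟨t, ht, htK, hadj⟩⟩ := hcon K (hK.trans (Finset.erase_subset _ _)) hKne
      · exact ⟨u, hu, Or.inl (Or.inr h)⟩
      · by_cases htv : t = v
        · exact ⟨u, hu, Or.inl (Or.inl (htv ▸ hadj))⟩
        · exact ⟨u, hu, Or.inr ⟨t, Finset.mem_erase.2 ⟨htv, ht⟩, htK, hadj⟩⟩)
    -- The quotient for the enlarged set factors as `G * F'`, whereas the recursion contains `G *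
    -- F`. Monotonicity bounds the second below by the first.
    have hmono := indepQuot_sub_mem hs hy hC (J.erase v)
      ((J.erase v).filter (· ∉ {u | adj v u})) (Finset.filter_subset _ _) M
    rw [indepQuot_union hs hy] at htop
    have hmem := indepQuot_mem hs hy hC (J.erase v)
    rw [indepQuot_eq_mul hs hy hv hM, ← Finset.mul_prod_erase J y hv]
    set G := indepQuot adj y (J.erase v) {u | adj v u}
    set F := indepQuot adj y (J.erase v) M
    set F' := indepQuot adj y ((J.erase v).filter (· ∉ {u | adj v u})) M
    have : (1 + y v * G) * F - y v * ∏ x ∈ J.erase v, y x =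
        F + y v * (G * (F - F') + (G * F' - ∏ x ∈ J.erase v, y x)) := by ring
    rw [this]
    exact add_mem (hmem M) (mul_mem (hC v) (add_mem (mul_mem (hmem _) hmono) htop))

end Indep

/-! ### A coefficient of a formal logarithm -/

section Map

variable {V A A' : Type*} [CommRing A] [CommRing A'] {adj : V → V → Prop}

lemma map_indepPoly (g : A →+* A') (y : V → A) (J : Finset V) :
    g (indepPoly adj y J) = indepPoly adj (fun v => g (y v)) J := by
  simp [indepPoly, map_sum, map_mul, map_pow, map_prod]

lemma indepPoly_zero (J : Finset V) : indepPoly adj (fun _ => (0 : A)) J = 1 := by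
  classical
  unfold indepPoly
  rw [Finset.sum_eq_single ∅]
  · simp
  · intro I _ hI
    obtain ⟨v, hv⟩ := Finset.nonempty_iff_ne_empty.2 hI
    rw [Finset.prod_eq_zero hv rfl, mul_zero]
  · intro h
    exact absurd (Finset.mem_filter.2 ⟨Finset.empty_mem_powerset J, by simp [IsIndep]⟩) h

/-- The factor `k + 1` is the one that cancels the denominators of the logarithm. -/
lemma add_pow_of_sq_eq_zero (x : A) {t : A} (ht : t * t = 0) (k : ℕ) :
    (x + t) ^ (k + 1) = x ^ (k + 1) + (k + 1 : ℕ) * (t * x ^ k) := by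
  induction k with
  | zero => simp
  | succ k ih =>
    rw [pow_succ, ih]
    push_cast
    linear_combination ((k : A) + 1) * x ^ k * ht

end Map

/-! ### Power series modulo the monomials that do not divide a given one -/

namespace MvPowerSeries

variable {σ : Type*}

/-- The power series without monomials that divide the monomial of exponent `d`. -/
def truncIdeal (d : σ →₀ ℕ) : Ideal (MvPowerSeries σ ℂ) where
  carrier := {f | ∀ e ≤ d, coeff e f = 0}
  zero_mem' := by simp
  add_mem' hf hg e he := by rw [map_add, hf e he, hg e he, add_zero]
  smul_mem' f g hg e he := by
    classical
    rw [smul_eq_mul, coeff_mul, Finset.sum_eq_zero]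
    intro p hp
    have h : p.1 + p.2 = e := Finset.HasAntidiagonal.mem_antidiagonal.1 hp
    rw [hg p.2 (le_trans (h ▸ le_add_self) he), mul_zero]

lemma monomial_mem_truncIdeal {d e : σ →₀ ℕ} (h : ¬e ≤ d) (c : ℂ) :
    monomial e c ∈ truncIdeal d := by
  classical
  intro e' he'
  rw [coeff_monomial, if_neg]
  rintro rfl
  exact h he'

lemma coeff_eq_of_mk_eq {d : σ →₀ ℕ} {f g : MvPowerSeries σ ℂ}
    (h : Ideal.Quotient.mk (truncIdeal d) f = Ideal.Quotient.mk (truncIdeal d) g) :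
    coeff d f = coeff d g := by
  have := (Ideal.Quotient.eq.1 h) d le_rfl
  rwa [map_sub, sub_eq_zero] at this

/-- The power series that do not involve the variable `s`. -/
def freeOf (s : σ) : Subring (MvPowerSeries σ ℂ) where
  carrier := {f | ∀ e : σ →₀ ℕ, e s ≠ 0 → coeff e f = 0}
  zero_mem' := by simp
  one_mem' e he := by
    classical
    rw [coeff_one, if_neg]
    rintro rfl
    exact he rfl
  add_mem' hf hg e he := by rw [map_add, hf e he, hg e he, add_zero]
  neg_mem' hf e he := by rw [map_neg, hf e he, neg_zero]
  mul_mem' {f g} hf hg e he := by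
    classical
    rw [coeff_mul, Finset.sum_eq_zero]
    intro p hp
    have h : p.1 + p.2 = e := Finset.HasAntidiagonal.mem_antidiagonal.1 hp
    by_cases h1 : p.1 s = 0
    · rw [hg p.2 (by rw [← h, Finsupp.add_apply, h1, zero_add] at he; exact he), mul_zero]
    · rw [hf p.1 h1, zero_mul]

/-- Disposes of the remainder of a finite geometric sum, as `f ^ n` has no terms of degree less than
`n`. -/
lemma coeff_mul_pow_eq_zero {f g : MvPowerSeries σ ℂ} (hf : constantCoeff f = 0) {d : σ →₀ ℕ}
    {n : ℕ} (hn : d.degree < n) : coeff d (g * f ^ n) = 0 := by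
  classical
  rw [coeff_mul, Finset.sum_eq_zero]
  intro p hp
  have h : p.1 + p.2 = d := Finset.HasAntidiagonal.mem_antidiagonal.1 hp
  rw [coeff_eq_zero_of_constantCoeff_nilpotent (m := 1) (by rw [hf, pow_one]), mul_zero]
  have : p.1.degree + p.2.degree = d.degree := by rw [← h, map_add]
  omega

end MvPowerSeries

open MvPowerSeries in
open Classical in
/-- If `U` is a sum of signed monomials over the independent sets of a graph each of whose components
meets `N`, and its part linear in the variable `s` is the subsum over the sets disjoint from `N`,
then the coefficient of `s` times all vertex variables in `log U` is not zero. -/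
theorem coeff_formalLog_ne_zero {σ : Type} {V : Type*} {adj : V → V → Prop}
    (hs : ∀ u v, adj u v → adj v u) (P : Finset V) (N : Set V)
    (hcon : ∀ K ⊆ P, K.Nonempty → ∃ v ∈ K, v ∈ N ∨ ∃ u ∈ P, u ∉ K ∧ adj u v)
    (s : σ) (e : V → σ →₀ ℕ) (hes : ∀ v, e v s = 0)
    (he : ∀ v ∈ P, ¬e v + e v ≤ Finsupp.single s 1 + ∑ v ∈ P, e v) (he0 : ∀ v ∈ P, e v ≠ 0)
    {c : ℂ} (hc : c ≠ 0) (U : MvPowerSeries σ ℂ)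
    (hU : Ideal.Quotient.mk (truncIdeal (Finsupp.single s 1 + ∑ v ∈ P, e v)) U =
      Ideal.Quotient.mk _ (indepPoly adj (fun v => if v ∈ P then monomial (e v) 1 else 0) P +
        C c * X s *
          indepPoly adj (fun v => if v ∈ P then monomial (e v) 1 else 0) (P.filter (· ∉ N)))) :
    coeff (Finsupp.single s 1 + ∑ v ∈ P, e v) (-formalLog U) ≠ 0 := by
  set d := ∑ v ∈ P, e v with hd
  set D := Finsupp.single s 1 + d with hD
  set m := Ideal.Quotient.mk (truncIdeal D) with hm
  set Y : V → MvPowerSeries σ ℂ := fun v => if v ∈ P then monomial (e v) 1 else 0 with hY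
  set Q := indepPoly adj Y P with hQ
  set Q' := indepPoly adj Y (P.filter (· ∉ N)) with hQ'
  set q := 1 - Q with hq
  have hds : d s = 0 := by simp [hd, Finsupp.finsetSum_apply, hes]
  have hYfree : ∀ v, Y v ∈ freeOf s := by
    intro v f hf
    simp only [hY]
    split_ifs
    · rw [coeff_monomial, if_neg]
      rintro rfl
      exact hf (hes v)
    · simp
  have hqfree : q ∈ freeOf s := by
    refine sub_mem (one_mem _) (sum_mem fun I _ => mul_mem (pow_mem (neg_mem (one_mem _)) _) ?_)
    exact prod_mem fun v _ => hYfree v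
  have hYsq : ∀ v, m (Y v) * m (Y v) = 0 := by
    intro v
    rw [← map_mul, hm, Ideal.Quotient.eq_zero_iff_mem]
    simp only [hY]
    split_ifs with h
    · rw [monomial_mul_monomial]
      exact monomial_mem_truncIdeal (he v h) _
    · simp
  have hXsq : m (X s) * m (X s) = 0 := by
    rw [← map_mul, hm, Ideal.Quotient.eq_zero_iff_mem, X, monomial_mul_monomial]
    refine monomial_mem_truncIdeal (fun h => ?_) _
    have := h s
    simp [hD, hds] at this
  have hq0 : constantCoeff q = 0 := by
    have : (fun v => constantCoeff (Y v)) = fun _ => (0 : ℂ) := by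
      funext v
      simp only [hY]
      split_ifs with h
      · rw [← coeff_zero_eq_constantCoeff_apply, coeff_monomial, if_neg (he0 v h).symm]
      · simp
    rw [hq, map_sub, map_one, hQ, map_indepPoly, this, indepPoly_zero, sub_self]
  -- The classes of series with natural coefficients; positivity is expressed by membership here.
  let C₀ : Subsemiring (MvPowerSeries σ ℂ ⧸ truncIdeal D) :=
    (m.comp (MvPowerSeries.map (Nat.castRingHom ℂ))).rangeS
  have hC₀ : ∀ v, m (Y v) ∈ C₀ := by
    intro v
    simp only [hY]
    split_ifs
    · exact ⟨monomial (e v) 1, by simp⟩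
    · rw [map_zero]; exact zero_mem _
  obtain ⟨g, hg⟩ := indepQuot_sub_prod_mem (y := fun v => m (Y v)) hs hYsq hC₀ P N hcon
  have hFQ := indepQuot_mul (y := fun v => m (Y v)) hs hYsq P N
  -- A lift of `Q' / Q` in which the coefficient at `d` is visibly one plus a natural number.
  set F : MvPowerSeries σ ℂ := ∏ v ∈ P, Y v + MvPowerSeries.map (Nat.castRingHom ℂ) g with hF
  have hmF : m F = indepQuot adj (fun v => m (Y v)) P N := by
    rw [hF, map_add, map_prod]
    rw [RingHom.comp_apply] at hg
    rw [hg]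
    ring
  rw [← hmF, ← map_indepPoly, ← map_indepPoly] at hFQ
  have hdeg : D.degree = d.degree + 1 := by rw [hD, map_add, Finsupp.degree_single, add_comm]
  -- In the quotient `1 - U` is `q` plus an element of square zero that is linear in `X s`. Only the
  -- linear term of the power contributes, since `q` does not involve `s`.
  have hterm : ∀ k ∈ Finset.range D.degree,
      coeff D ((1 - U) ^ (k + 1)) / ((k + 1 : ℕ) : ℂ) = -c * coeff D (X s * (Q' * q ^ k)) := by
    intro k _
    have h1 : m ((1 - U) ^ (k + 1)) =
        m (q ^ (k + 1) + C (-c * (k + 1 : ℕ)) * (X s * (Q' * q ^ k))) := by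
      have ht : (-(m (C c) * m (X s) * m Q')) * (-(m (C c) * m (X s) * m Q')) = 0 := by
        linear_combination (m (C c) * m Q') ^ 2 * hXsq
      have h2 : m (1 - U) = m q + -(m (C c) * m (X s) * m Q') := by
        rw [map_sub, hU, hq]
        simp only [map_add, map_sub, map_mul]
        ring
      rw [map_pow, h2, add_pow_of_sq_eq_zero _ ht]
      simp only [map_add, map_mul, map_pow, map_neg, map_natCast]
      ring
    rw [coeff_eq_of_mk_eq h1, map_add, pow_mem hqfree (k + 1) D (by simp [hD, hds]), zero_add,
      coeff_C_mul]
    have : ((k + 1 : ℕ) : ℂ) ≠ 0 := Nat.cast_ne_zero.2 (Nat.succ_ne_zero k)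
    field_simp
  have hsum : coeff D (-formalLog U) =
      -c * coeff D (X s * (Q' * ∑ k ∈ Finset.range D.degree, q ^ k)) := by
    have h1 : coeff D (-formalLog U) =
        ∑ k ∈ Finset.Icc 1 D.degree, coeff D ((1 - U) ^ k) / (k : ℂ) := by
      rw [map_neg]
      exact neg_neg _
    rw [h1, ← Finset.Ico_add_one_right_eq_Icc, Finset.sum_Ico_eq_sum_range, Nat.add_sub_cancel]
    simp only [add_comm 1]
    rw [Finset.sum_congr rfl hterm, ← Finset.mul_sum, ← map_sum, ← Finset.mul_sum, ← Finset.mul_sum]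
  -- The geometric sum inverts `Q = 1 - q` up to `q ^ D.degree`, and `Q'` is congruent to `F * Q`.
  have hgeom : m (X s * (Q' * ∑ k ∈ Finset.range D.degree, q ^ k)) =
      m (X s * (F - F * q ^ D.degree)) := by
    have h1 : Q * ∑ k ∈ Finset.range D.degree, q ^ k = 1 - q ^ D.degree := by
      have := mul_neg_geom_sum q D.degree
      rwa [hq, sub_sub_cancel] at this
    have h2 : F - F * q ^ D.degree = F * (Q * ∑ k ∈ Finset.range D.degree, q ^ k) := by
      rw [h1]; ring
    rw [h2]
    simp only [map_mul]
    linear_combination -m (X s) * m (∑ k ∈ Finset.range D.degree, q ^ k) * hFQ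
  have hcoeff : coeff D (X s * (F - F * q ^ D.degree)) = coeff d F := by
    have hlt : d.degree < D.degree := by omega
    rw [← sub_zero (coeff d F), ← coeff_mul_pow_eq_zero (g := F) hq0 hlt, ← map_sub,
      ← one_mul (coeff d _), ← coeff_add_monomial_mul (Finsupp.single s 1)]
    rfl
  have hFval : coeff d F = 1 + (coeff d g : ℕ) := by
    have : ∏ v ∈ P, Y v = monomial d 1 := by
      rw [hd, Finset.prod_congr rfl (g := fun v => monomial (e v) (1 : ℂ))
        fun v hv => if_pos hv]
      rw [prod_monomial, Finset.prod_const_one]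
    rw [hF, map_add, this, coeff_monomial_same, coeff_map]
    simp
  rw [hsum, coeff_eq_of_mk_eq hgeom, hcoeff, hFval]
  refine mul_ne_zero (neg_ne_zero.2 hc) ?_
  norm_cast
  omega

open Classical in
-- Puts the two polynomials over the same index set, so that they can be compared with `U` term by
-- term.
lemma indepPoly_filter {V A : Type*} [CommRing A] (adj : V → V → Prop) (y : V → A) (P : Finset V)
    (N : Set V) : indepPoly adj y (P.filter (· ∉ N)) =
      ∑ I ∈ P.powerset with IsIndep adj I,
        if ∀ v ∈ I, v ∉ N then (-1) ^ I.card * ∏ v ∈ I, y v else 0 := by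
  rw [← Finset.sum_filter, indepPoly]
  refine Finset.sum_congr ?_ fun _ _ => rfl
  ext I
  simp only [Finset.mem_filter, Finset.mem_powerset, Finset.subset_iff]
  exact ⟨fun h => ⟨⟨fun v hv => (h.1 hv).1, h.2⟩, fun v hv => (h.1 hv).2⟩,
    fun h => ⟨fun v hv => ⟨h.1.1 hv, h.2 v hv⟩, h.1.2⟩⟩

namespace SuperRootDatum

variable {ι : Type}

/-! ### Exponents -/

/-- The weight `∑ c_α α`. -/
noncomputable def expWeight (B : Set (ι → ℂ)) : (B →₀ ℕ) →+ (ι → ℂ) :=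
  Finsupp.liftAddHom fun α : B => (AddMonoidHom.flip (smulAddHom ℂ (ι → ℂ)) (α : ι → ℂ)).comp
    (Nat.castAddMonoidHom ℂ)

lemma expWeight_apply (B : Set (ι → ℂ)) (c : B →₀ ℕ) :
    expWeight B c = c.sum fun α k => (k : ℂ) • (α : ι → ℂ) := rfl

lemma isExponent_iff {D : SuperRootDatum ι} {B : Set (ι → ℂ)} {lam : ι → ℂ}
    {w : Module.End ℂ (ι → ℂ)} {c : B →₀ ℕ} :
    D.IsExponent B lam w c ↔ lam + D.rho - w (lam + D.rho) = expWeight B c := Iff.rfl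

lemma expWeight_injective {B : Set (ι → ℂ)}
    (hB : LinearIndependent ℂ (fun α : B => (α : ι → ℂ))) :
    Function.Injective (expWeight B) := by
  intro c c' h
  have key : ∀ c : B →₀ ℕ, expWeight B c = Finsupp.linearCombination ℂ (fun α : B => (α : ι → ℂ))
      (c.mapRange (Nat.cast : ℕ → ℂ) Nat.cast_zero) := by
    intro c
    rw [expWeight_apply, Finsupp.linearCombination_apply, Finsupp.sum_mapRange_index]
    simp
  rw [key, key] at h
  exact Finsupp.mapRange_injective _ _ Nat.cast_injective (hB h)

lemma exponent_eq {D : SuperRootDatum ι} {B : Set (ι → ℂ)} {lam : ι → ℂ}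
    {w : Module.End ℂ (ι → ℂ)} (hB : LinearIndependent ℂ (fun α : B => (α : ι → ℂ)))
    {c : B →₀ ℕ} (hc : D.IsExponent B lam w c) : D.exponent B lam w = c := by
  have h : ∃ c, D.IsExponent B lam w c := ⟨c, hc⟩
  rw [exponent, dif_pos h]
  exact expWeight_injective hB ((isExponent_iff.1 h.choose_spec).symm.trans (isExponent_iff.1 hc))

lemma monX_eq (D : SuperRootDatum ι) (B : Set (ι → ℂ)) (lam : ι → ℂ)
    (w : Module.End ℂ (ι → ℂ)) :
    D.monX B lam w =
      MvPowerSeries.monomial ((0 : D.oddRoots →₀ ℕ).sumElim (D.exponent B lam w)) 1 := by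
  unfold monX
  have h : ((0 : D.oddRoots →₀ ℕ).sumElim (D.exponent B lam w)) =
      ∑ α ∈ (D.exponent B lam w).support, Finsupp.single (Sum.inr α) (D.exponent B lam w α) := by
    conv_lhs => rw [Finsupp.sumElim_eq_add, Finsupp.mapDomain_zero, zero_add]
    rfl
  rw [h, Finsupp.prod, ← Finset.prod_const_one (s := (D.exponent B lam w).support),
    ← MvPowerSeries.prod_monomial]
  exact Finset.prod_congr rfl fun α _ => MvPowerSeries.X_pow_eq _ _

/-! ### The factors -/

/-- Of the function φ only the nonzero linear coefficient `c` is ever used; here it is `-1`, and `-1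
/ 2` for the special factor. -/
lemma exists_genericFactor {σ : Type} {z : MvPowerSeries σ ℂ}
    (hz : MvPowerSeries.constantCoeff z = 0) :
    ∃ r, genericFactor z = 1 + MvPowerSeries.C (-1) * z + z * z * r := by
  refine ⟨(1 + z)⁻¹, ?_⟩
  have h : (1 + z) * (1 + z)⁻¹ = 1 := MvPowerSeries.mul_inv_cancel _ (by simp [hz])
  rw [genericFactor, map_neg, map_one]
  linear_combination (1 - z) * h

lemma exists_specialFactor {σ : Type} {z : MvPowerSeries σ ℂ}
    (hz : MvPowerSeries.constantCoeff z = 0) :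
    ∃ r, specialFactor z = 1 + MvPowerSeries.C (-1 / 2) * z + z * z * r := by
  refine ⟨MvPowerSeries.C (1 / 2) * (1 + z)⁻¹, ?_⟩
  have h : (1 + z) * (1 + z)⁻¹ = 1 := MvPowerSeries.mul_inv_cancel _ (by simp [hz])
  have h2 : (2 : MvPowerSeries σ ℂ) * MvPowerSeries.C (1 / 2 : ℂ) = 1 := by
    rw [← map_ofNat (MvPowerSeries.C (σ := σ) (R := ℂ)) 2, ← map_mul]
    norm_num
  rw [specialFactor, MvPowerSeries.smul_eq_C_mul, neg_div, map_neg]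
  linear_combination MvPowerSeries.C (1 / 2 : ℂ) * (2 - z) * h + h2

end SuperRootDatum

/-! ### The numerator `U` modulo the monomials that do not divide Z_γ X^λ -/

namespace SuperRootDatum

variable {ι : Type} [Fintype ι]

open MvPowerSeries in
-- The target monomial contains `Z_γ` once and no other `Z`, so squares and the variables of the
-- other odd roots vanish in the quotient.
lemma mk_factor_varZ (D : SuperRootDatum ι) (B : Set (ι → ℂ)) {γ : ι → ℂ} (hγ : γ ∈ D.oddRoots)
    (β : ι → ℂ) (a : B →₀ ℕ) {φ : D.SeriesRing B → D.SeriesRing B} {c : ℂ}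
    (hφ : ∀ z, constantCoeff z = 0 → ∃ r, φ z = 1 + C c * z + z * z * r) [Decidable (β = γ)] :
    Ideal.Quotient.mk (truncIdeal (Finsupp.single (Sum.inl ⟨γ, hγ⟩) 1 + (0 : _ →₀ ℕ).sumElim a))
      (φ (D.varZ B β)) = Ideal.Quotient.mk _
        (1 + if β = γ then C c * X (Sum.inl ⟨γ, hγ⟩) else 0) := by
  have h0 : constantCoeff (D.varZ B β) = 0 := by
    unfold varZ; split_ifs <;> simp
  obtain ⟨r, hr⟩ := hφ _ h0
  rw [hr]
  have hsq : D.varZ B β * D.varZ B β ∈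
      truncIdeal (Finsupp.single (Sum.inl ⟨γ, hγ⟩) 1 + (0 : _ →₀ ℕ).sumElim a) := by
    unfold varZ
    split_ifs with h
    · rw [X, monomial_mul_monomial]
      refine monomial_mem_truncIdeal (fun hle => ?_) _
      have := hle (Sum.inl ⟨β, h⟩)
      simp only [Finsupp.add_apply, Finsupp.single_eq_same, Finsupp.sumElim_inl,
        Finsupp.zero_apply, Finsupp.single_apply] at this
      split_ifs at this <;> omega
    · simp
  rw [map_add, Ideal.Quotient.eq_zero_iff_mem.2 (Ideal.mul_mem_right r _ hsq), add_zero]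
  by_cases hβ : β = γ
  · subst hβ
    rw [if_pos rfl, varZ, dif_pos hγ]
  · rw [if_neg hβ, map_add, map_add]
    congr 1
    rw [map_zero, Ideal.Quotient.eq_zero_iff_mem]
    refine Ideal.mul_mem_left _ _ ?_
    unfold varZ
    split_ifs with h
    · refine monomial_mem_truncIdeal (fun hle => ?_) _
      have := hle (Sum.inl ⟨β, h⟩)
      simp only [Finsupp.add_apply, Finsupp.single_eq_same, Finsupp.sumElim_inl,
        Finsupp.zero_apply, Finsupp.single_apply] at this
      rw [if_neg] at this
      · omega
      · intro he
        exact hβ (congrArg Subtype.val (Sum.inl_injective he)).symm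
    · exact zero_mem _

open MvPowerSeries in
open Classical in
-- Reduces the coefficient to `coeff_formalLog_ne_zero` for the Dynkin diagram of the even simple
-- roots. It is stated for a general generating set `S`, so that it covers both reflection groups;
-- `hspan` says that the additional elements cannot contribute to X^λ.
theorem IsPositiveSystem.hasNonzeroCoeff {D : SuperRootDatum ι} {R : Set (ι → ℂ)}
    (h : D.IsPositiveSystem R) {lam γ : ι → ℂ} (hγ : γ ∈ D.oddRoots) {k : (ι → ℂ) → ℕ}
    (hk : ∀ α ∈ D.evenSimple, D.pairing (lam + D.rho) α = k α)
    (hpos : ∀ α ∈ D.evenSimple, 0 < k α)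
    (hcon : ∀ K ⊆ D.evenSimple, K.Nonempty → ∃ v ∈ K, D.pairing γ v ≠ 0 ∨
      ∃ u ∈ D.evenSimple, u ∉ K ∧ D.pairing u v ≠ 0)
    {S B : Set (ι → ℂ)} (hsub : D.evenSimple ⊆ S) (hS : ∀ α ∈ S, D.form α α ≠ 0)
    (hfin : {w | w ∈ D.weyl S}.Finite) (hB : D.evenSimple ⊆ B)
    (hind : LinearIndependent ℂ (fun α : B => (α : ι → ℂ)))
    (hexp : ∀ w ∈ D.weyl S, ∃ c, D.IsExponent B lam w c)
    (hspan : ∀ w ∈ D.weyl S, lam + D.rho - w (lam + D.rho) ∈ Submodule.span ℂ D.evenSimple →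
      w ∈ D.weyl D.evenSimple)
    {φ : D.SeriesRing B → D.SeriesRing B} {c : ℂ} (hc : c ≠ 0)
    (hφ : ∀ z, constantCoeff z = 0 → ∃ r, φ z = 1 + C c * z + z * z * r) :
    D.HasNonzeroCoeff S B φ lam γ := by
  have hPfin : D.evenSimple.Finite := h.finite.subset h.simple_subset
  set P : Finset (ι → ℂ) := hPfin.toFinset with hP
  have hPmem : ∀ {v}, v ∈ P ↔ v ∈ D.evenSimple := hPfin.mem_toFinset
  set Λ := lam + D.rho with hΛ
  choose! f f1 f0 using h.exists_coweight
  let ex : (ι → ℂ) → B →₀ ℕ := fun v => if hv : v ∈ B then Finsupp.single ⟨v, hv⟩ (k v) else 0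
  have hex : ∀ v ∈ D.evenSimple, ∀ hv : v ∈ B, ex v = Finsupp.single ⟨v, hv⟩ (k v) :=
    fun v _ hv => dif_pos hv
  have hexw : ∀ v ∈ D.evenSimple, expWeight B (ex v) = (k v : ℂ) • v := by
    intro v hv
    rw [hex v hv (hB hv), expWeight_apply, Finsupp.sum_single_index (by simp)]
  set a : B →₀ ℕ := ∑ v ∈ P, ex v with ha
  have ha_apply : ∀ α : B, a α = if (α : ι → ℂ) ∈ D.evenSimple then k α else 0 := by
    intro α
    rw [ha, Finsupp.finsetSum_apply]
    split_ifs with hα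
    · rw [Finset.sum_eq_single (α : ι → ℂ)]
      · rw [hex _ hα α.2, Finsupp.single_eq_same]
      · intro v hv hne
        rw [hex v (hPmem.1 hv) (hB (hPmem.1 hv)), Finsupp.single_eq_of_ne]
        rintro rfl
        exact hne rfl
      · exact fun hn => absurd (hPmem.2 hα) hn
    · refine Finset.sum_eq_zero fun v hv => ?_
      rw [hex v (hPmem.1 hv) (hB (hPmem.1 hv)), Finsupp.single_eq_of_ne]
      rintro rfl
      exact hα (hPmem.1 hv)
  refine ⟨a, ?_, ?_⟩
  · intro α
    rw [ha_apply]
    split_ifs with hα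
    · exact (hk _ hα).symm
    · simp
  set s : D.oddRoots ⊕ B := Sum.inl ⟨γ, hγ⟩ with hs
  let adj : (ι → ℂ) → (ι → ℂ) → Prop := fun u v =>
    u ∈ D.evenSimple ∧ v ∈ D.evenSimple ∧ D.pairing u v ≠ 0
  let N : Set (ι → ℂ) := {v | D.pairing γ v ≠ 0}
  let e : (ι → ℂ) → D.oddRoots ⊕ B →₀ ℕ := fun v => (0 : D.oddRoots →₀ ℕ).sumElim (ex v)
  have hsumElim : ∀ I : Finset (ι → ℂ),
      ∑ v ∈ I, e v = (0 : D.oddRoots →₀ ℕ).sumElim (∑ v ∈ I, ex v) := by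
    intro I
    ext (x | x) <;> simp [e, Finsupp.finsetSum_apply]
  have hd : Finsupp.single s 1 + ∑ v ∈ P, e v = (Finsupp.single ⟨γ, hγ⟩ 1).sumElim a := by
    rw [hsumElim, Finsupp.sumElim_eq_add (Finsupp.single _ _), Finsupp.mapDomain_single,
      Finsupp.sumElim_eq_add, Finsupp.mapDomain_zero, zero_add]
  suffices hmain : coeff (Finsupp.single s 1 + ∑ v ∈ P, e v) (-formalLog (D.U S B φ lam γ)) ≠ 0 by
    intro h0
    apply hmain
    have := congrArg (fun g => coeff (Finsupp.single ⟨γ, hγ⟩ 1) g) h0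
    rw [hd]
    exact this
  have hsymm : ∀ u v, adj u v → adj v u := fun u v ⟨hu, hv, huv⟩ =>
    ⟨hv, hu, fun h0 => huv (pairing_eq_zero_comm h.symm h0
      (h.form_ne_zero _ hu))⟩
  refine coeff_formalLog_ne_zero (adj := adj) hsymm P N ?_ s e ?_ ?_ ?_ hc _ ?_
  · intro K hK hKne
    have hK' : ∀ v ∈ K, v ∈ D.evenSimple := fun v hv => hPmem.1 (hK hv)
    obtain ⟨v, hv, hN | ⟨u, hu, huK, huv⟩⟩ := hcon K hK' hKne
    · exact ⟨v, hv, Or.inl hN⟩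
    · exact ⟨v, hv, Or.inr ⟨u, hPmem.2 hu, huK, hu, hK' v hv, huv⟩⟩
  · intro v
    rfl
  · intro v hv hle
    have hv' := hPmem.1 hv
    have := hle (Sum.inr ⟨v, hB hv'⟩)
    rw [hd] at this
    simp only [e, Finsupp.add_apply, Finsupp.sumElim_inr, ha_apply, if_pos hv',
      hex v hv' (hB hv'), Finsupp.single_eq_same] at this
    have := hpos v hv'
    omega
  · intro v hv h0
    have hv' := hPmem.1 hv
    have := DFunLike.congr_fun h0 (Sum.inr ⟨v, hB hv'⟩)
    simp only [e, Finsupp.sumElim_inr, hex v hv' (hB hv'), Finsupp.single_eq_same,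
      Finsupp.zero_apply] at this
    exact (hpos v hv').ne' this
  rw [hsumElim, ← ha]
  set m := Ideal.Quotient.mk
    (truncIdeal (Finsupp.single s 1 + (0 : D.oddRoots →₀ ℕ).sumElim a)) with hm
  -- the exponents of the products of commuting reflections
  have hexpI : ∀ I ⊆ P, D.exponent B lam (D.orthRefl I) = ∑ v ∈ I, ex v := by
    intro I hI
    refine exponent_eq hind (isExponent_iff.2 ?_)
    rw [map_sum, ← hΛ, orthRefl_apply, sub_sub_cancel]
    refine Finset.sum_congr rfl fun v hv => ?_
    rw [hexw v (hPmem.1 (hI hv)), hk v (hPmem.1 (hI hv))]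
  have hfI : ∀ I ⊆ P, ∀ x, ∀ v ∈ D.evenSimple,
      f v (D.orthRefl I x) = f v x - if v ∈ I then D.pairing x v else 0 := by
    intro I hI x v hv
    rw [orthRefl_apply, map_sub, map_sum]
    congr 1
    split_ifs with hvI
    · rw [Finset.sum_eq_single v]
      · rw [map_smul, f1 v hv, smul_eq_mul, mul_one]
      · intro b hb hne
        rw [map_smul, f0 v hv b (hPmem.1 (hI hb)) hne, smul_zero]
      · exact fun hn => absurd hvI hn
    · refine Finset.sum_eq_zero fun b hb => ?_
      rw [map_smul, f0 v hv b (hPmem.1 (hI hb)) (by rintro rfl; exact hvI hb), smul_zero]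
  have horth : ∀ I ⊆ P, (IsIndep adj I ↔ D.PairwiseOrth I) := by
    intro I hI
    refine forall₂_congr fun u hu => forall₂_congr fun v hv => forall_congr' fun _ => ?_
    simp only [adj, not_and, not_not]
    exact ⟨fun h => h (hPmem.1 (hI hu)) (hPmem.1 (hI hv)), fun h _ _ => h⟩
  -- Since every `k v` is positive, `I` can be read off from the coordinates of `Λ - orthRefl I Λ`.
  have hinj : Set.InjOn D.orthRefl {I | I ⊆ P} := by
    have key : ∀ I ⊆ P, ∀ J ⊆ P, D.orthRefl I = D.orthRefl J → I ⊆ J := by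
      intro I hI J hJ hIJ v hv
      by_contra hvJ
      have hv' := hPmem.1 (hI hv)
      have h1 := hfI I hI Λ v hv'
      rw [hIJ, hfI J hJ Λ v hv', if_pos hv, if_neg hvJ, hk v hv'] at h1
      have : (k v : ℂ) = 0 := by linear_combination h1
      exact (hpos v hv').ne' (by exact_mod_cast this)
    exact fun I hI J hJ hIJ => (key I hI J hJ hIJ).antisymm (key J hJ I hI hIJ.symm)
  -- the terms of `U`
  let term : Module.End ℂ (ι → ℂ) → D.SeriesRing B := fun w =>
    (-1) ^ D.length S w * φ (D.varZ B (w γ)) * D.monX B lam w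
  have hU : m (D.U S B φ lam γ) = ∑ w ∈ hfin.toFinset, m (term w) := by
    rw [← map_sum]
    congr 1
    exact finsum_mem_eq_finite_toFinset_sum _ hfin
  have hzero : ∀ w ∈ hfin.toFinset, w ∉ (P.powerset.filter (IsIndep adj)).image D.orthRefl →
      m (term w) = 0 := by
    intro w hw hnot
    rw [Set.Finite.mem_toFinset] at hw
    have hmon : m (D.monX B lam w) = 0 := by
      rw [hm, Ideal.Quotient.eq_zero_iff_mem, monX_eq]
      -- If the monomial of `w` divides X^λ, its exponents are supported on the even simple roots
      -- and bounded by `k`, which forces `w` to be a product of commuting simple reflections.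
      refine monomial_mem_truncIdeal (fun hle => hnot ?_) _
      obtain ⟨b, hb⟩ := hexp w hw
      rw [exponent_eq hind hb] at hle
      have hba : ∀ α : B, b α ≤ if (α : ι → ℂ) ∈ D.evenSimple then k α else 0 := by
        intro α
        have := hle (Sum.inr α)
        simpa [hs, ha_apply] using this
      have hsupp : ∀ α ∈ b.support, (α : ι → ℂ) ∈ D.evenSimple := by
        intro α hα
        by_contra hn
        have := hba α
        rw [if_neg hn] at this
        exact (Finsupp.mem_support_iff.1 hα) (by omega)
      have hbw : Λ - w Λ = ∑ α ∈ b.support, (b α : ℂ) • (α : ι → ℂ) := isExponent_iff.1 hb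
      have hwW : w ∈ D.weyl D.evenSimple := by
        refine hspan w hw ?_
        rw [hbw]
        exact sum_mem fun α hα => Submodule.smul_mem _ _ (Submodule.subset_span (hsupp α hα))
      obtain ⟨I, hI, hIorth, rfl⟩ := h.exists_eq_orthRefl hk hpos f1 f0 hwW (by
        intro α hα
        refine ⟨b ⟨α, hB hα⟩, ?_, by simpa [hα] using hba ⟨α, hB hα⟩⟩
        rw [hbw, map_sum, Finset.sum_eq_single (⟨α, hB hα⟩ : B)]
        · rw [map_smul, f1 α hα, smul_eq_mul, mul_one]
        · intro β hβ hne
          rw [map_smul, f0 α hα β (hsupp β hβ) fun hn => hne (Subtype.ext hn), smul_zero]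
        · intro hn
          rw [Finsupp.notMem_support_iff.1 hn]
          simp)
      have hIP : I ⊆ P := fun v hv => hPmem.2 (hI hv)
      exact Finset.mem_image.2 ⟨I, Finset.mem_filter.2 ⟨Finset.mem_powerset.2 hIP,
        (horth I hIP).2 hIorth⟩, rfl⟩
    rw [map_mul, hmon, mul_zero]
  have hsubset : (P.powerset.filter (IsIndep adj)).image D.orthRefl ⊆ hfin.toFinset := by
    intro w hw
    obtain ⟨I, hI, rfl⟩ := Finset.mem_image.1 hw
    rw [Finset.mem_filter, Finset.mem_powerset] at hI
    rw [Set.Finite.mem_toFinset]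
    exact (orthRefl_mem_weyl hS (fun v hv => hsub (hPmem.1 (hI.1 hv)))
      ((horth I hI.1).1 hI.2)).1
  rw [hU, ← Finset.sum_subset hsubset hzero, Finset.sum_image fun I hI J hJ =>
    hinj (Finset.mem_powerset.1 (Finset.mem_filter.1 hI).1)
      (Finset.mem_powerset.1 (Finset.mem_filter.1 hJ).1), indepPoly_filter, indepPoly,
    Finset.mul_sum, ← Finset.sum_add_distrib, map_sum]
  refine Finset.sum_congr rfl fun I hI => ?_
  rw [Finset.mem_filter, Finset.mem_powerset] at hI
  obtain ⟨hIP, hIind⟩ := hI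
  obtain ⟨hmem, hdet⟩ := orthRefl_mem_weyl hS (fun v hv => hsub (hPmem.1 (hIP hv)))
    ((horth I hIP).1 hIind)
  have hsign : ((-1) ^ D.length S (D.orthRefl I) : D.SeriesRing B) = (-1) ^ I.card := by
    have h1 := neg_one_pow_length hS hmem
    rw [hdet] at h1
    have h2 := congrArg (C (σ := D.oddRoots ⊕ B)) h1
    simpa only [map_pow, map_neg, map_one] using h2
  -- The coordinate of `γ - orthRefl I γ` at `v ∈ I` is `⟨γ, v⟩`. Thus the terms with `Z_γ` are
  -- those of the diagram with `N` removed.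
  have hfix : D.orthRefl I γ = γ ↔ ∀ v ∈ I, v ∉ N := by
    constructor
    · intro hfix v hv hvN
      have hv' := hPmem.1 (hIP hv)
      have h1 := hfI I hIP γ v hv'
      rw [hfix, if_pos hv] at h1
      exact hvN (by linear_combination h1)
    · intro hN
      rw [orthRefl_apply, Finset.sum_eq_zero, sub_zero]
      intro v hv
      rw [not_not.1 (hN v hv), zero_smul]
  have hmonI : D.monX B lam (D.orthRefl I) =
      ∏ v ∈ I, if v ∈ P then monomial (e v) (1 : ℂ) else 0 := by
    rw [monX_eq, hexpI I hIP, ← hsumElim, Finset.prod_congr rfl fun v hv => if_pos (hIP hv),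
      prod_monomial, Finset.prod_const_one]
  have hfac : m (φ (D.varZ B (D.orthRefl I γ))) =
      m (1 + if D.orthRefl I γ = γ then C c * X s else 0) :=
    D.mk_factor_varZ B hγ (D.orthRefl I γ) a hφ
  simp only [term]
  rw [map_mul, map_mul, hfac, hsign, hmonI, ← map_mul, ← map_mul]
  congr 1
  by_cases hN : ∀ v ∈ I, v ∉ N
  · rw [if_pos (hfix.2 hN), if_pos hN]
    ring_nf
  · rw [if_neg (fun h => hN (hfix.1 h)), if_neg hN]
    ring_nf

end SuperRootDatum

namespace SuperRootDatum

variable {ι : Type} [Fintype ι]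

/-! ### Dominant integral weights -/

attribute [local instance] LieRing.ofAssociativeRing in
-- The operators of `α`, with `H` and `F` rescaled by `2 / (α, α)`, form an sl₂-triple for which the
-- highest weight vector is primitive. In finite dimension its weight is a natural number.
lemma IsDominantIntegral.exists_nat {D : SuperRootDatum ι} {lam : ι → ℂ}
    (hlam : D.IsDominantIntegral lam) (hD : D.gram.IsSymm) {α : ι → ℂ} (hα : α ∈ D.evenSimple)
    (hα0 : D.form α α ≠ 0) : ∃ n : ℕ, D.pairing lam α = n := by
  obtain ⟨V, _, _, _, M, -, v, hv0, hE, hH⟩ := hlam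
  have hmem : α ∈ D.evenSimple ∪ D.oddSimple := Or.inl hα
  set c : ℂ := 2 / D.form α α with hc
  have hHv : M.H α v = D.form α lam • v := hH α
  have hpair : D.pairing lam α = c * D.form α lam := by
    rw [pairing, form_comm hD, hc]; ring
  -- An sl₂-triple is required to have nonzero `h`; in the excluded case the weight is zero.
  by_cases h0 : M.H α = 0
  · rw [h0, LinearMap.zero_apply] at hHv
    have : D.form α lam = 0 := (smul_eq_zero.1 hHv.symm).resolve_right hv0
    exact ⟨0, by rw [hpair, this]; simp⟩
  have hc0 : c ≠ 0 := div_ne_zero two_ne_zero hα0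
  have ht : IsSl2Triple (c • M.H α) (M.E α) (c • M.F α) := by
    refine ⟨smul_ne_zero hc0 h0, ?_, ?_, ?_⟩
    · rw [LieRing.of_associative_ring_bracket, mul_smul_comm, smul_mul_assoc, ← smul_sub,
        M.E_F_even α hα]
    · rw [LieRing.of_associative_ring_bracket, mul_smul_comm, smul_mul_assoc, ← smul_sub,
        M.H_E α α hmem, smul_smul, hc, div_mul_cancel₀ _ hα0, ofNat_smul_eq_nsmul]
    · have hcc : c * c * D.form α α = 2 * c := by rw [hc]; field_simp
      rw [LieRing.of_associative_ring_bracket, smul_mul_smul_comm, smul_mul_smul_comm, ← smul_sub,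
        M.H_F α α hmem, smul_neg, smul_smul, hcc, mul_smul, ofNat_smul_eq_nsmul]
  have P : ht.HasPrimitiveVectorWith v (c * D.form α lam) := by
    refine ⟨hv0, ?_, ?_⟩
    · change (c • M.H α) v = _
      rw [LinearMap.smul_apply, hHv, smul_smul]
    · exact hE α hmem
  rw [hpair]
  exact P.exists_nat

/-! ### The Weyl vector -/

lemma sRefl_finsum {D : SuperRootDatum ι} {α : ι → ℂ} (hα : D.form α α ≠ 0) {T : Set (ι → ℂ)}
    (hT : T.Finite) (hs : ∀ x ∈ T, D.sRefl α x ∈ T) : D.pairing (∑ᶠ x ∈ T, x) α = 0 := by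
  have hinv : ∀ x, D.sRefl α (D.sRefl α x) = x := fun x => by
    rw [← Module.End.mul_apply, sRefl_mul_self hα, Module.End.one_apply]
  have h1 : D.sRefl α (∑ᶠ x ∈ T, x) = ∑ᶠ x ∈ T, x := by
    rw [finsum_mem_eq_finite_toFinset_sum _ hT, map_sum]
    refine Finset.sum_nbij' (D.sRefl α) (D.sRefl α) ?_ ?_ ?_ ?_ ?_
    · intro x hx; rw [Set.Finite.mem_toFinset] at hx ⊢; exact hs x hx
    · intro x hx; rw [Set.Finite.mem_toFinset] at hx ⊢; exact hs x hx
    · exact fun x _ => hinv x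
    · exact fun x _ => hinv x
    · exact fun x _ => rfl
  rw [sRefl_apply, sub_eq_self] at h1
  refine (smul_eq_zero.1 h1).resolve_right ?_
  rintro rfl
  exact hα (by simp [form])

/-- The reflection in `α` permutes the positive odd roots and the positive even roots other than
`α`. Both sums are orthogonal to `α`, and only `α / 2` contributes. -/
lemma pairing_rho {D : SuperRootDatum ι} {α : ι → ℂ} (hα : D.form α α ≠ 0)
    (hmem : α ∈ D.evenPos) (hneg : -α ∉ D.evenPos) (hev : D.evenPos.Finite)
    (hodd : D.oddPos.Finite) (hs0 : ∀ x ∈ D.evenPos, x ≠ α → D.sRefl α x ∈ D.evenPos)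
    (hs1 : ∀ x ∈ D.oddPos, D.sRefl α x ∈ D.oddPos) : D.pairing D.rho α = 1 := by
  have h1 := sRefl_finsum hα hodd hs1
  have h0 : D.pairing (∑ᶠ x ∈ D.evenPos \ {α}, x) α = 0 := by
    refine sRefl_finsum hα hev.sdiff fun x hx => ⟨hs0 x hx.1 hx.2, fun hxα => hneg ?_⟩
    have h2 : D.sRefl α (D.sRefl α x) = x := by
      rw [← Module.End.mul_apply, sRefl_mul_self hα, Module.End.one_apply]
    rw [Set.mem_singleton_iff.1 hxα, sRefl_self hα] at h2
    rw [h2]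
    exact hx.1
  have h2 : ∑ᶠ x ∈ D.evenPos, x = α + ∑ᶠ x ∈ D.evenPos \ {α}, x := by
    conv_lhs => rw [← Set.insert_sdiff_self_of_mem hmem]
    rw [finsum_mem_insert _ (by simp) hev.sdiff]
  rw [← pairingHom_apply] at h0 h1 ⊢
  rw [rho, map_sub, map_smul, map_smul, h2, map_add, h0, h1, pairingHom_apply, pairing_self hα]
  norm_num

/-! ### The common properties of the root data -/

/-- The positive even roots are the disjoint union of a positive system `R` with the even simple roots
as base and of a set `E` with at most one element, which is orthogonal to `R`. -/
structure IsStandard (D : SuperRootDatum ι) (R E : Set (ι → ℂ)) : Prop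
    extends D.IsPositiveSystem R where
  evenPos_eq : D.evenPos = R ∪ E
  subsingleton : E.Subsingleton
  orthogonal : ∀ β ∈ D.evenSimple, ∀ d ∈ E, D.pairing d β = 0
  form_ne_zero' : ∀ d ∈ E, D.form d d ≠ 0
  exists_separating : ∀ d ∈ E, ∃ g : (ι → ℂ) →ₗ[ℂ] ℂ, (∀ β ∈ D.evenSimple, g β = 0) ∧ g d ≠ 0
  oddPos_finite : D.oddPos.Finite
  sRefl_oddPos : ∀ β ∈ D.evenSimple, ∀ x ∈ D.oddPos, D.sRefl β x ∈ D.oddPos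
  exists_height : ∃ ht : (ι → ℂ) →ₗ[ℂ] ℂ, (∀ x ∈ D.evenPos, ∃ n : ℕ, ht x = n + 1) ∧
    ∀ β ∈ D.evenSimple, ht β = 1
  evenBase_subset : D.evenBase ⊆ D.evenSimple ∪ E

/-! ### The Weyl group of the even part compared with the group of the even simple roots -/

namespace IsStandard

variable {D : SuperRootDatum ι} {R E : Set (ι → ℂ)}

lemma sRefl_eq_self (h : D.IsStandard R E) {β d : ι → ℂ} (hβ : β ∈ D.evenSimple) (hd : d ∈ E) :
    D.sRefl β d = d := by
  rw [sRefl_apply, h.orthogonal β hβ d hd, zero_smul, sub_zero]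

lemma simple_subset_evenPos (h : D.IsStandard R E) : D.evenSimple ⊆ D.evenPos := by
  rw [h.evenPos_eq]
  exact h.simple_subset.trans Set.subset_union_left

/-- A root of height one is not a sum of two roots of height at least one. -/
lemma simple_subset_evenBase (h : D.IsStandard R E) : D.evenSimple ⊆ D.evenBase := by
  intro α hα
  refine ⟨h.simple_subset_evenPos hα, ?_⟩
  rintro ⟨β, hβ, γ, hγ, rfl⟩
  obtain ⟨ht, h1, h2⟩ := h.exists_height
  obtain ⟨a, ha⟩ := h1 β hβ
  obtain ⟨b, hb⟩ := h1 γ hγ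
  have := h2 _ hα
  rw [map_add, ha, hb] at this
  have : a + 1 + (b + 1) = 1 := by exact_mod_cast this
  omega

lemma pairing_rho_eq_one (h : D.IsStandard R E) {α : ι → ℂ} (hα : α ∈ D.evenSimple) :
    D.pairing D.rho α = 1 := by
  refine pairing_rho (h.form_ne_zero α hα) (h.simple_subset_evenPos hα) ?_ ?_ h.oddPos_finite ?_
    (h.sRefl_oddPos α hα)
  · intro hn
    obtain ⟨ht, h1, h2⟩ := h.exists_height
    obtain ⟨a, ha⟩ := h1 _ hn
    rw [map_neg, h2 α hα] at ha
    have : (a + 1 + 1 : ℂ) = 0 := by rw [← ha]; ring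
    norm_cast at this
  · rw [h.evenPos_eq]
    exact h.finite.union h.subsingleton.finite
  · intro x hx hne
    rw [h.evenPos_eq] at hx ⊢
    rcases hx with hx | hx
    · exact Or.inl (h.sRefl_mem α hα x hx hne)
    · rw [h.sRefl_eq_self hα hx]
      exact Or.inr hx

lemma form_evenBase (h : D.IsStandard R E) : ∀ α ∈ D.evenBase, D.form α α ≠ 0 := by
  intro α hα
  rcases h.evenBase_subset hα with h1 | h1
  exacts [h.form_ne_zero α h1, h.form_ne_zero' α h1]

/-- The reflection in the extra root commutes with the simple reflections, so it can be collected on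
the right, where it occurs at most once. -/
lemma weyl_evenBase (h : D.IsStandard R E) {w : Module.End ℂ (ι → ℂ)}
    (hw : w ∈ D.weyl D.evenBase) :
    ∃ u ∈ D.weyl D.evenSimple, w = u ∨ ∃ d ∈ E, w = u * D.sRefl d := by
  induction hw using Submonoid.closure_induction_right with
  | one => exact ⟨1, one_mem _, Or.inl rfl⟩
  | mul_right w _ s hs ih =>
    obtain ⟨α, hα, rfl⟩ := hs
    obtain ⟨u, hu, ih⟩ := ih
    rcases h.evenBase_subset hα with hα | hα
    · refine ⟨u * D.sRefl α, mul_mem hu (D.sRefl_mem_weyl hα), ?_⟩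
      rcases ih with rfl | ⟨d, hd, rfl⟩
      · exact Or.inl rfl
      · refine Or.inr ⟨d, hd, ?_⟩
        rw [mul_assoc, mul_assoc, weyl_mul_sRefl h.symm h.form_ne_zero (D.sRefl_mem_weyl hα),
          h.sRefl_eq_self hα hd]
    · rcases ih with rfl | ⟨d, hd, rfl⟩
      · exact ⟨w, hu, Or.inr ⟨α, hα, rfl⟩⟩
      · rw [h.subsingleton hd hα, mul_assoc, sRefl_mul_self (h.form_ne_zero' α hα), mul_one]
        exact ⟨u, hu, Or.inl rfl⟩

lemma weyl_apply_eq_self (h : D.IsStandard R E) {w : Module.End ℂ (ι → ℂ)}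
    (hw : w ∈ D.weyl D.evenSimple) {d : ι → ℂ} (hd : d ∈ E) : w d = d := by
  induction hw using Submonoid.closure_induction with
  | mem _ hs => obtain ⟨β, hβ, rfl⟩ := hs; exact h.sRefl_eq_self hβ hd
  | one => rfl
  | mul u v _ _ hu hv => rw [Module.End.mul_apply, hv, hu]

lemma weyl_evenBase_finite (h : D.IsStandard R E) : {w | w ∈ D.weyl D.evenBase}.Finite := by
  refine (h.weyl_finite.union (h.weyl_finite.image2 (fun u d => u * D.sRefl d)
    h.subsingleton.finite)).subset fun w hw => ?_
  obtain ⟨u, hu, rfl | ⟨d, hd, rfl⟩⟩ := h.weyl_evenBase hw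
  · exact Or.inl hu
  · exact Or.inr ⟨u, hu, d, hd, rfl⟩

lemma linearIndependent (h : D.IsStandard R E) :
    LinearIndependent ℂ (fun α : D.evenSimple => (α : ι → ℂ)) := by
  classical
  rw [linearIndependent_iff']
  intro s g hg α hα
  obtain ⟨f, h1, h0⟩ := h.exists_coweight α α.2
  have := congrArg f hg
  rw [map_zero, map_sum, Finset.sum_eq_single α] at this
  · simpa [h1] using this
  · intro β _ hne
    rw [map_smul, h0 β β.2 fun hn => hne (Subtype.ext hn), smul_zero]
  · exact fun hn => absurd hα hn

/-- For `w = u * s_d` the difference `Λ - w Λ` contains `⟨Λ, d⟩ d`, which a linear form vanishing on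
the even simple roots detects. -/
lemma mem_weyl_of_sub_mem_span (h : D.IsStandard R E) {Λ : ι → ℂ} {k : (ι → ℂ) → ℕ}
    (hk : ∀ α ∈ D.evenSimple, D.pairing Λ α = k α) (hE : ∀ d ∈ E, D.pairing Λ d ≠ 0)
    {w : Module.End ℂ (ι → ℂ)} (hw : w ∈ D.weyl D.evenBase)
    (hspan : Λ - w Λ ∈ Submodule.span ℂ D.evenSimple) : w ∈ D.weyl D.evenSimple := by
  obtain ⟨u, hu, rfl | ⟨d, hd, rfl⟩⟩ := h.weyl_evenBase hw
  · exact hu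
  exfalso
  obtain ⟨g, hg, hgd⟩ := h.exists_separating d hd
  have hg' : ∀ x ∈ Submodule.span ℂ D.evenSimple, g x = 0 := by
    intro x hx
    have : Submodule.span ℂ D.evenSimple ≤ LinearMap.ker g := Submodule.span_le.2 hg
    exact this hx
  have h1 : Λ - u Λ ∈ Submodule.span ℂ D.evenSimple :=
    AddSubmonoid.closure_le (S := (Submodule.span ℂ D.evenSimple).toAddSubmonoid).2
      Submodule.subset_span (h.sub_weyl_mem_closure hk hu)
  have h2 : Λ - (u * D.sRefl d) Λ = (Λ - u Λ) + D.pairing Λ d • d := by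
    rw [Module.End.mul_apply, sRefl_apply, map_sub, map_smul, h.weyl_apply_eq_self hu hd]
    abel
  have h3 := hg' _ hspan
  rw [h2, map_add, hg' _ h1, zero_add, map_smul] at h3
  exact (smul_ne_zero (hE d hd) hgd) h3

open MvPowerSeries in
-- The form in which the four families use the argument: only the connectedness `hcon` and the
-- nonvanishing `hE` remain to be supplied.
theorem hasNonzeroCoeff (h : D.IsStandard R E) {lam γ : ι → ℂ} (hlam : D.IsDominantIntegral lam)
    (hγ : γ ∈ D.oddPos)
    (hcon : ∀ K ⊆ D.evenSimple, K.Nonempty → ∃ v ∈ K, D.pairing γ v ≠ 0 ∨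
      ∃ u ∈ D.evenSimple, u ∉ K ∧ D.pairing u v ≠ 0)
    (hE : ∀ d ∈ E, D.pairing (lam + D.rho) d ≠ 0)
    {φ : ∀ {σ : Type}, MvPowerSeries σ ℂ → MvPowerSeries σ ℂ} {c : ℂ} (hc : c ≠ 0)
    (hφ : ∀ {σ : Type} (z : MvPowerSeries σ ℂ), constantCoeff z = 0 →
      ∃ r, φ z = 1 + C c * z + z * z * r) :
    D.HasNonzeroCoeff D.evenSimple D.evenSimple φ lam γ ∧
      ∀ B, D.IsExpansionSet lam B → D.HasNonzeroCoeff D.evenBase B φ lam γ := by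
  have hk : ∀ α ∈ D.evenSimple, ∃ n : ℕ, D.pairing (lam + D.rho) α = (n : ℕ) ∧ 0 < n := by
    intro α hα
    obtain ⟨n, hn⟩ := hlam.exists_nat h.symm hα (h.form_ne_zero α hα)
    refine ⟨n + 1, ?_, Nat.succ_pos n⟩
    rw [← pairingHom_apply, map_add, pairingHom_apply, pairingHom_apply, hn,
      h.pairing_rho_eq_one hα, Nat.cast_add_one]
  choose! k hk hpos using hk
  constructor
  · refine h.toIsPositiveSystem.hasNonzeroCoeff (Or.inl hγ) hk hpos hcon subset_rfl h.form_ne_zero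
      h.weyl_finite subset_rfl h.linearIndependent (fun w hw => ?_) (fun w hw _ => hw) hc hφ
    have hle : AddSubmonoid.closure D.evenSimple ≤ AddMonoidHom.mrange (expWeight D.evenSimple) :=
      AddSubmonoid.closure_le.2 fun α hα => ⟨Finsupp.single ⟨α, hα⟩ 1, by
        rw [expWeight_apply, Finsupp.sum_single_index (by simp)]; simp⟩
    obtain ⟨c, hc⟩ := hle (h.sub_weyl_mem_closure hk hw)
    exact ⟨c, hc.symm⟩
  · rintro B ⟨hB, hind, hexp⟩
    exact h.toIsPositiveSystem.hasNonzeroCoeff (Or.inl hγ) hk hpos hcon h.simple_subset_evenBase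
      h.form_evenBase h.weyl_evenBase_finite hB hind hexp
      (fun w hw => h.mem_weyl_of_sub_mem_span hk hE hw) hc hφ

end IsStandard

end SuperRootDatum

namespace SuperRootDatum

/-! ### Data with diagonal Gram matrix -/

section Diagonal

variable {κ : Type} [Fintype κ] [DecidableEq κ] {D : SuperRootDatum κ} {g : κ → ℂ}

lemma form_diagonal (hD : D.gram = Matrix.diagonal g) (x y : κ → ℂ) :
    D.form x y = ∑ i, x i * (g i * y i) := by
  simp [form, hD, dotProduct, Matrix.mulVec_diagonal]

lemma form_single (hD : D.gram = Matrix.diagonal g) (x : κ → ℂ) (a : κ) (c : ℂ) :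
    D.form x (Pi.single a c) = x a * (g a * c) := by
  rw [form_diagonal hD, Finset.sum_eq_single a]
  · simp
  · intro b _ hb
    simp [hb]
  · simp

lemma form_single_sub (hD : D.gram = Matrix.diagonal g) (x : κ → ℂ) (a b : κ) :
    D.form x (Pi.single a 1 - Pi.single b 1) = x a * g a - x b * g b := by
  have := form_sub_smul_right D x (Pi.single a 1) (Pi.single b 1) 1
  rw [one_smul] at this
  rw [this, form_single hD, form_single hD]
  ring

lemma form_single_sub_self (hD : D.gram = Matrix.diagonal g) {a b : κ} (hab : a ≠ b) :
    D.form (Pi.single a 1 - Pi.single b 1) (Pi.single a 1 - Pi.single b 1) = g a + g b := by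
  rw [form_single_sub hD]
  simp [hab, hab.symm]

lemma pairing_single_sub (hD : D.gram = Matrix.diagonal g) {a b : κ} (hab : a ≠ b)
    (hg : g a = g b) (hg0 : g a ≠ 0) (x : κ → ℂ) :
    D.pairing x (Pi.single a 1 - Pi.single b 1) = x a - x b := by
  rw [pairing, form_single_sub_self hD hab, form_single_sub hD, ← hg]
  field_simp
  ring

lemma sRefl_single_sub (hD : D.gram = Matrix.diagonal g) {a b : κ} (hab : a ≠ b)
    (hg : g a = g b) (hg0 : g a ≠ 0) (c : κ) :
    D.sRefl (Pi.single a 1 - Pi.single b 1) (Pi.single c 1) =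
      Pi.single (Equiv.swap a b c) 1 := by
  rw [sRefl_apply, pairing_single_sub hD hab hg hg0]
  by_cases hca : c = a
  · subst hca
    simp [hab.symm]
  · by_cases hcb : c = b
    · subst hcb
      simp [hab]
    · rw [Equiv.swap_apply_of_ne_of_ne hca hcb]
      simp [Ne.symm hca, Ne.symm hcb]

lemma pairing_single (hD : D.gram = Matrix.diagonal g) {a : κ} (hg0 : g a ≠ 0) {c : ℂ}
    (hc : c ≠ 0) (x : κ → ℂ) : D.pairing x (Pi.single a c) = 2 * x a / c := by
  rw [pairing, form_single hD, form_single hD, Pi.single_eq_same]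
  field_simp

lemma sRefl_single (hD : D.gram = Matrix.diagonal g) {a : κ} (hg0 : g a ≠ 0) {c : ℂ}
    (hc : c ≠ 0) (b : κ) : D.sRefl (Pi.single a c) (Pi.single b 1) =
      if b = a then -Pi.single b 1 else Pi.single b 1 := by
  rw [sRefl_apply, pairing_single hD hg0 hc]
  split_ifs with h
  · subst h
    rw [Pi.single_eq_same, ← Pi.single_smul, smul_eq_mul, div_mul_cancel₀ _ hc, ← Pi.single_sub,
      ← Pi.single_neg]
    norm_num
  · rw [Pi.single_eq_of_ne (Ne.symm h)]
    simp

end Diagonal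

/-! ### Combinatorics of `Fin` -/

/-- An adjacent transposition reverses only the pair that it exchanges. This is why a simple
reflection of type A makes only its own root negative. -/
lemma swap_castSucc_succ_lt {n : ℕ} {a : Fin n} {i k : Fin (n + 1)} (hik : i < k)
    (h : ¬(i = a.castSucc ∧ k = a.succ)) :
    Equiv.swap a.castSucc a.succ i < Equiv.swap a.castSucc a.succ k := by
  have hval : ∀ j : Fin (n + 1), (Equiv.swap a.castSucc a.succ j).1 =
      if j.1 = a.1 then a.1 + 1 else if j.1 = a.1 + 1 then a.1 else j.1 := by
    intro j
    simp only [Equiv.swap_apply_def, Fin.ext_iff, Fin.val_castSucc, Fin.val_succ]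
    split_ifs <;> rfl
  rw [Fin.lt_def] at hik ⊢
  simp only [Fin.ext_iff, Fin.val_castSucc, Fin.val_succ] at h
  rw [hval, hval]
  split_ifs <;> omega

lemma eq_castSucc_succ_or_exists {n : ℕ} {i k : Fin (n + 1)} (hik : i < k) :
    (∃ a : Fin n, i = a.castSucc ∧ k = a.succ) ∨ ∃ j, i < j ∧ j < k := by
  rw [Fin.lt_def] at hik
  have := k.2
  by_cases h : k.1 = i.1 + 1
  · exact Or.inl ⟨⟨i.1, by omega⟩, Fin.ext rfl, Fin.ext h⟩
  · refine Or.inr ⟨⟨i.1 + 1, by omega⟩, ?_, ?_⟩ <;> rw [Fin.lt_def] <;> simp only <;> omega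

lemma sub_mem_of_castSucc_sub_succ_mem {V : Type*} [AddCommGroup V] {C : AddSubmonoid V} {n : ℕ}
    {f : Fin (n + 1) → V} (hf : ∀ a : Fin n, f a.castSucc - f a.succ ∈ C) {i k : Fin (n + 1)}
    (hik : i ≤ k) : f i - f k ∈ C := by
  induction k using Fin.induction with
  | zero => rw [Fin.le_zero_iff.1 hik, sub_self]; exact zero_mem C
  | succ k ih =>
    rcases hik.eq_or_lt with rfl | hlt
    · rw [sub_self]; exact zero_mem C
    · have := add_mem (ih (Fin.le_castSucc_iff.2 hlt)) (hf k)
      rwa [sub_add_sub_cancel] at this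

/-- Connectedness of a path, applied to Dynkin diagrams of type A. -/
lemma forall_mem_of_adjacent {n : ℕ} {A : Set (Fin n)} (hA : A.Nonempty)
    (h : ∀ a ∈ A, ∀ b : Fin n, (b.1 = a.1 + 1 ∨ a.1 = b.1 + 1) → b ∈ A) (b : Fin n) : b ∈ A := by
  obtain ⟨a, ha⟩ := hA
  have up : ∀ d, ∀ hd : a.1 + d < n, (⟨a.1 + d, hd⟩ : Fin n) ∈ A := by
    intro d
    induction d with
    | zero => exact fun _ => ha
    | succ d ih => exact fun hd => h _ (ih (by omega)) _ (Or.inl rfl)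
  have down : ∀ d, d ≤ a.1 → ∀ hd : a.1 - d < n, (⟨a.1 - d, hd⟩ : Fin n) ∈ A := by
    intro d
    induction d with
    | zero => exact fun _ _ => ha
    | succ d ih => exact fun hd _ => h _ (ih (by omega) (by omega)) _ (Or.inr (by simp; omega))
  rcases le_total a.1 b.1 with hab | hab
  · have := up (b.1 - a.1) (by omega)
    simpa [Nat.add_sub_cancel' hab] using this
  · have := down (a.1 - b.1) (by omega) (by omega)
    simpa [Nat.sub_sub_self hab] using this

/-! ### `sl(m+1, n+1)` -/

section Sl

variable (m n : ℕ)

lemma slDatum_gram : (slDatum m n).gram =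
    Matrix.diagonal (Sum.elim (fun _ => (1 : ℂ)) (fun _ => -1)) := rfl

lemma pairing_slEps_sub {a b : Fin (m + 1)} (hab : a ≠ b) (x : Fin (m + 1) ⊕ Fin (n + 1) → ℂ) :
    (slDatum m n).pairing x (slEps m n a - slEps m n b) = x (Sum.inl a) - x (Sum.inl b) := by
  rw [slEps, slEps, pairing_single_sub (slDatum_gram m n) (by simpa using hab) (by rfl) (by simp)]

lemma pairing_slDelta_sub {a b : Fin (n + 1)} (hab : a ≠ b)
    (x : Fin (m + 1) ⊕ Fin (n + 1) → ℂ) :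
    (slDatum m n).pairing x (slDelta m n a - slDelta m n b) = x (Sum.inr a) - x (Sum.inr b) := by
  rw [slDelta, slDelta, pairing_single_sub (slDatum_gram m n) (by simpa using hab) (by rfl) (by simp)]

lemma sRefl_slEps_sub {a b : Fin (m + 1)} (hab : a ≠ b) :
    (∀ i, (slDatum m n).sRefl (slEps m n a - slEps m n b) (slEps m n i) =
      slEps m n (Equiv.swap a b i)) ∧
    ∀ j, (slDatum m n).sRefl (slEps m n a - slEps m n b) (slDelta m n j) = slDelta m n j := by
  have hab' : (Sum.inl a : Fin (m + 1) ⊕ Fin (n + 1)) ≠ Sum.inl b := by simpa using hab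
  constructor
  · intro i
    refine (sRefl_single_sub (slDatum_gram m n) hab' rfl (by simp) (Sum.inl i)).trans ?_
    rw [Equiv.swap_apply_def, Equiv.swap_apply_def]
    simp only [Sum.inl.injEq]
    split_ifs <;> rfl
  · intro j
    refine (sRefl_single_sub (slDatum_gram m n) hab' rfl (by simp) (Sum.inr j)).trans ?_
    rw [Equiv.swap_apply_of_ne_of_ne (by simp) (by simp)]
    rfl

lemma sRefl_slDelta_sub {a b : Fin (n + 1)} (hab : a ≠ b) :
    (∀ i, (slDatum m n).sRefl (slDelta m n a - slDelta m n b) (slEps m n i) = slEps m n i) ∧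
    ∀ j, (slDatum m n).sRefl (slDelta m n a - slDelta m n b) (slDelta m n j) =
      slDelta m n (Equiv.swap a b j) := by
  have hab' : (Sum.inr a : Fin (m + 1) ⊕ Fin (n + 1)) ≠ Sum.inr b := by simpa using hab
  constructor
  · intro i
    refine (sRefl_single_sub (slDatum_gram m n) hab' rfl (by simp) (Sum.inl i)).trans ?_
    rw [Equiv.swap_apply_of_ne_of_ne (by simp) (by simp)]
    rfl
  · intro j
    refine (sRefl_single_sub (slDatum_gram m n) hab' rfl (by simp) (Sum.inr j)).trans ?_
    rw [Equiv.swap_apply_def, Equiv.swap_apply_def]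
    simp only [Sum.inr.injEq]
    split_ifs <;> rfl

/-- The linear form with the given values on the `ε i` and `δ j`. -/
noncomputable def slForm (u : Fin (m + 1) → ℂ) (v : Fin (n + 1) → ℂ) :
    (Fin (m + 1) ⊕ Fin (n + 1) → ℂ) →ₗ[ℂ] ℂ :=
  Fintype.linearCombination ℂ (Sum.elim u v)

@[simp] lemma slForm_slEps (u : Fin (m + 1) → ℂ) (v : Fin (n + 1) → ℂ) (i : Fin (m + 1)) :
    slForm m n u v (slEps m n i) = u i := by
  simp [slForm, slEps, Fintype.linearCombination_apply_single]

@[simp] lemma slForm_slDelta (u : Fin (m + 1) → ℂ) (v : Fin (n + 1) → ℂ) (j : Fin (n + 1)) :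
    slForm m n u v (slDelta m n j) = v j := by
  simp [slForm, slDelta, Fintype.linearCombination_apply_single]

lemma castSucc_ne_succ {k : ℕ} (a : Fin k) : a.castSucc ≠ a.succ := by
  simp [Fin.ext_iff]

lemma slDatum_sRefl_mem : ∀ β ∈ (slDatum m n).evenSimple, ∀ x ∈ (slDatum m n).evenPos, x ≠ β →
    (slDatum m n).sRefl β x ∈ (slDatum m n).evenPos := by
  rintro _ (⟨a, rfl⟩ | ⟨a, rfl⟩) _ (⟨i, k, hik, rfl⟩ | ⟨i, k, hik, rfl⟩) hne
  · obtain ⟨h1, _⟩ := sRefl_slEps_sub m n (castSucc_ne_succ a)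
    refine Or.inl ⟨_, _, swap_castSucc_succ_lt hik ?_, by rw [map_sub, h1, h1]⟩
    rintro ⟨rfl, rfl⟩
    exact hne rfl
  · obtain ⟨_, h2⟩ := sRefl_slEps_sub m n (castSucc_ne_succ a)
    exact Or.inr ⟨i, k, hik, by rw [map_sub, h2, h2]⟩
  · obtain ⟨h1, _⟩ := sRefl_slDelta_sub m n (castSucc_ne_succ a)
    exact Or.inl ⟨i, k, hik, by rw [map_sub, h1, h1]⟩
  · obtain ⟨_, h2⟩ := sRefl_slDelta_sub m n (castSucc_ne_succ a)
    refine Or.inr ⟨_, _, swap_castSucc_succ_lt hik ?_, by rw [map_sub, h2, h2]⟩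
    rintro ⟨rfl, rfl⟩
    exact hne rfl

lemma slDatum_finite : (slDatum m n).evenPos.Finite ∧ (slDatum m n).oddPos.Finite := by
  constructor
  · refine ((Set.finite_range fun p : Fin (m + 1) × Fin (m + 1) =>
      slEps m n p.1 - slEps m n p.2).union (Set.finite_range fun p : Fin (n + 1) × Fin (n + 1) =>
      slDelta m n p.1 - slDelta m n p.2)).subset ?_
    rintro _ (⟨i, k, _, rfl⟩ | ⟨i, k, _, rfl⟩)
    exacts [Or.inl ⟨(i, k), rfl⟩, Or.inr ⟨(i, k), rfl⟩]
  · refine (Set.finite_range fun p : Fin (m + 1) × Fin (n + 1) =>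
      slEps m n p.1 - slDelta m n p.2).subset ?_
    rintro _ ⟨i, k, rfl⟩
    exact ⟨(i, k), rfl⟩

/-- The indicator of an initial segment jumps only at its end, so it defines the fundamental
coweight of type A. -/
lemma coweight_castSucc_succ {k : ℕ} (a b : Fin k) :
    ((if b.castSucc ≤ a.castSucc then 1 else 0) - (if b.succ ≤ a.castSucc then 1 else 0) : ℂ) =
      if b = a then 1 else 0 := by
  simp only [Fin.le_def, Fin.val_castSucc, Fin.val_succ, Fin.ext_iff]
  split_ifs <;> first | omega | norm_num

lemma slDatum_isStandard : (slDatum m n).IsStandard (slDatum m n).evenPos ∅ where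
  symm := Matrix.diagonal_transpose _
  finite := (slDatum_finite m n).1
  simple_subset := by
    rintro _ (⟨a, rfl⟩ | ⟨a, rfl⟩)
    exacts [Or.inl ⟨_, _, Fin.castSucc_lt_succ, rfl⟩, Or.inr ⟨_, _, Fin.castSucc_lt_succ, rfl⟩]
  subset_closure := by
    rintro _ (⟨i, k, hik, rfl⟩ | ⟨i, k, hik, rfl⟩)
    · exact sub_mem_of_castSucc_sub_succ_mem (f := slEps m n)
        (fun a => AddSubmonoid.subset_closure (Or.inl ⟨a, rfl⟩)) hik.le
    · exact sub_mem_of_castSucc_sub_succ_mem (f := slDelta m n)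
        (fun a => AddSubmonoid.subset_closure (Or.inr ⟨a, rfl⟩)) hik.le
  sRefl_mem := slDatum_sRefl_mem m n
  form_ne_zero := by
    rintro _ (⟨a, rfl⟩ | ⟨a, rfl⟩)
    · rw [slEps, slEps, form_single_sub_self (slDatum_gram m n) (by simp [Fin.ext_iff])]
      norm_num
    · rw [slDelta, slDelta, form_single_sub_self (slDatum_gram m n) (by simp [Fin.ext_iff])]
      norm_num
  exists_coweight := by
    rintro _ (⟨a, rfl⟩ | ⟨a, rfl⟩)
    · refine ⟨slForm m n (fun i => if i ≤ a.castSucc then 1 else 0) 0, ?_, ?_⟩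
      · rw [map_sub, slForm_slEps, slForm_slEps, coweight_castSucc_succ, if_pos rfl]
      · rintro _ (⟨b, rfl⟩ | ⟨b, rfl⟩) hne
        · rw [map_sub, slForm_slEps, slForm_slEps, coweight_castSucc_succ, if_neg]
          rintro rfl
          exact hne rfl
        · simp
    · refine ⟨slForm m n 0 (fun i => if i ≤ a.castSucc then 1 else 0), ?_, ?_⟩
      · rw [map_sub, slForm_slDelta, slForm_slDelta, coweight_castSucc_succ, if_pos rfl]
      · rintro _ (⟨b, rfl⟩ | ⟨b, rfl⟩) hne
        · simp
        · rw [map_sub, slForm_slDelta, slForm_slDelta, coweight_castSucc_succ, if_neg]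
          rintro rfl
          exact hne rfl
  evenPos_eq := (Set.union_empty _).symm
  subsingleton := Set.subsingleton_empty
  orthogonal _ _ _ h := h.elim
  form_ne_zero' _ h := h.elim
  exists_separating _ h := h.elim
  oddPos_finite := (slDatum_finite m n).2
  sRefl_oddPos := by
    rintro _ (⟨a, rfl⟩ | ⟨a, rfl⟩) _ ⟨i, j, rfl⟩
    · obtain ⟨h1, h2⟩ := sRefl_slEps_sub m n (castSucc_ne_succ a)
      exact ⟨_, _, by rw [map_sub, h1, h2]⟩
    · obtain ⟨h1, h2⟩ := sRefl_slDelta_sub m n (castSucc_ne_succ a)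
      exact ⟨_, _, by rw [map_sub, h1, h2]⟩
  exists_height := by
    refine ⟨slForm m n (fun i => -(i : ℕ)) (fun j => -(j : ℕ)), ?_, ?_⟩
    · rintro _ (⟨i, k, hik, rfl⟩ | ⟨i, k, hik, rfl⟩) <;>
      · obtain ⟨d, hd⟩ := Nat.exists_eq_add_of_lt (Fin.lt_def.1 hik)
        refine ⟨d, ?_⟩
        simp only [map_sub, slForm_slEps, slForm_slDelta]
        rw [hd]
        push_cast
        ring
    · rintro _ (⟨a, rfl⟩ | ⟨a, rfl⟩) <;> simp
  evenBase_subset := by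
    rintro _ ⟨⟨i, k, hik, rfl⟩ | ⟨i, k, hik, rfl⟩, hn⟩
    · rcases eq_castSucc_succ_or_exists hik with ⟨a, rfl, rfl⟩ | ⟨j, h1, h2⟩
      · exact Or.inl (Or.inl ⟨a, rfl⟩)
      · exact absurd ⟨_, Or.inl ⟨i, j, h1, rfl⟩, _, Or.inl ⟨j, k, h2, rfl⟩, by abel⟩ hn
    · rcases eq_castSucc_succ_or_exists hik with ⟨a, rfl, rfl⟩ | ⟨j, h1, h2⟩
      · exact Or.inl (Or.inr ⟨a, rfl⟩)
      · exact absurd ⟨_, Or.inr ⟨i, j, h1, rfl⟩, _, Or.inr ⟨j, k, h2, rfl⟩, by abel⟩ hn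

/-- Every vertex of a path with at least one edge lies on an edge. -/
lemma eq_castSucc_or_eq_succ {k : ℕ} (a : Fin k) (i : Fin (k + 1)) :
    ∃ b : Fin k, i = b.castSucc ∨ i = b.succ := by
  induction i using Fin.cases with
  | zero => exact ⟨⟨0, a.pos⟩, Or.inl rfl⟩
  | succ b => exact ⟨b, Or.inr rfl⟩

lemma single_sub_single_adjacent {k : ℕ} {a b : Fin k} (h : b.1 = a.1 + 1 ∨ a.1 = b.1 + 1) :
    ((Pi.single b.castSucc 1 - Pi.single b.succ 1 : Fin (k + 1) → ℂ) a.castSucc -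
      (Pi.single b.castSucc 1 - Pi.single b.succ 1 : Fin (k + 1) → ℂ) a.succ) ≠ 0 := by
  simp only [Pi.sub_apply, Pi.single_apply, Fin.ext_iff, Fin.val_castSucc, Fin.val_succ]
  split_ifs <;> first | omega | norm_num

/-- The diagram consists of two paths. The root `ε i - δ j` is not orthogonal to a simple root on
the first path that involves `ε i`, nor to one on the second that involves `δ j`. A counterexample
`K` would contain a whole path. -/
lemma slDatum_connected {γ : Fin (m + 1) ⊕ Fin (n + 1) → ℂ} (hγ : γ ∈ (slDatum m n).oddPos) :
    ∀ K ⊆ (slDatum m n).evenSimple, K.Nonempty → ∃ v ∈ K, (slDatum m n).pairing γ v ≠ 0 ∨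
      ∃ u ∈ (slDatum m n).evenSimple, u ∉ K ∧ (slDatum m n).pairing u v ≠ 0 := by
  obtain ⟨i, j, rfl⟩ := hγ
  intro K hK ⟨v, hv⟩
  by_contra! hcon
  have hne := fun {k : ℕ} (a : Fin k) => castSucc_ne_succ a
  rcases hK hv with ⟨a, rfl⟩ | ⟨a, rfl⟩
  · have hall := forall_mem_of_adjacent
      (A := {a : Fin m | slEps m n a.castSucc - slEps m n a.succ ∈ K}) ⟨a, hv⟩ (by
        intro a ha b hb
        by_contra hbK
        have := (hcon _ ha).2 _ (Or.inl ⟨b, rfl⟩) hbK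
        rw [pairing_slEps_sub m n (hne a)] at this
        refine single_sub_single_adjacent hb ?_
        simpa [slEps, Pi.single_apply] using this)
    obtain ⟨b, hb⟩ := eq_castSucc_or_eq_succ a i
    have := (hcon _ (hall b)).1
    rw [pairing_slEps_sub m n (hne b)] at this
    rcases hb with rfl | rfl <;> simp [slEps, slDelta, Fin.ext_iff] at this
  · have hall := forall_mem_of_adjacent
      (A := {a : Fin n | slDelta m n a.castSucc - slDelta m n a.succ ∈ K}) ⟨a, hv⟩ (by
        intro a ha b hb
        by_contra hbK
        have := (hcon _ ha).2 _ (Or.inr ⟨b, rfl⟩) hbK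
        rw [pairing_slDelta_sub m n (hne a)] at this
        refine single_sub_single_adjacent hb ?_
        simpa [slDelta, Pi.single_apply] using this)
    obtain ⟨b, hb⟩ := eq_castSucc_or_eq_succ a j
    have := (hcon _ (hall b)).1
    rw [pairing_slDelta_sub m n (hne b)] at this
    rcases hb with rfl | rfl <;> simp [slEps, slDelta, Fin.ext_iff] at this

end Sl

end SuperRootDatum

namespace SuperRootDatum

/-! ### `osp(2, 2n)` -/

section Osp

variable (r : ℕ)

lemma ospDatum_gram : (ospDatum r).gram =
    Matrix.diagonal (Sum.elim (fun _ => (1 : ℂ)) (fun _ => -1)) := rfl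

lemma two_smul_ospDelta (j : Fin (r + 1)) :
    (2 : ℂ) • ospDelta r j = Pi.single (Sum.inr j) 2 := by
  rw [ospDelta, ← Pi.single_smul, smul_eq_mul, mul_one]

lemma pairing_ospDelta_sub {a b : Fin (r + 1)} (hab : a ≠ b) (x : Unit ⊕ Fin (r + 1) → ℂ) :
    (ospDatum r).pairing x (ospDelta r a - ospDelta r b) = x (Sum.inr a) - x (Sum.inr b) := by
  rw [ospDelta, ospDelta,
    pairing_single_sub (ospDatum_gram r) (by simpa using hab) (by rfl) (by simp)]

lemma pairing_two_ospDelta (a : Fin (r + 1)) (x : Unit ⊕ Fin (r + 1) → ℂ) :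
    (ospDatum r).pairing x ((2 : ℂ) • ospDelta r a) = x (Sum.inr a) := by
  rw [two_smul_ospDelta, pairing_single (ospDatum_gram r) (by simp) two_ne_zero,
    mul_div_cancel_left₀ _ two_ne_zero]

lemma sRefl_ospDelta_sub {a b : Fin (r + 1)} (hab : a ≠ b) :
    ((ospDatum r).sRefl (ospDelta r a - ospDelta r b) (ospEps r) = ospEps r) ∧
    ∀ j, (ospDatum r).sRefl (ospDelta r a - ospDelta r b) (ospDelta r j) =
      ospDelta r (Equiv.swap a b j) := by
  have hab' : (Sum.inr a : Unit ⊕ Fin (r + 1)) ≠ Sum.inr b := by simpa using hab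
  constructor
  · refine (sRefl_single_sub (ospDatum_gram r) hab' rfl (by simp) (Sum.inl ())).trans ?_
    rw [Equiv.swap_apply_of_ne_of_ne (by simp) (by simp)]
    rfl
  · intro j
    refine (sRefl_single_sub (ospDatum_gram r) hab' rfl (by simp) (Sum.inr j)).trans ?_
    rw [Equiv.swap_apply_def, Equiv.swap_apply_def]
    simp only [Sum.inr.injEq]
    split_ifs <;> rfl

lemma sRefl_two_ospDelta (a : Fin (r + 1)) :
    ((ospDatum r).sRefl ((2 : ℂ) • ospDelta r a) (ospEps r) = ospEps r) ∧
    ((ospDatum r).sRefl ((2 : ℂ) • ospDelta r a) (ospDelta r a) = -ospDelta r a) ∧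
    ∀ j, j ≠ a → (ospDatum r).sRefl ((2 : ℂ) • ospDelta r a) (ospDelta r j) = ospDelta r j := by
  rw [two_smul_ospDelta, ospEps]
  refine ⟨?_, ?_, fun j hj => ?_⟩
  · rw [sRefl_single (ospDatum_gram r) (by simp) two_ne_zero, if_neg (by simp)]
  · rw [ospDelta, sRefl_single (ospDatum_gram r) (by simp) two_ne_zero, if_pos rfl]
  · rw [ospDelta, sRefl_single (ospDatum_gram r) (by simp) two_ne_zero, if_neg (by simpa using hj)]

/-- The linear form with the given values on `ε` and the `δ j`. -/
noncomputable def ospForm (u : ℂ) (v : Fin (r + 1) → ℂ) :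
    (Unit ⊕ Fin (r + 1) → ℂ) →ₗ[ℂ] ℂ :=
  Fintype.linearCombination ℂ (Sum.elim (fun _ => u) v)

@[simp] lemma ospForm_ospDelta (u : ℂ) (v : Fin (r + 1) → ℂ) (j : Fin (r + 1)) :
    ospForm r u v (ospDelta r j) = v j := by
  simp [ospForm, ospDelta, Fintype.linearCombination_apply_single]

lemma ospDatum_sRefl_mem : ∀ β ∈ (ospDatum r).evenSimple, ∀ x ∈ (ospDatum r).evenPos, x ≠ β →
    (ospDatum r).sRefl β x ∈ (ospDatum r).evenPos := by
  rintro _ (⟨a, rfl⟩ | rfl) _ (⟨j, rfl⟩ | ⟨j, k, hjk, rfl | rfl⟩) hne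
  · obtain ⟨_, h2⟩ := sRefl_ospDelta_sub r (castSucc_ne_succ a)
    exact Or.inl ⟨_, by rw [map_smul, h2]⟩
  · obtain ⟨_, h2⟩ := sRefl_ospDelta_sub r (castSucc_ne_succ a)
    refine Or.inr ⟨_, _, swap_castSucc_succ_lt hjk ?_, Or.inl (by rw [map_sub, h2, h2])⟩
    rintro ⟨rfl, rfl⟩
    exact hne rfl
  · obtain ⟨_, h2⟩ := sRefl_ospDelta_sub r (castSucc_ne_succ a)
    rw [map_add, h2, h2]
    have hswap : Equiv.swap a.castSucc a.succ j ≠ Equiv.swap a.castSucc a.succ k :=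
      fun h => hjk.ne (Equiv.injective _ h)
    rcases hswap.lt_or_gt with hlt | hlt
    · exact Or.inr ⟨_, _, hlt, Or.inr rfl⟩
    · exact Or.inr ⟨_, _, hlt, Or.inr (add_comm _ _)⟩
  · obtain ⟨_, _, h3⟩ := sRefl_two_ospDelta r (Fin.last r)
    refine Or.inl ⟨j, ?_⟩
    rw [map_smul, h3 j]
    rintro rfl
    exact hne rfl
  · obtain ⟨_, h2, h3⟩ := sRefl_two_ospDelta r (Fin.last r)
    refine Or.inr ⟨j, k, hjk, ?_⟩
    rw [map_sub, h3 j (hjk.trans_le (Fin.le_last k)).ne]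
    by_cases hk : k = Fin.last r
    · subst hk
      rw [h2, sub_neg_eq_add]
      exact Or.inr rfl
    · rw [h3 k hk]
      exact Or.inl rfl
  · obtain ⟨_, h2, h3⟩ := sRefl_two_ospDelta r (Fin.last r)
    refine Or.inr ⟨j, k, hjk, ?_⟩
    rw [map_add, h3 j (hjk.trans_le (Fin.le_last k)).ne]
    by_cases hk : k = Fin.last r
    · subst hk
      rw [h2, ← sub_eq_add_neg]
      exact Or.inl rfl
    · rw [h3 k hk]
      exact Or.inr rfl

lemma ospDatum_finite : (ospDatum r).evenPos.Finite ∧ (ospDatum r).oddPos.Finite := by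
  constructor
  · refine ((Set.finite_range fun j : Fin (r + 1) => (2 : ℂ) • ospDelta r j).union
      ((Set.finite_range fun p : Fin (r + 1) × Fin (r + 1) => ospDelta r p.1 - ospDelta r p.2).union
      (Set.finite_range fun p : Fin (r + 1) × Fin (r + 1) =>
        ospDelta r p.1 + ospDelta r p.2))).subset ?_
    rintro _ (⟨j, rfl⟩ | ⟨j, k, _, rfl | rfl⟩)
    exacts [Or.inl ⟨j, rfl⟩, Or.inr (Or.inl ⟨(j, k), rfl⟩), Or.inr (Or.inr ⟨(j, k), rfl⟩)]
  · refine ((Set.finite_range fun j : Fin (r + 1) => ospEps r + ospDelta r j).union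
      (Set.finite_range fun j : Fin (r + 1) => ospEps r - ospDelta r j)).subset ?_
    rintro _ ⟨j, rfl | rfl⟩
    exacts [Or.inl ⟨j, rfl⟩, Or.inr ⟨j, rfl⟩]

lemma ospDatum_subset_closure :
    (ospDatum r).evenPos ⊆ AddSubmonoid.closure (ospDatum r).evenSimple := by
  have hsub : ∀ {i k : Fin (r + 1)}, i ≤ k →
      ospDelta r i - ospDelta r k ∈ AddSubmonoid.closure (ospDatum r).evenSimple := fun hik =>
    sub_mem_of_castSucc_sub_succ_mem (f := ospDelta r)
      (fun a => AddSubmonoid.subset_closure (Or.inl ⟨a, rfl⟩)) hik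
  have htwo : ∀ j, (2 : ℂ) • ospDelta r j ∈ AddSubmonoid.closure (ospDatum r).evenSimple := by
    intro j
    have h1 := hsub (Fin.le_last j)
    have h2 : (2 : ℂ) • ospDelta r (Fin.last r) ∈
      AddSubmonoid.closure (ospDatum r).evenSimple := AddSubmonoid.subset_closure (Or.inr rfl)
    have := add_mem (add_mem h1 h1) h2
    convert this using 1
    rw [two_smul, two_smul]
    abel
  rintro _ (⟨j, rfl⟩ | ⟨j, k, hjk, rfl | rfl⟩)
  · exact htwo j
  · exact hsub hjk.le
  · have := add_mem (hsub hjk.le) (htwo k)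
    rw [SetLike.mem_coe]
    convert this using 1
    rw [two_smul]
    abel

lemma ospDatum_isStandard : (ospDatum r).IsStandard (ospDatum r).evenPos ∅ where
  symm := Matrix.diagonal_transpose _
  finite := (ospDatum_finite r).1
  simple_subset := by
    rintro _ (⟨a, rfl⟩ | rfl)
    exacts [Or.inr ⟨_, _, Fin.castSucc_lt_succ, Or.inl rfl⟩, Or.inl ⟨_, rfl⟩]
  subset_closure := ospDatum_subset_closure r
  sRefl_mem := ospDatum_sRefl_mem r
  form_ne_zero := by
    rintro _ (⟨a, rfl⟩ | rfl)
    · rw [ospDelta, ospDelta, form_single_sub_self (ospDatum_gram r) (by simp [Fin.ext_iff])]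
      norm_num
    · rw [two_smul_ospDelta, form_single (ospDatum_gram r)]
      simp
  exists_coweight := by
    rintro _ (⟨a, rfl⟩ | rfl)
    · refine ⟨ospForm r 0 (fun i => if i ≤ a.castSucc then 1 else 0), ?_, ?_⟩
      · rw [map_sub, ospForm_ospDelta, ospForm_ospDelta, coweight_castSucc_succ, if_pos rfl]
      · rintro _ (⟨b, rfl⟩ | rfl) hne
        · rw [map_sub, ospForm_ospDelta, ospForm_ospDelta, coweight_castSucc_succ, if_neg]
          rintro rfl
          exact hne rfl
        · rw [map_smul, ospForm_ospDelta, if_neg, smul_zero]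
          simp [Fin.le_def]
    -- The value is `1 / 2` because the last simple root is twice the last `δ`.
    · refine ⟨ospForm r 0 (fun _ => 1 / 2), ?_, ?_⟩
      · simp
      · rintro _ (⟨b, rfl⟩ | rfl) hne
        · simp
        · exact absurd rfl hne
  evenPos_eq := (Set.union_empty _).symm
  subsingleton := Set.subsingleton_empty
  orthogonal _ _ _ h := h.elim
  form_ne_zero' _ h := h.elim
  exists_separating _ h := h.elim
  oddPos_finite := (ospDatum_finite r).2
  sRefl_oddPos := by
    rintro _ (⟨a, rfl⟩ | rfl) _ ⟨j, rfl | rfl⟩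
    · obtain ⟨h1, h2⟩ := sRefl_ospDelta_sub r (castSucc_ne_succ a)
      exact ⟨_, Or.inl (by rw [map_add, h1, h2])⟩
    · obtain ⟨h1, h2⟩ := sRefl_ospDelta_sub r (castSucc_ne_succ a)
      exact ⟨_, Or.inr (by rw [map_sub, h1, h2])⟩
    · obtain ⟨h1, h2, h3⟩ := sRefl_two_ospDelta r (Fin.last r)
      refine ⟨j, ?_⟩
      rw [map_add, h1]
      by_cases hj : j = Fin.last r
      · rw [hj, h2]
        exact Or.inr (sub_eq_add_neg _ _).symm
      · rw [h3 j hj]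
        exact Or.inl rfl
    · obtain ⟨h1, h2, h3⟩ := sRefl_two_ospDelta r (Fin.last r)
      refine ⟨j, ?_⟩
      rw [map_sub, h1]
      by_cases hj : j = Fin.last r
      · rw [hj, h2]
        exact Or.inl (sub_neg_eq_add _ _)
      · rw [h3 j hj]
        exact Or.inr rfl
  exists_height := by
    -- The values decrease by one and end at `1 / 2`, so that the long simple root also has height
    -- one.
    refine ⟨ospForm r 0 (fun j => (r : ℂ) - (j : ℕ) + 1 / 2), ?_, ?_⟩
    · rintro _ (⟨j, rfl⟩ | ⟨j, k, hjk, rfl | rfl⟩)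
      · obtain ⟨d, hd⟩ := Nat.exists_eq_add_of_le (Fin.is_le j)
        refine ⟨2 * d, ?_⟩
        have : (r : ℂ) = j + d := by exact_mod_cast hd
        rw [map_smul, ospForm_ospDelta, this, smul_eq_mul]
        push_cast
        ring
      · obtain ⟨d, hd⟩ := Nat.exists_eq_add_of_lt (Fin.lt_def.1 hjk)
        refine ⟨d, ?_⟩
        rw [map_sub, ospForm_ospDelta, ospForm_ospDelta, hd]
        push_cast
        ring
      · obtain ⟨d, hd⟩ := Nat.exists_eq_add_of_le (Fin.is_le j)
        obtain ⟨d', hd'⟩ := Nat.exists_eq_add_of_le (Fin.is_le k)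
        refine ⟨d + d', ?_⟩
        have h1 : (r : ℂ) = j + d := by exact_mod_cast hd
        have h2 : (r : ℂ) = k + d' := by exact_mod_cast hd'
        rw [map_add, ospForm_ospDelta, ospForm_ospDelta]
        push_cast
        linear_combination h1 + h2
    · rintro _ (⟨a, rfl⟩ | rfl)
      · simp
      · simp
  evenBase_subset := by
    rintro _ ⟨⟨j, rfl⟩ | ⟨j, k, hjk, rfl | rfl⟩, hn⟩
    · by_cases hj : j = Fin.last r
      · exact Or.inl (Or.inr (by rw [hj]; rfl))
      · have hlt : j < Fin.last r := lt_of_le_of_ne (Fin.le_last j) hj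
        refine absurd ⟨_, Or.inr ⟨j, Fin.last r, hlt, Or.inl rfl⟩, _,
          Or.inr ⟨j, Fin.last r, hlt, Or.inr rfl⟩, ?_⟩ hn
        rw [two_smul]
        abel
    · rcases eq_castSucc_succ_or_exists hjk with ⟨a, rfl, rfl⟩ | ⟨i, h1, h2⟩
      · exact Or.inl (Or.inl ⟨a, rfl⟩)
      · exact absurd ⟨_, Or.inr ⟨j, i, h1, Or.inl rfl⟩, _, Or.inr ⟨i, k, h2, Or.inl rfl⟩,
          by abel⟩ hn
    · refine absurd ⟨_, Or.inr ⟨j, k, hjk, Or.inl rfl⟩, _, Or.inl ⟨k, rfl⟩, ?_⟩ hn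
      rw [two_smul]
      abel

/-- The diagram of type C is connected, so a counterexample `K` contains all simple roots.
Orthogonality to all of them makes every `δ`-coordinate of `γ` vanish, starting from the last. -/
lemma ospDatum_connected {γ : Unit ⊕ Fin (r + 1) → ℂ} (hγ : γ ∈ (ospDatum r).oddPos) :
    ∀ K ⊆ (ospDatum r).evenSimple, K.Nonempty → ∃ v ∈ K, (ospDatum r).pairing γ v ≠ 0 ∨
      ∃ u ∈ (ospDatum r).evenSimple, u ∉ K ∧ (ospDatum r).pairing u v ≠ 0 := by
  intro K hK ⟨v, hv⟩
  by_contra! hcon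
  have hne := fun {k : ℕ} (a : Fin k) => castSucc_ne_succ a
  set A := {a : Fin r | ospDelta r a.castSucc - ospDelta r a.succ ∈ K} with hA
  have hall : A.Nonempty → ∀ a, a ∈ A := by
    refine fun hAne => forall_mem_of_adjacent hAne ?_
    intro a ha b hb
    by_contra hbK
    have := (hcon _ ha).2 _ (Or.inl ⟨b, rfl⟩) hbK
    rw [pairing_ospDelta_sub r (hne a)] at this
    refine single_sub_single_adjacent hb ?_
    simpa [ospDelta, Pi.single_apply] using this
  have hA' : ∀ a, a ∈ A := by
    intro a
    rcases hK hv with ⟨b, rfl⟩ | rfl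
    · exact hall ⟨b, hv⟩ a
    · have hr := a.pos
      let b : Fin r := ⟨r - 1, by omega⟩
      have hb : b.succ = Fin.last r := Fin.ext (by simp [b]; omega)
      have hb' : b.castSucc ≠ Fin.last r := hb ▸ castSucc_ne_succ b
      refine hall ⟨b, ?_⟩ a
      by_contra hbK
      have := (hcon _ hv).2 _ (Or.inl ⟨b, rfl⟩) hbK
      rw [pairing_two_ospDelta, hb] at this
      simp [ospDelta, hb'] at this
  have hlast : (2 : ℂ) • ospDelta r (Fin.last r) ∈ K := by
    rcases hK hv with ⟨a, rfl⟩ | rfl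
    · have hr := a.pos
      let b : Fin r := ⟨r - 1, by omega⟩
      have hb : b.succ = Fin.last r := Fin.ext (by simp [b]; omega)
      by_contra hbK
      have := (hcon _ (hA' b)).2 _ (Or.inr rfl) hbK
      rw [pairing_ospDelta_sub r (hne b), hb] at this
      simp [ospDelta] at this
    · exact hv
  have hzero : ∀ j, γ (Sum.inr j) = 0 := by
    intro j
    induction j using Fin.reverseInduction with
    | last =>
      have := (hcon _ hlast).1
      rwa [pairing_two_ospDelta] at this
    | cast a ih =>
      have := (hcon _ (hA' a)).1
      rwa [pairing_ospDelta_sub r (hne a), ih, sub_zero] at this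
  obtain ⟨j, rfl | rfl⟩ := hγ
  · have := hzero j
    simp [ospEps, ospDelta] at this
  · have := hzero j
    simp [ospEps, ospDelta] at this

end Osp

end SuperRootDatum

namespace SuperRootDatum

/-! ### `G(3)` -/

section G3

lemma g3Datum_form (x y : Fin 3 → ℂ) : g3Datum.form x y =
    x 0 * (2 * y 0 - y 1) + x 1 * (2 * y 1 - y 0) - 2 * (x 2 * y 2) := by
  simp [form, g3Datum, dotProduct, Matrix.mulVec, Fin.sum_univ_three]
  ring

/-- The positive roots of the subalgebra `G₂` of `G(3)`. -/
def g3Pos : Set (Fin 3 → ℂ) :=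
  {![1, 0, 0], ![0, 1, 0], ![1, 1, 0], ![-1, 1, 0], ![2, 1, 0], ![1, 2, 0]}

lemma g3Datum_evenPos : g3Datum.evenPos = g3Pos ∪ {![0, 0, 2]} := by
  have h : g3Datum.evenPos = {g3Eps 0, g3Eps 1, -g3Eps 2, g3Eps 1 - g3Eps 0, g3Eps 0 - g3Eps 2,
    g3Eps 1 - g3Eps 2} ∪ {(2 : ℂ) • g3Delta} := by
    simp only [g3Datum, Set.insert_union, Set.singleton_union]
  rw [h, g3Pos]
  congr! <;> (ext i; fin_cases i <;> simp [g3Eps, g3Delta] <;> norm_num)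

lemma g3Datum_evenSimple : g3Datum.evenSimple = {![1, 0, 0], ![-1, 1, 0]} := by
  have h : g3Datum.evenSimple = {g3Eps 0, g3Eps 1 - g3Eps 0} := rfl
  rw [h]
  congr!
  ext i
  fin_cases i <;> norm_num [g3Eps]

lemma g3Datum_oddPos : g3Datum.oddPos = {![0, 0, 1], ![1, 0, 1], ![-1, 0, 1], ![0, 1, 1],
    ![0, -1, 1], ![-1, -1, 1], ![1, 1, 1]} := by
  ext x
  simp only [g3Datum, Set.mem_union, Set.mem_ofPred_eq, Set.mem_insert_iff,
    Set.mem_singleton_iff, Fin.exists_fin_succ, g3Eps, g3Delta]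
  simp
  tauto

lemma g3Datum_pairing_short (x : Fin 3 → ℂ) : g3Datum.pairing x ![1, 0, 0] = 2 * x 0 - x 1 := by
  simp only [pairing, g3Datum_form]
  simp
  ring

lemma g3Datum_pairing_long (x : Fin 3 → ℂ) : g3Datum.pairing x ![-1, 1, 0] = x 1 - x 0 := by
  simp only [pairing, g3Datum_form]
  simp
  ring

lemma g3Datum_pairing_delta (x : Fin 3 → ℂ) : g3Datum.pairing x ![0, 0, 2] = x 2 := by
  simp only [pairing, g3Datum_form]
  simp
  ring

lemma g3Datum_sRefl_short (a b c : ℂ) :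
    g3Datum.sRefl ![1, 0, 0] ![a, b, c] = ![b - a, b, c] := by
  rw [sRefl_apply, g3Datum_pairing_short]
  ext i
  fin_cases i <;> (simp; try ring)

lemma g3Datum_sRefl_long (a b c : ℂ) :
    g3Datum.sRefl ![-1, 1, 0] ![a, b, c] = ![b, a, c] := by
  rw [sRefl_apply, g3Datum_pairing_long]
  ext i
  fin_cases i <;> simp

/-- The linear form with the given coefficients. -/
noncomputable def g3Form (a b c : ℂ) : (Fin 3 → ℂ) →ₗ[ℂ] ℂ :=
  Fintype.linearCombination ℂ ![a, b, c]

@[simp] lemma g3Form_apply (a b c : ℂ) (x : Fin 3 → ℂ) :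
    g3Form a b c x = x 0 * a + x 1 * b + x 2 * c := by
  simp [g3Form, Fintype.linearCombination_apply, Fin.sum_univ_three]

lemma g3Pos_subset_closure : g3Pos ⊆ AddSubmonoid.closure g3Datum.evenSimple := by
  have h1 : ![1, 0, 0] ∈ AddSubmonoid.closure g3Datum.evenSimple :=
    AddSubmonoid.subset_closure (by simp [g3Datum_evenSimple])
  have h2 : ![-1, 1, 0] ∈ AddSubmonoid.closure g3Datum.evenSimple :=
    AddSubmonoid.subset_closure (by simp [g3Datum_evenSimple])
  have h3 : ![0, 1, 0] ∈ AddSubmonoid.closure g3Datum.evenSimple := by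
    simpa using add_mem h1 h2
  have h4 : ![1, 1, 0] ∈ AddSubmonoid.closure g3Datum.evenSimple := by
    simpa using add_mem h1 h3
  have h5 : ![2, 1, 0] ∈ AddSubmonoid.closure g3Datum.evenSimple := by
    have := add_mem h1 h4
    norm_num at this
    exact this
  have h6 : ![1, 2, 0] ∈ AddSubmonoid.closure g3Datum.evenSimple := by
    have := add_mem h3 h4
    norm_num at this
    exact this
  rintro _ (rfl | rfl | rfl | rfl | rfl | rfl)
  exacts [h1, h3, h4, h2, h5, h6]

lemma g3Datum_isStandard : g3Datum.IsStandard g3Pos {![0, 0, 2]} where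
  symm := by
    ext i j
    fin_cases i <;> fin_cases j <;> rfl
  finite := by simp [g3Pos]
  simple_subset := by
    rw [g3Datum_evenSimple]
    rintro _ (rfl | rfl) <;> simp [g3Pos]
  subset_closure := g3Pos_subset_closure
  sRefl_mem := by
    rw [g3Datum_evenSimple]
    rintro _ (rfl | rfl) _ (rfl | rfl | rfl | rfl | rfl | rfl) hne <;>
      first
      | exact absurd rfl hne
      | (simp only [g3Datum_sRefl_short, g3Datum_sRefl_long]; norm_num [g3Pos])
  form_ne_zero := by
    rw [g3Datum_evenSimple]
    rintro _ (rfl | rfl) <;> rw [g3Datum_form] <;> simp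
    norm_num
  exists_coweight := by
    rw [g3Datum_evenSimple]
    rintro _ (rfl | rfl)
    · refine ⟨g3Form 1 1 0, by simp, ?_⟩
      rintro _ (rfl | rfl) hne
      · exact absurd rfl hne
      · simp
    · refine ⟨g3Form 0 1 0, by simp, ?_⟩
      rintro _ (rfl | rfl) hne
      · simp
      · exact absurd rfl hne
  evenPos_eq := g3Datum_evenPos
  subsingleton := Set.subsingleton_singleton
  orthogonal := by
    rw [g3Datum_evenSimple]
    rintro _ (rfl | rfl) _ rfl
    · rw [g3Datum_pairing_short]; simp
    · rw [g3Datum_pairing_long]; simp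
  form_ne_zero' := by
    rintro _ rfl
    rw [g3Datum_form]
    simp
  exists_separating := by
    rintro _ rfl
    refine ⟨g3Form 0 0 1, ?_, by simp⟩
    rw [g3Datum_evenSimple]
    rintro _ (rfl | rfl) <;> simp
  oddPos_finite := by simp [g3Datum_oddPos]
  sRefl_oddPos := by
    rw [g3Datum_evenSimple, g3Datum_oddPos]
    rintro _ (rfl | rfl) _ (rfl | rfl | rfl | rfl | rfl | rfl | rfl) <;>
      simp only [g3Datum_sRefl_short, g3Datum_sRefl_long] <;> norm_num
  exists_height := by
    refine ⟨g3Form 1 2 (1 / 2), ?_, ?_⟩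
    · rw [g3Datum_evenPos, g3Pos]
      rintro _ ((rfl | rfl | rfl | rfl | rfl | rfl) | rfl)
      exacts [⟨0, by simp⟩, ⟨1, by simp; norm_num⟩, ⟨2, by simp; norm_num⟩,
        ⟨0, by simp; norm_num⟩, ⟨3, by simp; norm_num⟩, ⟨4, by simp; norm_num⟩, ⟨0, by simp⟩]
    · rw [g3Datum_evenSimple]
      rintro _ (rfl | rfl) <;> simp
      norm_num
  evenBase_subset := by
    rintro x ⟨hx, hn⟩
    rw [g3Datum_evenPos] at hx hn
    rw [g3Datum_evenSimple]
    have key : ∀ y ∈ g3Pos, ∀ z ∈ g3Pos, x ≠ y + z := fun y hy z hz hyz =>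
      hn ⟨y, Or.inl hy, z, Or.inl hz, hyz⟩
    rcases hx with (rfl | rfl | rfl | rfl | rfl | rfl) | hx
    · exact Or.inl (Or.inl rfl)
    · exact absurd (by simp) (key ![1, 0, 0] (by simp [g3Pos]) ![-1, 1, 0] (by simp [g3Pos]))
    · exact absurd (by simp) (key ![1, 0, 0] (by simp [g3Pos]) ![0, 1, 0] (by simp [g3Pos]))
    · exact Or.inl (Or.inr rfl)
    · exact absurd (by norm_num) (key ![1, 0, 0] (by simp [g3Pos]) ![1, 1, 0] (by simp [g3Pos]))
    · exact absurd (by norm_num) (key ![0, 1, 0] (by simp [g3Pos]) ![1, 1, 0] (by simp [g3Pos]))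
    · exact Or.inr hx

/-- Isotropy excludes the odd root `δ`, the only one without a component along `G₂`. -/
lemma g3Datum_ne_zero {γ : Fin 3 → ℂ} (hγ : γ ∈ g3Datum.oddPos) (h0 : g3Datum.form γ γ = 0) :
    ¬(γ 0 = 0 ∧ γ 1 = 0) := by
  rw [g3Datum_oddPos] at hγ
  rw [g3Datum_form] at h0
  rcases hγ with rfl | rfl | rfl | rfl | rfl | rfl | rfl <;> simp at h0 ⊢

lemma g3Datum_connected {γ : Fin 3 → ℂ} (hγ : γ ∈ g3Datum.oddPos)
    (h0 : g3Datum.form γ γ = 0) :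
    ∀ K ⊆ g3Datum.evenSimple, K.Nonempty → ∃ v ∈ K, g3Datum.pairing γ v ≠ 0 ∨
      ∃ u ∈ g3Datum.evenSimple, u ∉ K ∧ g3Datum.pairing u v ≠ 0 := by
  intro K hK ⟨v, hv⟩
  rw [g3Datum_evenSimple] at hK ⊢
  by_contra! hcon
  have h1 : ![1, 0, 0] ∈ K := by
    rcases hK hv with rfl | rfl
    · exact hv
    · by_contra hn
      have := (hcon _ hv).2 _ (Or.inl rfl) hn
      rw [g3Datum_pairing_long] at this
      simp at this
  have h2 : ![-1, 1, 0] ∈ K := by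
    by_contra hn
    have := (hcon _ h1).2 _ (Or.inr rfl) hn
    rw [g3Datum_pairing_short] at this
    norm_num at this
  have e1 := (hcon _ h1).1
  have e2 := (hcon _ h2).1
  rw [g3Datum_pairing_short] at e1
  rw [g3Datum_pairing_long] at e2
  exact g3Datum_ne_zero hγ h0 ⟨by linear_combination e1 + e2, by linear_combination e1 + 2 * e2⟩

/-- If `lam + ρ` had no `δ`-component, it would also be orthogonal to the positive odd root obtained
from `γ` by negating the `G₂`-component. That root differs from `γ`, against single atypicality. -/
lemma g3Datum_pairing_ne_zero {lam γ : Fin 3 → ℂ} (h : g3Datum.IsSinglyAtypical lam γ) :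
    g3Datum.pairing (lam + g3Datum.rho) ![0, 0, 2] ≠ 0 := by
  obtain ⟨hγ, h0, h1, h2⟩ := h
  rw [g3Datum_pairing_delta]
  intro hΛ
  have hmem : ![-γ 0, -γ 1, γ 2] ∈ g3Datum.oddPos := by
    rw [g3Datum_oddPos] at hγ ⊢
    rcases hγ with rfl | rfl | rfl | rfl | rfl | rfl | rfl <;> simp
  have h3 := h2 _ hmem (by
    rw [g3Datum_form] at h1 ⊢
    simp only [Matrix.cons_val]
    rw [hΛ] at h1 ⊢
    linear_combination -h1)
  refine g3Datum_ne_zero hγ h0 ⟨?_, ?_⟩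
  · have := congrFun h3 0
    simp only [Matrix.cons_val] at this
    linear_combination -this / 2
  · have := congrFun h3 1
    simp only [Matrix.cons_val] at this
    linear_combination -this / 2

end G3

end SuperRootDatum

namespace SuperRootDatum

/-! ### `F(4)` -/

section F4

lemma f4Datum_form (x y : Fin 4 → ℂ) : f4Datum.form x y =
    x 0 * y 0 + x 1 * y 1 + x 2 * y 2 - 3 * (x 3 * y 3) := by
  rw [form_diagonal (D := f4Datum) rfl, Fin.sum_univ_four]
  simp
  ring

lemma f4Eps_eq : f4Eps 0 = ![1, 0, 0, 0] ∧ f4Eps 1 = ![0, 1, 0, 0] ∧ f4Eps 2 = ![0, 0, 1, 0] ∧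
    f4Delta = ![0, 0, 0, 1] := by
  refine ⟨?_, ?_, ?_, ?_⟩ <;> (ext i; fin_cases i <;> simp [f4Eps, f4Delta])

lemma f4Eps_sub : (![1, 0, 0, 0] - ![0, 1, 0, 0] : Fin 4 → ℂ) = ![1, -1, 0, 0] ∧
    (![1, 0, 0, 0] - ![0, 0, 1, 0] : Fin 4 → ℂ) = ![1, 0, -1, 0] ∧
    (![0, 1, 0, 0] - ![0, 0, 1, 0] : Fin 4 → ℂ) = ![0, 1, -1, 0] := by
  refine ⟨?_, ?_, ?_⟩ <;> (ext i; fin_cases i <;> simp)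

/-- The positive roots of the subalgebra `B₃` of `F(4)`. -/
def f4Pos : Set (Fin 4 → ℂ) :=
  {![1, 0, 0, 0], ![0, 1, 0, 0], ![0, 0, 1, 0], ![1, -1, 0, 0], ![1, 1, 0, 0], ![1, 0, -1, 0],
    ![1, 0, 1, 0], ![0, 1, -1, 0], ![0, 1, 1, 0]}

lemma f4Datum_evenPos : f4Datum.evenPos = f4Pos ∪ {![0, 0, 0, 1]} := by
  obtain ⟨h0, h1, h2, h3⟩ := f4Eps_eq
  obtain ⟨h4, h5, h6⟩ := f4Eps_sub
  ext x
  simp only [f4Datum, f4Pos, Set.mem_union, Set.mem_ofPred_eq, Set.mem_insert_iff,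
    Set.mem_singleton_iff, Fin.exists_fin_succ, Fin.succ_zero_eq_one, Fin.succ_one_eq_two,
    IsEmpty.exists_iff, or_false, h0, h1, h2, h3, h4, h5, h6]
  simp
  tauto

lemma f4Datum_evenSimple :
    f4Datum.evenSimple = {![1, -1, 0, 0], ![0, 1, -1, 0], ![0, 0, 1, 0]} := by
  obtain ⟨h0, h1, h2, _⟩ := f4Eps_eq
  have h : f4Datum.evenSimple = {f4Eps 0 - f4Eps 1, f4Eps 1 - f4Eps 2, f4Eps 2} := rfl
  obtain ⟨h4, _, h6⟩ := f4Eps_sub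
  rw [h, h0, h1, h2, h4, h6]

lemma mem_f4Datum_oddPos {x : Fin 4 → ℂ} : x ∈ f4Datum.oddPos ↔
    (x 0 = 1 / 2 ∨ x 0 = -1 / 2) ∧ (x 1 = 1 / 2 ∨ x 1 = -1 / 2) ∧
      (x 2 = 1 / 2 ∨ x 2 = -1 / 2) ∧ x 3 = 1 / 2 := by
  obtain ⟨h0, h1, h2, h3⟩ := f4Eps_eq
  have key : ∀ s : Fin 3 → ℂ, (1 / 2 : ℂ) • (∑ i, s i • f4Eps i + f4Delta) =
      ![s 0 / 2, s 1 / 2, s 2 / 2, 1 / 2] := by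
    intro s
    rw [Fin.sum_univ_three, h0, h1, h2, h3]
    ext i
    fin_cases i <;> (simp; try ring)
  constructor
  · rintro ⟨s, hs, rfl⟩
    rw [key]
    refine ⟨?_, ?_, ?_, rfl⟩
    · rcases hs 0 with h | h <;> simp [h]
    · rcases hs 1 with h | h <;> simp [h]
    · rcases hs 2 with h | h <;> simp [h]
  · rintro ⟨hx0, hx1, hx2, hx3⟩
    -- The signs are twice the coordinates, which are `±1 / 2`.
    refine ⟨![2 * x 0, 2 * x 1, 2 * x 2], ?_, ?_⟩
    · intro i
      fin_cases i
      · rcases hx0 with h | h <;> (simp [h]; try norm_num)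
      · rcases hx1 with h | h <;> (simp [h]; try norm_num)
      · rcases hx2 with h | h <;> (simp [h]; try norm_num)
    · rw [key]
      ext i
      fin_cases i <;> simp [hx3]

lemma f4Datum_pairing_zero (x : Fin 4 → ℂ) : f4Datum.pairing x ![1, -1, 0, 0] = x 0 - x 1 := by
  simp only [pairing, f4Datum_form]
  simp
  ring

lemma f4Datum_pairing_one (x : Fin 4 → ℂ) : f4Datum.pairing x ![0, 1, -1, 0] = x 1 - x 2 := by
  simp only [pairing, f4Datum_form]
  simp
  ring

lemma f4Datum_pairing_two (x : Fin 4 → ℂ) : f4Datum.pairing x ![0, 0, 1, 0] = 2 * x 2 := by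
  simp only [pairing, f4Datum_form]
  simp

lemma f4Datum_pairing_delta (x : Fin 4 → ℂ) : f4Datum.pairing x ![0, 0, 0, 1] = 2 * x 3 := by
  simp only [pairing, f4Datum_form]
  simp
  ring

lemma f4Datum_sRefl_zero (x : Fin 4 → ℂ) :
    f4Datum.sRefl ![1, -1, 0, 0] x = ![x 1, x 0, x 2, x 3] := by
  rw [sRefl_apply, f4Datum_pairing_zero]
  ext i
  fin_cases i <;> simp

lemma f4Datum_sRefl_one (x : Fin 4 → ℂ) :
    f4Datum.sRefl ![0, 1, -1, 0] x = ![x 0, x 2, x 1, x 3] := by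
  rw [sRefl_apply, f4Datum_pairing_one]
  ext i
  fin_cases i <;> simp

lemma f4Datum_sRefl_two (x : Fin 4 → ℂ) :
    f4Datum.sRefl ![0, 0, 1, 0] x = ![x 0, x 1, -x 2, x 3] := by
  rw [sRefl_apply, f4Datum_pairing_two]
  ext i
  fin_cases i <;> (simp; try ring)

/-- The linear form with the given coefficients. -/
noncomputable def f4Form (a b c d : ℂ) : (Fin 4 → ℂ) →ₗ[ℂ] ℂ :=
  Fintype.linearCombination ℂ ![a, b, c, d]

@[simp] lemma f4Form_apply (a b c d : ℂ) (x : Fin 4 → ℂ) :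
    f4Form a b c d x = x 0 * a + x 1 * b + x 2 * c + x 3 * d := by
  simp [f4Form, Fintype.linearCombination_apply, Fin.sum_univ_four]

lemma f4Pos_subset_closure : f4Pos ⊆ AddSubmonoid.closure f4Datum.evenSimple := by
  have h1 : ![1, -1, 0, 0] ∈ AddSubmonoid.closure f4Datum.evenSimple :=
    AddSubmonoid.subset_closure (by simp [f4Datum_evenSimple])
  have h2 : ![0, 1, -1, 0] ∈ AddSubmonoid.closure f4Datum.evenSimple :=
    AddSubmonoid.subset_closure (by simp [f4Datum_evenSimple])
  have h3 : ![0, 0, 1, 0] ∈ AddSubmonoid.closure f4Datum.evenSimple :=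
    AddSubmonoid.subset_closure (by simp [f4Datum_evenSimple])
  have h4 : ![0, 1, 0, 0] ∈ AddSubmonoid.closure f4Datum.evenSimple := by
    simpa using add_mem h2 h3
  have h5 : ![1, 0, 0, 0] ∈ AddSubmonoid.closure f4Datum.evenSimple := by
    simpa using add_mem h1 h4
  have h6 : ![1, 0, -1, 0] ∈ AddSubmonoid.closure f4Datum.evenSimple := by
    simpa using add_mem h1 h2
  have h7 : ![1, 1, 0, 0] ∈ AddSubmonoid.closure f4Datum.evenSimple := by
    simpa using add_mem h4 h5
  have h8 : ![1, 0, 1, 0] ∈ AddSubmonoid.closure f4Datum.evenSimple := by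
    simpa using add_mem h3 h5
  have h9 : ![0, 1, 1, 0] ∈ AddSubmonoid.closure f4Datum.evenSimple := by
    simpa using add_mem h3 h4
  rintro _ (rfl | rfl | rfl | rfl | rfl | rfl | rfl | rfl | rfl)
  exacts [h5, h4, h3, h1, h7, h6, h8, h2, h9]

lemma f4Datum_sRefl_mem : ∀ β ∈ f4Datum.evenSimple, ∀ x ∈ f4Pos, x ≠ β →
    f4Datum.sRefl β x ∈ f4Pos := by
  rw [f4Datum_evenSimple]
  rintro _ (rfl | rfl | rfl) _ (rfl | rfl | rfl | rfl | rfl | rfl | rfl | rfl | rfl) hne <;>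
    first
    | exact absurd rfl hne
    | (simp only [f4Datum_sRefl_zero, f4Datum_sRefl_one, f4Datum_sRefl_two]; simp [f4Pos])

lemma f4Datum_isStandard : f4Datum.IsStandard f4Pos {![0, 0, 0, 1]} where
  symm := Matrix.diagonal_transpose _
  finite := by simp [f4Pos]
  simple_subset := by
    rw [f4Datum_evenSimple]
    rintro _ (rfl | rfl | rfl) <;> simp [f4Pos]
  subset_closure := f4Pos_subset_closure
  sRefl_mem := f4Datum_sRefl_mem
  form_ne_zero := by
    rw [f4Datum_evenSimple]
    rintro _ (rfl | rfl | rfl) <;> rw [f4Datum_form] <;> simp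
  exists_coweight := by
    rw [f4Datum_evenSimple]
    rintro _ (rfl | rfl | rfl)
    · refine ⟨f4Form 1 0 0 0, by simp, ?_⟩
      rintro _ (rfl | rfl | rfl) hne
      · exact absurd rfl hne
      · simp
      · simp
    · refine ⟨f4Form 1 1 0 0, by simp, ?_⟩
      rintro _ (rfl | rfl | rfl) hne
      · simp
      · exact absurd rfl hne
      · simp
    · refine ⟨f4Form 1 1 1 0, by simp, ?_⟩
      rintro _ (rfl | rfl | rfl) hne
      · simp
      · simp
      · exact absurd rfl hne
  evenPos_eq := f4Datum_evenPos
  subsingleton := Set.subsingleton_singleton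
  orthogonal := by
    rw [f4Datum_evenSimple]
    rintro _ (rfl | rfl | rfl) _ rfl
    · rw [f4Datum_pairing_zero]; simp
    · rw [f4Datum_pairing_one]; simp
    · rw [f4Datum_pairing_two]; simp
  form_ne_zero' := by
    rintro _ rfl
    rw [f4Datum_form]
    simp
  exists_separating := by
    rintro _ rfl
    refine ⟨f4Form 0 0 0 1, ?_, by simp⟩
    rw [f4Datum_evenSimple]
    rintro _ (rfl | rfl | rfl) <;> simp
  oddPos_finite := by
    refine (Set.Finite.pi' (fun _ : Fin 4 => Set.toFinite {(1 / 2 : ℂ), -1 / 2})).subset ?_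
    intro x hx i
    obtain ⟨h0, h1, h2, h3⟩ := mem_f4Datum_oddPos.1 hx
    fin_cases i
    exacts [h0, h1, h2, Or.inl h3]
  sRefl_oddPos := by
    rw [f4Datum_evenSimple]
    rintro _ (rfl | rfl | rfl) x hx <;>
      obtain ⟨h0, h1, h2, h3⟩ := mem_f4Datum_oddPos.1 hx <;>
      rw [mem_f4Datum_oddPos]
    · rw [f4Datum_sRefl_zero]
      exact ⟨h1, h0, h2, h3⟩
    · rw [f4Datum_sRefl_one]
      exact ⟨h0, h2, h1, h3⟩
    · rw [f4Datum_sRefl_two]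
      refine ⟨h0, h1, ?_, h3⟩
      rcases h2 with h2 | h2
      · exact Or.inr (by simp [h2, neg_div])
      · exact Or.inl (by simp [h2, neg_div])
  exists_height := by
    refine ⟨f4Form 3 2 1 1, ?_, ?_⟩
    · rw [f4Datum_evenPos, f4Pos]
      rintro _ ((rfl | rfl | rfl | rfl | rfl | rfl | rfl | rfl | rfl) | rfl)
      exacts [⟨2, by simp; norm_num⟩, ⟨1, by simp; norm_num⟩, ⟨0, by simp⟩,
        ⟨0, by simp; norm_num⟩, ⟨4, by simp; norm_num⟩, ⟨1, by simp; norm_num⟩,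
        ⟨3, by simp⟩, ⟨0, by simp; norm_num⟩, ⟨2, by simp⟩, ⟨0, by simp⟩]
    · rw [f4Datum_evenSimple]
      rintro _ (rfl | rfl | rfl) <;> simp <;> norm_num
  evenBase_subset := by
    rintro x ⟨hx, hn⟩
    rw [f4Datum_evenPos] at hx hn
    rw [f4Datum_evenSimple]
    have key : ∀ y ∈ f4Pos, ∀ z ∈ f4Pos, x ≠ y + z := fun y hy z hz hyz =>
      hn ⟨y, Or.inl hy, z, Or.inl hz, hyz⟩
    rcases hx with (rfl | rfl | rfl | rfl | rfl | rfl | rfl | rfl | rfl) | hx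
    · exact absurd (by simp)
        (key ![1, -1, 0, 0] (by simp [f4Pos]) ![0, 1, 0, 0] (by simp [f4Pos]))
    · exact absurd (by simp)
        (key ![0, 1, -1, 0] (by simp [f4Pos]) ![0, 0, 1, 0] (by simp [f4Pos]))
    · exact Or.inl (Or.inr (Or.inr rfl))
    · exact Or.inl (Or.inl rfl)
    · exact absurd (by simp)
        (key ![1, 0, 0, 0] (by simp [f4Pos]) ![0, 1, 0, 0] (by simp [f4Pos]))
    · exact absurd (by simp)
        (key ![1, -1, 0, 0] (by simp [f4Pos]) ![0, 1, -1, 0] (by simp [f4Pos]))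
    · exact absurd (by simp)
        (key ![1, 0, 0, 0] (by simp [f4Pos]) ![0, 0, 1, 0] (by simp [f4Pos]))
    · exact Or.inl (Or.inr (Or.inl rfl))
    · exact absurd (by simp)
        (key ![0, 1, 0, 0] (by simp [f4Pos]) ![0, 0, 1, 0] (by simp [f4Pos]))
    · exact Or.inr hx

/-- A counterexample `K` contains the short simple root at the end of the path. An odd root pairs
with it to `±1`. -/
lemma f4Datum_connected {γ : Fin 4 → ℂ} (hγ : γ ∈ f4Datum.oddPos) :
    ∀ K ⊆ f4Datum.evenSimple, K.Nonempty → ∃ v ∈ K, f4Datum.pairing γ v ≠ 0 ∨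
      ∃ u ∈ f4Datum.evenSimple, u ∉ K ∧ f4Datum.pairing u v ≠ 0 := by
  intro K hK ⟨v, hv⟩
  rw [f4Datum_evenSimple] at hK ⊢
  by_contra! hcon
  have h01 : ![1, -1, 0, 0] ∈ K → ![0, 1, -1, 0] ∈ K := by
    intro h
    by_contra hn
    have := (hcon _ h).2 _ (Or.inr (Or.inl rfl)) hn
    rw [f4Datum_pairing_zero] at this
    simp at this
  have h12 : ![0, 1, -1, 0] ∈ K → ![0, 0, 1, 0] ∈ K := by
    intro h
    by_contra hn
    have := (hcon _ h).2 _ (Or.inr (Or.inr rfl)) hn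
    rw [f4Datum_pairing_one] at this
    simp at this
  have h2 : ![0, 0, 1, 0] ∈ K := by
    rcases hK hv with rfl | rfl | rfl
    exacts [h12 (h01 hv), h12 hv, hv]
  have := (hcon _ h2).1
  rw [f4Datum_pairing_two] at this
  obtain ⟨_, _, h | h, _⟩ := mem_f4Datum_oddPos.1 hγ <;> rw [h] at this <;> norm_num at this

/-- As for `G(3)`, negating the `B₃`-component of `γ` would give a second atypical root; this
component is never zero. -/
lemma f4Datum_pairing_ne_zero {lam γ : Fin 4 → ℂ} (h : f4Datum.IsSinglyAtypical lam γ) :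
    f4Datum.pairing (lam + f4Datum.rho) ![0, 0, 0, 1] ≠ 0 := by
  obtain ⟨hγ, -, h1, h2⟩ := h
  obtain ⟨hx0, hx1, hx2, hx3⟩ := mem_f4Datum_oddPos.1 hγ
  rw [f4Datum_pairing_delta]
  intro hΛ
  have hΛ' : (lam + f4Datum.rho) 3 = 0 := by linear_combination hΛ / 2
  have hneg : ∀ z : ℂ, z = 1 / 2 ∨ z = -1 / 2 → -z = 1 / 2 ∨ -z = -1 / 2 := by
    rintro z (rfl | rfl)
    · exact Or.inr (by ring)
    · exact Or.inl (by ring)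
  have hmem : ![-γ 0, -γ 1, -γ 2, γ 3] ∈ f4Datum.oddPos :=
    mem_f4Datum_oddPos.2 ⟨hneg _ hx0, hneg _ hx1, hneg _ hx2, hx3⟩
  have h3 := h2 _ hmem (by
    rw [f4Datum_form] at h1 ⊢
    simp only [Matrix.cons_val]
    rw [hΛ'] at h1 ⊢
    linear_combination -h1)
  have := congrFun h3 0
  simp only [Matrix.cons_val] at this
  rcases hx0 with h | h <;> rw [h] at this <;> norm_num at this

end F4

end SuperRootDatum

/-! ### The theorem for the four families -/

theorem mainTheorem6 :
    (∀ (m n : ℕ) (lam γ : Fin (m + 1) ⊕ Fin (n + 1) → ℂ),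
      (slDatum m n).IsDominantIntegral lam → (slDatum m n).IsSinglyAtypical lam γ →
        (slDatum m n).HasNonzeroCoeff (slDatum m n).evenSimple (slDatum m n).evenSimple genericFactor lam γ ∧
        ∀ B, (slDatum m n).IsExpansionSet lam B →
          (slDatum m n).HasNonzeroCoeff (slDatum m n).evenBase B genericFactor lam γ) ∧
    (∀ (r : ℕ) (lam γ : Unit ⊕ Fin (r + 1) → ℂ),
      (ospDatum r).IsDominantIntegral lam → (ospDatum r).IsSinglyAtypical lam γ →
        (ospDatum r).HasNonzeroCoeff (ospDatum r).evenSimple (ospDatum r).evenSimple genericFactor lam γ ∧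
        ∀ B, (ospDatum r).IsExpansionSet lam B →
          (ospDatum r).HasNonzeroCoeff (ospDatum r).evenBase B genericFactor lam γ) ∧
    (∀ (lam γ : Fin 3 → ℂ),
      g3Datum.IsDominantIntegral lam → g3Datum.IsSinglyAtypical lam γ →
        (g3Datum.HasNonzeroCoeff g3Datum.evenSimple g3Datum.evenSimple genericFactor lam γ ∧
        ∀ B, g3Datum.IsExpansionSet lam B →
          g3Datum.HasNonzeroCoeff g3Datum.evenBase B genericFactor lam γ) ∧
        (g3Datum.HasNonzeroCoeff g3Datum.evenSimple g3Datum.evenSimple specialFactor lam γ ∧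
        ∀ B, g3Datum.IsExpansionSet lam B →
          g3Datum.HasNonzeroCoeff g3Datum.evenBase B specialFactor lam γ)) ∧
    (∀ (lam γ : Fin 4 → ℂ),
      f4Datum.IsDominantIntegral lam → f4Datum.IsSinglyAtypical lam γ →
        (f4Datum.HasNonzeroCoeff f4Datum.evenSimple f4Datum.evenSimple genericFactor lam γ ∧
        ∀ B, f4Datum.IsExpansionSet lam B →
          f4Datum.HasNonzeroCoeff f4Datum.evenBase B genericFactor lam γ) ∧
        (f4Datum.HasNonzeroCoeff f4Datum.evenSimple f4Datum.evenSimple specialFactor lam γ ∧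
        ∀ B, f4Datum.IsExpansionSet lam B →
          f4Datum.HasNonzeroCoeff f4Datum.evenBase B specialFactor lam γ)) := by
  have generic : ∀ {σ : Type} (z : MvPowerSeries σ ℂ), MvPowerSeries.constantCoeff z = 0 →
      ∃ r, genericFactor z = 1 + MvPowerSeries.C (-1) * z + z * z * r :=
    fun z hz => SuperRootDatum.exists_genericFactor hz
  have special : ∀ {σ : Type} (z : MvPowerSeries σ ℂ), MvPowerSeries.constantCoeff z = 0 →
      ∃ r, specialFactor z = 1 + MvPowerSeries.C (-1 / 2) * z + z * z * r :=
    fun z hz => SuperRootDatum.exists_specialFactor hz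
  have h1 : (-1 : ℂ) ≠ 0 := by norm_num
  have h2 : (-1 / 2 : ℂ) ≠ 0 := by norm_num
  refine ⟨?_, ?_, ?_, ?_⟩
  · intro m n lam γ hlam hγ
    exact (SuperRootDatum.slDatum_isStandard m n).hasNonzeroCoeff hlam hγ.1
      (SuperRootDatum.slDatum_connected m n hγ.1) (fun _ h => h.elim) h1 generic
  · intro r lam γ hlam hγ
    exact (SuperRootDatum.ospDatum_isStandard r).hasNonzeroCoeff hlam hγ.1
      (SuperRootDatum.ospDatum_connected r hγ.1) (fun _ h => h.elim) h1 generic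
  · intro lam γ hlam hγ
    have hE : ∀ d ∈ ({![0, 0, 2]} : Set (Fin 3 → ℂ)),
        g3Datum.pairing (lam + g3Datum.rho) d ≠ 0 := by
      rintro _ rfl
      exact SuperRootDatum.g3Datum_pairing_ne_zero hγ
    have hcon := SuperRootDatum.g3Datum_connected hγ.1 hγ.2.1
    exact ⟨SuperRootDatum.g3Datum_isStandard.hasNonzeroCoeff hlam hγ.1 hcon hE h1 generic,
      SuperRootDatum.g3Datum_isStandard.hasNonzeroCoeff hlam hγ.1 hcon hE h2 special⟩
  · intro lam γ hlam hγ
    have hE : ∀ d ∈ ({![0, 0, 0, 1]} : Set (Fin 4 → ℂ)),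
        f4Datum.pairing (lam + f4Datum.rho) d ≠ 0 := by
      rintro _ rfl
      exact SuperRootDatum.f4Datum_pairing_ne_zero hγ
    have hcon := SuperRootDatum.f4Datum_connected hγ.1
    exact ⟨SuperRootDatum.f4Datum_isStandard.hasNonzeroCoeff hlam hγ.1 hcon hE h1 generic,
      SuperRootDatum.f4Datum_isStandard.hasNonzeroCoeff hlam hγ.1 hcon hE h2 special⟩
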